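/- All monoids are commutative with unit, and homomorphisms preserve units. An ideal of a monoid $A$ is a subset $\mathfrak a\subseteq A$ (possibly empty) with $\mathfrak a A\subseteq\mathfrak a$; it is prime if $\mathfrak a\neq A$ and $xy\in\mathfrak a$ implies $x\in\mathfrak a$ or $y\in\mathfrak a$. $\operatorname{Spec}A$ is the set of prime ideals of $A$, with closed sets $V(\mathfrak a)=\{\mathfrak p:\mathfrak p\supseteq\mathfrak a\}$, and with the sheaf of monoids whose sections over an open set $U$ are the functions $s\colon U\to\coprod_{\mathfrak p\in U}A_{\mathfrak p}$ with $s(\mathfrak p)\in A_{\mathfrak p}$ that are locally of the form $a/f$ with $a,f\in A$; here $A_{\mathfrak p}$ is the localization of $A$ at the submonoid $A\setminus\mathfrak p$. A monoidal space is a topological space with a sheaf of monoids. A morphism of monoidal spaces is a pair $(f,f^\#)$ consisting of a continuous map $f\colon X\to Y$ and a morphism of sheaves of monoids $f^\#\colon\mathcal O_Y\to f_*\mathcal O_X$; it is local if on every stalk a germ whose image is invertible is itself invertible. An $\mathbb F_1$-scheme is a monoidal space in which every point has an open neighbourhood isomorphic, as a monoidal space, to some $\operatorname{Spec}A$; morphisms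 of $\mathbb F_1$-schemes are the local morphisms of monoidal spaces. Every homomorphism $\varphi\colon A\to B$ of monoids induces a morphism $\operatorname{Spec}\varphi\colon\operatorname{Spec}B\to\operatorname{Spec}A$, $\mathfrak p\mapsto\varphi^{-1}(\mathfrak p)$. The base extension $X\mapsto X\otimes\mathbb Z$ is the functor from $\mathbb F_1$-schemes to schemes that glues the affine schemes $\operatorname{Spec}\mathbb Z[\mathcal O_X(U)]$, $U\subseteq X$ affine open, along the maps induced by the inclusions $U\subseteq U'$; here $\mathbb Z[A]$ is the monoid ring of $A$. **Proposition.** 1. Let $f\colon X\to S$ and $g\colon Y\to S$ be morphisms of $\mathbb F_1$-schemes. There are an $\mathbb F_1$-scheme $X\times_SY$ and morphisms $p\colon X\times_SY\to X$, $q\colon X\times_SY\to Y$ with $fp=gq$ such that, for every $\mathbb F_1$-scheme $Z$ over $S$, composition with $p$ and $q$ gives a bijection $$\operatorname{Hom}_S(Z,X\times_SY)\ \to\ \operatorname{Hom}_S(Z,X)\times\operatorname{Hom}_S(Z,Y).$$ The triple $(X\times_SY,p,q)$ is unique up to a unique isomorphism compatible with the projections to $X$ and $Y$. 2. Let $L,A,B$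 be monoids. Every morphism $\operatorname{Spec}A\to\operatorname{Spec}L$ of $\mathbb F_1$-schemes is $\operatorname{Spec}\varphi$ for a unique homomorphism $\varphi\colon L\to A$. For homomorphisms $\varphi\colon L\to A$ and $\psi\colon L\to B$, let $A\otimes_LB$ be the monoid $(A\times B)/\!\sim$, where $\sim$ is the equivalence relation generated by $(\varphi(l)m,n)\sim(m,\psi(l)n)$ for $l\in L$, $m\in A$, $n\in B$. Then $A\otimes_LB$, with the maps $a\mapsto[a,1]$ and $b\mapsto[1,b]$, is the push-out of $\varphi$ and $\psi$ in the category of monoids, and $\operatorname{Spec}(A\otimes_LB)$, with the induced projections, is the fibre product of $\operatorname{Spec}A$ and $\operatorname{Spec}B$ over $\operatorname{Spec}L$ (via $\operatorname{Spec}\varphi$ and $\operatorname{Spec}\psi$). 3. Base extension takes fibre products of $\mathbb F_1$-schemes to fibre products of schemes: for every fibre product $X\times_SY$ of $\mathbb F_1$-schemes, the canonical morphism $$(X\times_SY)\otimes\mathbb Z\ \to\ (X\otimes\mathbb Z)\times_{S\otimes\mathbb Z}(Y\otimes\mathbb Z)$$ is an isomorphism. -/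

import Mathlib

open CategoryTheory CategoryTheory.Limits TopologicalSpace Opposite AlgebraicGeometry

universe u

namespace FOne

noncomputable section

/-! ### Colimits of commutative monoids -/

section Colimits

variable {J : Type u} [Category.{u} J] (F : J ⥤ CommMonCat.{u})

/-- Free commutative monoid on the disjoint union of the monoids of a diagram. -/
abbrev ColimFree : Type u := Multiplicative (Multiset (Σ j, F.obj j))

/-- A generator of the free commutative monoid. -/
def colimGen (j : J) (x : F.obj j) : ColimFree F := Multiplicative.ofAdd {⟨j, x⟩}

/-- The relations cutting the colimit out of the free commutative monoid. -/
inductive ColimRel : ColimFree F → ColimFree F → Prop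
  | one (j : J) : ColimRel (colimGen F j 1) 1
  | mul (j : J) (x y : F.obj j) : ColimRel (colimGen F j (x * y)) (colimGen F j x * colimGen F j y)
  | map {i j : J} (f : i ⟶ j) (x : F.obj i) : ColimRel (colimGen F j (F.map f x)) (colimGen F i x)

/-- The colimit of a diagram of commutative monoids. -/
abbrev ColimObj : Type u := (conGen (ColimRel F)).Quotient

/-- The canonical map into the colimit. -/
def colimIota (j : J) : F.obj j →* ColimObj F where
  toFun x := (conGen (ColimRel F)).mk' (colimGen F j x)
  map_one' := (Con.eq _).2 (ConGen.Rel.of _ _ (.one j))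
  map_mul' x y := (Con.eq _).2 (ConGen.Rel.of _ _ (.mul j x y))

/-- The colimit cocone. -/
def colimCocone : Cocone F where
  pt := CommMonCat.of (ColimObj F)
  ι :=
    { app := fun j => CommMonCat.ofHom (colimIota F j)
      naturality := fun i j f => by
        ext x
        exact (Con.eq _).2 (ConGen.Rel.of _ _ (.map f x)) }

/-- The map out of the free commutative monoid induced by a cocone. -/
def colimFreeDesc (s : Cocone F) : ColimFree F →* s.pt where
  toFun m := (m.toAdd.map fun p : Σ j, F.obj j => (s.ι.app p.1) p.2).prod
  map_one' := by simp
  map_mul' a b := by simp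

lemma colimFreeDesc_gen (s : Cocone F) (j : J) (x : F.obj j) :
    colimFreeDesc F s (colimGen F j x) = s.ι.app j x := by
  simp [colimFreeDesc, colimGen]

/-- The map out of the colimit induced by a cocone. -/
def colimDesc (s : Cocone F) : ColimObj F →* s.pt :=
  (conGen (ColimRel F)).lift (colimFreeDesc F s) (by
    rw [Con.conGen_le]
    intro a b h
    change colimFreeDesc F s a = colimFreeDesc F s b
    induction h with
    | one j => simp [colimFreeDesc_gen]
    | mul j x y => simp [colimFreeDesc_gen]
    | map f x =>
      rw [colimFreeDesc_gen, colimFreeDesc_gen, ← s.w f]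
      rfl)

/-- The colimit cocone is a colimit. -/
def colimIsColimit : IsColimit (colimCocone F) where
  desc s := CommMonCat.ofHom (colimDesc F s)
  fac s j := by
    ext x
    exact colimFreeDesc_gen F s j x
  uniq s m hm := by
    ext x
    induction x using Con.induction_on with
    | H x =>
      change (m.hom.comp (conGen (ColimRel F)).mk') x = colimFreeDesc F s x
      refine Multiset.induction_on (p := fun y => (m.hom.comp (conGen (ColimRel F)).mk')
        (Multiplicative.ofAdd y) = colimFreeDesc F s (Multiplicative.ofAdd y)) x.toAdd ?_ ?_
      · exact (map_one (m.hom.comp (conGen (ColimRel F)).mk')).trans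
          (map_one (colimFreeDesc F s)).symm
      · rintro ⟨j, a⟩ t ht
        rw [← Multiset.singleton_add, ofAdd_add, map_mul, map_mul, ht]
        congr 1
        refine Eq.trans ?_ (colimFreeDesc_gen F s j a).symm
        rw [← hm j]
        rfl

end Colimits

instance : HasColimits CommMonCat.{u} where
  has_colimits_of_shape _ _ := { has_colimit := fun F => ⟨⟨_, colimIsColimit F⟩⟩ }

/-! ### Prime ideals and the spectrum of a monoid -/

/-- A prime ideal of a commutative monoid `A`: a proper ideal `𝔞` (`𝔞 A ⊆ 𝔞`, possibly empty)
such that `x y ∈ 𝔞` implies `x ∈ 𝔞` or `y ∈ 𝔞`. -/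
structure PrimeIdeal (A : Type u) [CommMonoid A] where
  /-- the underlying ideal -/
  ideal : SemigroupIdeal A
  ne_top : ideal ≠ ⊤
  mem_or_mem : ∀ x y : A, x * y ∈ ideal → x ∈ ideal ∨ y ∈ ideal

namespace PrimeIdeal

variable {A B : Type u} [CommMonoid A] [CommMonoid B]

@[ext]
lemma ext' {p q : PrimeIdeal A} (h : ∀ a, a ∈ p.ideal ↔ a ∈ q.ideal) : p = q := by
  obtain ⟨p, _, _⟩ := p
  obtain ⟨q, _, _⟩ := q
  obtain rfl : p = q := SetLike.ext h
  rfl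

lemma mul_mem_right (p : PrimeIdeal A) {a : A} (b : A) (h : a ∈ p.ideal) : b * a ∈ p.ideal :=
  p.ideal.smul_mem b h

lemma mul_mem_left (p : PrimeIdeal A) {a : A} (b : A) (h : a ∈ p.ideal) : a * b ∈ p.ideal :=
  mul_comm b a ▸ p.mul_mem_right b h

lemma one_notMem (p : PrimeIdeal A) : (1 : A) ∉ p.ideal := fun h =>
  p.ne_top (SetLike.ext fun a => ⟨fun _ => trivial, fun _ => mul_one a ▸ p.mul_mem_right a h⟩)

/-- The complement of a prime ideal is a submonoid. -/
def compl (p : PrimeIdeal A) : Submonoid A where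
  carrier := {a | a ∉ p.ideal}
  one_mem' := p.one_notMem
  mul_mem' {a b} ha hb h := (p.mem_or_mem a b h).elim ha hb

lemma mem_compl {p : PrimeIdeal A} {a : A} : a ∈ p.compl ↔ a ∉ p.ideal := Iff.rfl

/-- Construct a prime ideal from its membership predicate. -/
def mk' (P : A → Prop) (h1 : ¬ P 1) (h : ∀ a b, P (a * b) ↔ P a ∨ P b) : PrimeIdeal A where
  ideal := { carrier := {a | P a}, smul_mem' := fun b _ ha => (h b _).2 (Or.inr ha) }
  ne_top e := h1 ((SetLike.ext_iff.1 e 1).2 trivial)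
  mem_or_mem a b hab := (h a b).1 hab

/-- The preimage of a prime ideal. -/
def comap (φ : A →* B) (p : PrimeIdeal B) : PrimeIdeal A :=
  mk' (fun a => φ a ∈ p.ideal) (by simpa using p.one_notMem) (fun a b => by
    rw [map_mul]
    exact ⟨p.mem_or_mem _ _, fun h => h.elim (p.mul_mem_left _) (p.mul_mem_right _)⟩)

lemma mem_comap {φ : A →* B} {p : PrimeIdeal B} {a : A} :
    a ∈ (comap φ p).ideal ↔ φ a ∈ p.ideal := Iff.rfl

/-- `V(𝔞)`: the set of primes containing the ideal `𝔞`. -/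
def zeroLocus (a : SemigroupIdeal A) : Set (PrimeIdeal A) := {p | a ≤ p.ideal}

/-- The closed sets of the spectrum are the sets `V(𝔞)`; the empty set is `V(A)`. -/
instance : TopologicalSpace (PrimeIdeal A) :=
  TopologicalSpace.ofClosed {Z | ∃ a : SemigroupIdeal A, Z = zeroLocus a}
    ⟨⊤, by
      ext p
      simp only [Set.mem_empty_iff_false, zeroLocus, Set.mem_ofPred_eq, false_iff]
      exact fun h => p.ne_top (top_le_iff.1 h)⟩
    (by
      intro S hS
      choose a ha using fun Z : S => hS Z.2
      refine ⟨⨆ Z : S, a Z, ?_⟩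
      ext p
      simp only [Set.mem_sInter, zeroLocus, Set.mem_ofPred_eq, iSup_le_iff, Subtype.forall]
      refine forall₂_congr fun Z hZ => ?_
      conv_lhs => rw [show Z = _ from ha ⟨Z, hZ⟩]
      rfl)
    (by
      rintro _ ⟨a, rfl⟩ _ ⟨b, rfl⟩
      refine ⟨a ⊓ b, ?_⟩
      ext p
      simp only [Set.mem_union, zeroLocus, Set.mem_ofPred_eq]
      constructor
      · rintro (h | h)
        · exact inf_le_left.trans h
        · exact inf_le_right.trans h
      · intro h
        by_contra! hc
        obtain ⟨x, hx, hxp⟩ := SetLike.not_le_iff_exists.1 hc.1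
        obtain ⟨y, hy, hyp⟩ := SetLike.not_le_iff_exists.1 hc.2
        have : x * y ∈ p.ideal := h ⟨mul_comm y x ▸ a.smul_mem y hx, b.smul_mem x hy⟩
        exact (p.mem_or_mem _ _ this).elim hxp hyp)

lemma isClosed_iff (Z : Set (PrimeIdeal A)) : IsClosed Z ↔ ∃ a, Z = zeroLocus a := by
  rw [← isOpen_compl_iff]
  change (Zᶜ)ᶜ ∈ _ ↔ _
  rw [compl_compl]
  rfl

/-- The basic open set `D(f)` of the primes not containing `f`. -/
def basicOpen (f : A) : Opens (PrimeIdeal A) where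
  carrier := {p | f ∉ p.ideal}
  is_open' := by
    rw [← isClosed_compl_iff, isClosed_iff]
    refine ⟨SemigroupIdeal.closure {f}, ?_⟩
    ext p
    simp only [Set.mem_compl_iff, Set.mem_ofPred_eq, not_not, zeroLocus]
    exact ⟨fun h => SubMulAction.closure_le.2 (by simpa using h),
      fun h => h (SemigroupIdeal.mem_closure_of_mem rfl)⟩

lemma mem_basicOpen {f : A} {p : PrimeIdeal A} : p ∈ basicOpen f ↔ f ∉ p.ideal := Iff.rfl

lemma exists_basicOpen_le {p : PrimeIdeal A} {U : Opens (PrimeIdeal A)} (h : p ∈ U) :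
    ∃ f, p ∈ basicOpen f ∧ basicOpen f ≤ U := by
  obtain ⟨a, ha⟩ := (isClosed_iff (U : Set (PrimeIdeal A))ᶜ).1 U.2.isClosed_compl
  have hp : ¬ a ≤ p.ideal := fun h' => (ha ▸ h' : p ∈ (U : Set _)ᶜ) h
  obtain ⟨f, hf, hfp⟩ := SetLike.not_le_iff_exists.1 hp
  refine ⟨f, hfp, fun q hq => ?_⟩
  by_contra hqU
  have : q ∈ zeroLocus a := ha ▸ hqU
  exact hq (this hf)

lemma continuous_comap (φ : A →* B) : Continuous (comap φ) := by
  rw [continuous_def]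
  intro U hU
  rw [isOpen_iff_forall_mem_open]
  intro p hp
  obtain ⟨f, hf, hfU⟩ := exists_basicOpen_le (U := ⟨U, hU⟩) hp
  exact ⟨basicOpen (φ f), fun q hq => hfU (show comap φ q ∈ basicOpen f from hq),
    (basicOpen _).2, hf⟩

end PrimeIdeal


/-! ### The structure sheaf -/

/-- The underlying topological space of `Spec A`. -/
def specTop (A : CommMonCat.{u}) : TopCat.{u} := TopCat.of (PrimeIdeal A)

/-- The submonoid `A ∖ 𝔭`. -/
def specCompl {A : CommMonCat.{u}} (p : specTop A) : Submonoid A := PrimeIdeal.compl (A := A) p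

/-- The localization `A_𝔭` at a prime ideal. -/
abbrev LocAt {A : CommMonCat.{u}} (p : specTop A) : Type u :=
  Localization (specCompl p)

/-- The fraction `a / f` in `A_𝔭`. -/
def frac {A : CommMonCat.{u}} (p : specTop A) (a f : A)
    (h : f ∈ specCompl p) : LocAt p :=
  Localization.mk a ⟨f, h⟩

section frac

variable {A : CommMonCat.{u}} {p : specTop A}

lemma frac_eq_iff {a b f g : A} {hf hg} :
    frac p a f hf = frac p b g hg ↔
      ∃ c ∈ specCompl p, c * (g * a) = c * (f * b) := by
  rw [frac, frac, Localization.mk_eq_mk_iff, Localization.r_iff_exists]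
  exact ⟨fun ⟨c, hc⟩ => ⟨c, c.2, hc⟩, fun ⟨c, h, hc⟩ => ⟨⟨c, h⟩, hc⟩⟩

lemma exists_frac (x : LocAt p) : ∃ a f h, x = frac p a f h := by
  induction x using Localization.ind with
  | H y => exact ⟨y.1, y.2.1, y.2.2, rfl⟩

lemma frac_mul {a b f g : A} {hf hg} :
    frac p a f hf * frac p b g hg = frac p (a * b) (f * g) (mul_mem hf hg) :=
  Localization.mk_mul ..

lemma frac_one : frac p 1 1 (one_mem _) = 1 := Localization.mk_one

lemma isUnit_frac_iff {a f : A} {hf} :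
    IsUnit (frac p a f hf) ↔ a ∈ specCompl p := by
  constructor
  · rintro h
    obtain ⟨y, hy⟩ := isUnit_iff_exists_inv.1 h
    obtain ⟨b, g, hg, rfl⟩ := exists_frac y
    rw [frac_mul, ← frac_one, frac_eq_iff] at hy
    obtain ⟨c, hc, h⟩ := hy
    have h2 : c * (1 * (a * b)) ∈ specCompl p := by
      rw [h]
      exact mul_mem hc (mul_mem (mul_mem hf hg) (one_mem _))
    intro ha
    exact h2 (PrimeIdeal.mul_mem_right _ _ (PrimeIdeal.mul_mem_right _ _
      (PrimeIdeal.mul_mem_left _ _ ha)))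
  · intro ha
    refine isUnit_iff_exists_inv.2 ⟨frac p f a ha, ?_⟩
    rw [frac_mul, ← frac_one, frac_eq_iff]
    exact ⟨1, one_mem _, by simp [mul_comm]⟩

end frac

/-- A section is a fraction on `U` if it is of the form `𝔭 ↦ a / f` on `U`. -/
def fractionPrelocal (A : CommMonCat.{u}) :
    TopCat.PrelocalPredicate (fun p : specTop A => LocAt p) where
  pred {U} s := ∃ a f : A, ∀ p : U, ∃ h : f ∈ specCompl p.1,
    s p = frac p.1 a f h
  res := by
    rintro U V i s ⟨a, f, h⟩
    exact ⟨a, f, fun p => h (i p)⟩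

/-- The sections `s : U → ∐ A_𝔭` that are locally quotients of elements of `A`. -/
def sectionsSubmonoid (A : CommMonCat.{u}) (U : Opens (specTop A)) :
    Submonoid (∀ p : U, LocAt p.1) where
  carrier := {s | (fractionPrelocal A).sheafify.pred s}
  one_mem' p := ⟨U, p.2, 𝟙 _, 1, 1, fun q => ⟨one_mem _, frac_one.symm⟩⟩
  mul_mem' {s t} hs ht p := by
    obtain ⟨V, hV, i, a, f, h⟩ := hs p
    obtain ⟨W, hW, j, b, g, k⟩ := ht p
    refine ⟨V ⊓ W, ⟨hV, hW⟩, Opens.infLELeft _ _ ≫ i, a * b, f * g, fun q => ?_⟩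
    obtain ⟨h1, h2⟩ := h ⟨q.1, q.2.1⟩
    obtain ⟨k1, k2⟩ := k ⟨q.1, q.2.2⟩
    exact ⟨mul_mem h1 k1, (congr_arg₂ (· * ·) h2 k2).trans frac_mul⟩

/-- The structure presheaf of `Spec A`. -/
def specPresheaf (A : CommMonCat.{u}) : TopCat.Presheaf CommMonCat.{u} (specTop A) where
  obj U := CommMonCat.of (sectionsSubmonoid A U.unop)
  map {U V} i := CommMonCat.ofHom
    { toFun := fun s => ⟨fun p => s.1 (i.unop p),
        (fractionPrelocal A).sheafify.res i.unop s.1 s.2⟩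
      map_one' := rfl
      map_mul' := fun _ _ => rfl }

lemma specPresheaf_isSheaf (A : CommMonCat.{u}) : (specPresheaf A).IsSheaf :=
  (TopCat.Presheaf.isSheaf_iff_isSheaf_comp (CategoryTheory.forget CommMonCat) _).2
    (TopCat.Presheaf.isSheaf_of_iso (F := (TopCat.subsheafToTypes (fractionPrelocal A).sheafify).1)
      (NatIso.ofComponents (fun _ => Iso.refl _)) (TopCat.subsheafToTypes _).2)

/-- The monoidal space `(Spec A, 𝒪_A)`. -/
def specSpace (A : CommMonCat.{u}) : SheafedSpace CommMonCat.{u} where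
  carrier := specTop A
  presheaf := specPresheaf A
  IsSheaf := specPresheaf_isSheaf A

/-- The value of a section at a point. -/
def secVal {A : CommMonCat.{u}} {U : Opens (specTop A)} (s : (specPresheaf A).obj (op U)) (p : U) :
    LocAt p.1 := s.1 p

lemma sec_ext {A : CommMonCat.{u}} {U : Opens (specTop A)} {s t : (specPresheaf A).obj (op U)}
    (h : ∀ p : U, secVal s p = secVal t p) : s = t :=
  Subtype.ext (funext h)

lemma secVal_map {A : CommMonCat.{u}} {U V : Opens (specTop A)} (i : V ⟶ U)
    (s : (specPresheaf A).obj (op U)) (p : V) :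
    secVal ((specPresheaf A).map i.op s) p = secVal s (i p) := rfl

lemma secVal_mul {A : CommMonCat.{u}} {U : Opens (specTop A)} (s t : (specPresheaf A).obj (op U))
    (p : U) : secVal (s * t) p = secVal s p * secVal t p := rfl

lemma secVal_one {A : CommMonCat.{u}} {U : Opens (specTop A)} (p : U) :
    secVal (1 : (specPresheaf A).obj (op U)) p = 1 := rfl

lemma sec_locally {A : CommMonCat.{u}} {U : Opens (specTop A)} (s : (specPresheaf A).obj (op U))
    (p : U) : ∃ (V : Opens (specTop A)) (_ : p.1 ∈ V) (i : V ⟶ U) (a f : A),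
      ∀ q : V, ∃ h : f ∈ specCompl q.1, secVal s (i q) = frac q.1 a f h :=
  s.2 p

/-- The section `𝔭 ↦ a / f` over an open subset of `D(f)`. -/
def secFrac {A : CommMonCat.{u}} (U : Opens (specTop A)) (a f : A)
    (h : ∀ p ∈ U, f ∈ specCompl p) : (specPresheaf A).obj (op U) :=
  ⟨fun p => frac p.1 a f (h p.1 p.2), fun p => ⟨U, p.2, 𝟙 _, a, f, fun q => ⟨h q.1 q.2, rfl⟩⟩⟩

lemma secVal_secFrac {A : CommMonCat.{u}} {U : Opens (specTop A)} {a f : A} {h} (p : U) :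
    secVal (secFrac U a f h) p = frac p.1 a f (h p.1 p.2) := rfl

/-- Two germs agree iff the values agree. -/
lemma germ_eq_iff {A : CommMonCat.{u}} {U V : Opens (specTop A)} (p : specTop A) (hU : p ∈ U)
    (hV : p ∈ V) (s : (specPresheaf A).obj (op U)) (t : (specPresheaf A).obj (op V)) :
    (specPresheaf A).germ U p hU s = (specPresheaf A).germ V p hV t ↔
      secVal s ⟨p, hU⟩ = secVal t ⟨p, hV⟩ := by
  constructor
  · intro h
    obtain ⟨W, hW, i, j, e⟩ := (specPresheaf A).germ_eq p hU hV s t h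
    exact congr_arg (fun s => secVal s ⟨p, hW⟩) e
  · intro h
    obtain ⟨U', hU', i, a, f, hs⟩ := sec_locally s ⟨p, hU⟩
    obtain ⟨V', hV', j, b, g, ht⟩ := sec_locally t ⟨p, hV⟩
    obtain ⟨h1, h2⟩ := hs ⟨p, hU'⟩
    obtain ⟨h3, h4⟩ := ht ⟨p, hV'⟩
    have h5 : frac p a f h1 = frac p b g h3 := h2.symm.trans (h.trans h4)
    obtain ⟨c, hc, e⟩ := frac_eq_iff.1 h5
    let W : Opens (specTop A) := (U' ⊓ V') ⊓ PrimeIdeal.basicOpen (A := A) c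
    have hWU : W ≤ U' := inf_le_left.trans inf_le_left
    have hWV : W ≤ V' := inf_le_left.trans inf_le_right
    refine (specPresheaf A).germ_ext W ⟨⟨hU', hV'⟩, hc⟩ (homOfLE hWU ≫ i) (homOfLE hWV ≫ j) ?_
    refine sec_ext fun q => ?_
    obtain ⟨k1, k2⟩ := hs ⟨q.1, hWU q.2⟩
    obtain ⟨k3, k4⟩ := ht ⟨q.1, hWV q.2⟩
    exact k2.trans ((frac_eq_iff.2 ⟨c, q.2.2, e⟩).trans k4.symm)

/-- Every germ is the germ of a fraction on a basic open set. -/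
lemma exists_germ_frac {A : CommMonCat.{u}} (p : specTop A) (x : (specPresheaf A).stalk p) :
    ∃ (a f : A) (h : f ∈ specCompl p),
      x = (specPresheaf A).germ (PrimeIdeal.basicOpen (A := A) f) p h
        (secFrac _ a f fun _ h => h) := by
  obtain ⟨U, hU, s, rfl⟩ := (specPresheaf A).exists_germ_eq x
  obtain ⟨a, f, h, e⟩ := exists_frac (secVal s ⟨p, hU⟩)
  exact ⟨a, f, h, (germ_eq_iff _ _ _ _ _).2 e⟩

lemma germ_mul_germ_eq_iff {A : CommMonCat.{u}} {U V W : Opens (specTop A)} (p : specTop A)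
    (hU : p ∈ U) (hV : p ∈ V) (hW : p ∈ W) (s : (specPresheaf A).obj (op U))
    (t : (specPresheaf A).obj (op V)) (w : (specPresheaf A).obj (op W)) :
    (specPresheaf A).germ U p hU s * (specPresheaf A).germ V p hV t =
        (specPresheaf A).germ W p hW w ↔
      secVal s ⟨p, hU⟩ * secVal t ⟨p, hV⟩ = secVal w ⟨p, hW⟩ := by
  have hUV : p ∈ U ⊓ V := ⟨hU, hV⟩
  have h1 : (specPresheaf A).germ U p hU s * (specPresheaf A).germ V p hV t =
      (specPresheaf A).germ (U ⊓ V) p hUV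
        ((specPresheaf A).map (Opens.infLELeft U V).op s *
          (specPresheaf A).map (Opens.infLERight U V).op t) := by
    rw [map_mul, TopCat.Presheaf.germ_res_apply, TopCat.Presheaf.germ_res_apply]
  rw [h1]
  exact germ_eq_iff _ _ _ _ _

lemma germ_mul_germ_eq_one_iff {A : CommMonCat.{u}} {U V : Opens (specTop A)} (p : specTop A)
    (hU : p ∈ U) (hV : p ∈ V) (s : (specPresheaf A).obj (op U)) (t : (specPresheaf A).obj (op V)) :
    (specPresheaf A).germ U p hU s * (specPresheaf A).germ V p hV t = 1 ↔
      secVal s ⟨p, hU⟩ * secVal t ⟨p, hV⟩ = 1 := by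
  rw [← map_one ((specPresheaf A).germ U p hU).hom]
  exact germ_mul_germ_eq_iff p hU hV hU s t 1

lemma isUnit_germ_iff {A : CommMonCat.{u}} {U : Opens (specTop A)} (p : specTop A) (hU : p ∈ U)
    (s : (specPresheaf A).obj (op U)) :
    IsUnit ((specPresheaf A).germ U p hU s) ↔ IsUnit (secVal s ⟨p, hU⟩) := by
  rw [isUnit_iff_exists_inv, isUnit_iff_exists_inv]
  constructor
  · rintro ⟨y, hy⟩
    obtain ⟨b, g, hg, rfl⟩ := exists_germ_frac p y
    exact ⟨_, (germ_mul_germ_eq_one_iff (V := PrimeIdeal.basicOpen (A := A) g) p hU hg s _).1 hy⟩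
  · rintro ⟨y, hy⟩
    obtain ⟨b, g, hg, rfl⟩ := exists_frac y
    exact ⟨(specPresheaf A).germ (PrimeIdeal.basicOpen (A := A) g) p hg
      (secFrac _ b g fun _ h => h), (germ_mul_germ_eq_one_iff _ _ _ _ _).2 hy⟩

/-! ### Functoriality of the spectrum -/

section Map

variable {A B : CommMonCat.{u}} (φ : A ⟶ B)

/-- The map on spectra `𝔭 ↦ φ⁻¹(𝔭)`. -/
def specTopMap : specTop B ⟶ specTop A :=
  TopCat.ofHom ⟨PrimeIdeal.comap φ.hom, PrimeIdeal.continuous_comap φ.hom⟩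

/-- The localized map `A_{φ⁻¹(𝔭)} → B_𝔭`. -/
def locMap (p : specTop B) : LocAt (specTopMap φ p) →* LocAt p :=
  (Localization.monoidOf _).map (T := specCompl p) (g := φ.hom)
    (fun y => y.2) (Localization.monoidOf _)

lemma map_mem_specCompl (p : specTop B) {f : A} (h : f ∈ specCompl (specTopMap φ p)) :
    φ f ∈ specCompl p := h

lemma locMap_frac (p : specTop B) (a f : A) (h) :
    locMap φ p (frac _ a f h) = frac p (φ a) (φ f) (map_mem_specCompl φ p h) := by
  unfold frac
  rw [Localization.mk_eq_monoidOf_mk'_apply, Localization.mk_eq_monoidOf_mk'_apply]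
  exact Submonoid.LocalizationMap.map_mk' ..

lemma isUnit_of_locMap (p : specTop B) (x : LocAt (specTopMap φ p))
    (h : IsUnit (locMap φ p x)) : IsUnit x := by
  obtain ⟨a, f, hf, rfl⟩ := exists_frac x
  rw [locMap_frac] at h
  exact isUnit_frac_iff.2 (isUnit_frac_iff.1 h :)

/-- The map on sections of the structure sheaves induced by `φ`. -/
def secMap (U : Opens (specTop A)) :
    (specPresheaf A).obj (op U) ⟶ (specPresheaf B).obj (op ((Opens.map (specTopMap φ)).obj U)) :=
  CommMonCat.ofHom
    { toFun := fun s => ⟨fun p => locMap φ p.1 (secVal s ⟨specTopMap φ p.1, p.2⟩), fun p => by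
        obtain ⟨V, hV, i, a, f, h⟩ := sec_locally s ⟨specTopMap φ p.1, p.2⟩
        refine ⟨(Opens.map (specTopMap φ)).obj V, hV, (Opens.map (specTopMap φ)).map i,
          φ a, φ f, fun q => ?_⟩
        obtain ⟨h1, h2⟩ := h ⟨specTopMap φ q.1, q.2⟩
        exact ⟨h1, (congr_arg (locMap φ q.1) h2).trans (locMap_frac _ _ _ _ _)⟩⟩
      map_one' := sec_ext fun p => map_one (locMap φ p.1)
      map_mul' := fun s t => sec_ext fun p => map_mul (locMap φ p.1) _ _ }

lemma secVal_secMap (U : Opens (specTop A)) (s : (specPresheaf A).obj (op U))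
    (p : (Opens.map (specTopMap φ)).obj U) :
    secVal (secMap φ U s) p = locMap φ p.1 (secVal s ⟨specTopMap φ p.1, p.2⟩) := rfl

/-- The morphism of monoidal spaces `Spec B ⟶ Spec A` induced by `φ : A ⟶ B`. -/
def specSpaceMap : specSpace B ⟶ specSpace A :=
  InducedCategory.homMk
    { base := specTopMap φ
      c := { app := fun U => secMap φ U.unop
             naturality := fun _ _ _ => rfl } }

end Map

/-! ### Schemes over `𝔽₁` -/

/-- A morphism of monoidal spaces is local if all its stalk maps `φ` are local, that is
`φ⁻¹` of the units consists of units. -/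
def IsLocalMor {X Y : SheafedSpace CommMonCat.{u}} (f : X ⟶ Y) : Prop :=
  ∀ x : X, IsLocalHom (f.hom.stalkMap x).hom

lemma isLocalMor_iff {X Y : SheafedSpace CommMonCat.{u}} (f : X ⟶ Y) :
    IsLocalMor f ↔ ∀ (x : X) (U : Opens Y) (h : f.hom.base x ∈ U) (s : Y.presheaf.obj (op U)),
      IsUnit (X.presheaf.germ ((Opens.map f.hom.base).obj U) x h (f.hom.c.app (op U) s)) →
        IsUnit (Y.presheaf.germ U (f.hom.base x) h s) := by
  refine forall_congr' fun x => ⟨fun h U hU s hs => ?_, fun h => ⟨fun t ht => ?_⟩⟩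
  · refine h.1 _ ?_
    rw [← PresheafedSpace.stalkMap_germ_apply] at hs
    exact hs
  · obtain ⟨U, hU, s, rfl⟩ := Y.presheaf.exists_germ_eq t
    refine h U hU s ?_
    rw [← PresheafedSpace.stalkMap_germ_apply]
    exact ht

lemma IsLocalMor.id (X : SheafedSpace CommMonCat.{u}) : IsLocalMor (𝟙 X) := by
  rw [isLocalMor_iff]
  intro x U h s hs
  exact hs

lemma IsLocalMor.comp {X Y Z : SheafedSpace CommMonCat.{u}} {f : X ⟶ Y} {g : Y ⟶ Z}
    (hf : IsLocalMor f) (hg : IsLocalMor g) : IsLocalMor (f ≫ g) := by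
  rw [isLocalMor_iff] at *
  intro x U h s hs
  exact hg _ _ _ _ (hf _ _ _ _ hs)

lemma specSpaceMap_isLocal {A B : CommMonCat.{u}} (φ : A ⟶ B) : IsLocalMor (specSpaceMap φ) := by
  rw [isLocalMor_iff]
  intro p U hU s hs
  have hs' := (isUnit_germ_iff p hU (secMap φ U s)).1 hs
  refine (isUnit_germ_iff (specTopMap φ p) hU s).2 ?_
  exact isUnit_of_locMap φ p _ hs'

lemma specSpace_hom_ext {A B : CommMonCat.{u}} {f g : specSpace B ⟶ specSpace A}
    (h : ∀ p, f.hom.base p = g.hom.base p)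
    (h' : ∀ (U : Opens (specTop A)) (s : (specPresheaf A).obj (op U)) (p : specTop B)
      (hp : f.hom.base p ∈ U) (hp' : g.hom.base p ∈ U),
      secVal (f.hom.c.app (op U) s) ⟨p, hp⟩ = secVal (g.hom.c.app (op U) s) ⟨p, hp'⟩) : f = g := by
  obtain ⟨⟨f, fc⟩⟩ := f
  obtain ⟨⟨g, gc⟩⟩ := g
  obtain rfl : f = g := ConcreteCategory.hom_ext _ _ h
  congr 2
  ext U s
  exact sec_ext fun p => h' U s p.1 p.2 p.2

lemma specTopMap_id (A : CommMonCat.{u}) (p : specTop A) : specTopMap (𝟙 A) p = p := rfl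

lemma specTopMap_comp {A B C : CommMonCat.{u}} (φ : A ⟶ B) (ψ : B ⟶ C) (p : specTop C) :
    specTopMap (φ ≫ ψ) p = specTopMap φ (specTopMap ψ p) := rfl

lemma specSpaceMap_id (A : CommMonCat.{u}) : specSpaceMap (𝟙 A) = 𝟙 (specSpace A) := by
  refine specSpace_hom_ext (specTopMap_id A) fun U s p hp hp' => ?_
  change locMap (𝟙 A) p (secVal s ⟨specTopMap (𝟙 A) p, hp⟩) = secVal s ⟨p, hp'⟩
  obtain ⟨V, hV, i, a, f, h⟩ := sec_locally s ⟨p, hp'⟩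
  obtain ⟨h1, e1⟩ := h ⟨p, hV⟩
  obtain ⟨h2, e2⟩ := h ⟨specTopMap (𝟙 A) p, hV⟩
  refine (congr_arg (locMap (𝟙 A) p) e2).trans (Eq.trans ?_ e1.symm)
  exact locMap_frac (𝟙 A) p a f h2

lemma specSpaceMap_comp {A B C : CommMonCat.{u}} (φ : A ⟶ B) (ψ : B ⟶ C) :
    specSpaceMap (φ ≫ ψ) = specSpaceMap ψ ≫ specSpaceMap φ := by
  refine specSpace_hom_ext (specTopMap_comp φ ψ) fun U s p hp hp' => ?_
  change locMap (φ ≫ ψ) p (secVal s ⟨specTopMap (φ ≫ ψ) p, hp⟩) =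
    locMap ψ p (locMap φ (specTopMap ψ p) (secVal s ⟨specTopMap φ (specTopMap ψ p), hp'⟩))
  obtain ⟨V, hV, i, a, f, h⟩ := sec_locally s ⟨_, hp'⟩
  obtain ⟨h1, e1⟩ := h ⟨_, hV⟩
  obtain ⟨h2, e2⟩ := h ⟨specTopMap (φ ≫ ψ) p, hV⟩
  refine (congr_arg (locMap (φ ≫ ψ) p) e2).trans (Eq.trans ?_
    (congr_arg (fun x => locMap ψ p (locMap φ (specTopMap ψ p) x)) e1.symm))
  refine (locMap_frac (φ ≫ ψ) p a f h2).trans (Eq.symm ?_)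
  exact (congr_arg (locMap ψ p) (locMap_frac φ _ a f h1)).trans (locMap_frac ψ p _ _ _)

end

/-- A monoidal space is affine if it is isomorphic to `Spec A` for some monoid `A`. -/
def IsAffineSpace (X : SheafedSpace CommMonCat.{u}) : Prop :=
  ∃ A : CommMonCat.{u}, Nonempty (X ≅ specSpace A)

/-- An open subset `U` of a monoidal space `X` is affine if `(U, 𝒪_X|_U)` is affine. -/
def IsAffineOpen {X : SheafedSpace CommMonCat.{u}} (U : Opens X) : Prop :=
  IsAffineSpace (X.restrict U.isOpenEmbedding)

end FOne

/-- A scheme over `𝔽₁`: a monoidal space in which every point has an affine open neighbourhood. -/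
structure MonoidScheme extends SheafedSpace CommMonCat.{u} where
  local_affine : ∀ x : toSheafedSpace, ∃ U : Opens toSheafedSpace, x ∈ U ∧ FOne.IsAffineOpen U

namespace MonoidScheme

open FOne

/-- A morphism of schemes over `𝔽₁` is a local morphism of monoidal spaces. -/
@[ext]
structure Hom (X Y : MonoidScheme.{u}) where
  /-- the underlying morphism of monoidal spaces -/
  mor : X.toSheafedSpace ⟶ Y.toSheafedSpace
  isLocal : IsLocalMor mor

instance : Category MonoidScheme.{u} where
  Hom := Hom
  id X := ⟨𝟙 _, .id _⟩
  comp f g := ⟨f.mor ≫ g.mor, f.isLocal.comp g.isLocal⟩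

@[ext]
lemma hom_ext {X Y : MonoidScheme.{u}} {f g : X ⟶ Y} (h : f.mor = g.mor) : f = g := Hom.ext h

@[simp] lemma id_mor (X : MonoidScheme.{u}) : (𝟙 X : X ⟶ X).mor = 𝟙 _ := rfl

@[simp] lemma comp_mor {X Y Z : MonoidScheme.{u}} (f : X ⟶ Y) (g : Y ⟶ Z) :
    (f ≫ g).mor = f.mor ≫ g.mor := rfl

/-- The affine scheme `Spec A` over `𝔽₁`. -/
noncomputable def specObj (A : CommMonCat.{u}) : MonoidScheme.{u} where
  toSheafedSpace := specSpace A
  local_affine _ := ⟨⊤, trivial, A, ⟨(specSpace A).restrictTopIso⟩⟩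

/-- The contravariant functor `A ↦ Spec A` from monoids to schemes over `𝔽₁`. -/
noncomputable def Spec : CommMonCat.{u}ᵒᵖ ⥤ MonoidScheme.{u} where
  obj A := specObj A.unop
  map φ := ⟨specSpaceMap φ.unop, specSpaceMap_isLocal φ.unop⟩
  map_id A := hom_ext (specSpaceMap_id A.unop)
  map_comp φ ψ := hom_ext (specSpaceMap_comp ψ.unop φ.unop)

end MonoidScheme

namespace FOne

noncomputable section

/-! ### Localization away from an element -/

/-- `ι : A → B` is a localization of the monoid `A` away from `f`. -/
structure IsLocAway {A B : Type u} [CommMonoid A] [CommMonoid B] (ι : A →* B) (f : A) : Prop where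
  isUnit : IsUnit (ι f)
  surj : ∀ b, ∃ a k, b * ι (f ^ k) = ι a
  eq : ∀ a a', ι a = ι a' → ∃ k, f ^ k * a = f ^ k * a'

lemma isLocAway_localization {A : Type u} [CommMonoid A] (f : A) :
    IsLocAway (Localization.monoidOf (Submonoid.powers f)).toMonoidHom f where
  isUnit := (Localization.monoidOf (Submonoid.powers f)).map_units ⟨f, 1, pow_one f⟩
  surj b := by
    obtain ⟨⟨a, _, k, rfl⟩, h⟩ := (Localization.monoidOf (Submonoid.powers f)).surj b
    exact ⟨a, k, h⟩
  eq a a' h := by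
    obtain ⟨⟨_, k, rfl⟩, h⟩ := (Localization.monoidOf (Submonoid.powers f)).exists_of_eq h
    exact ⟨k, h⟩

lemma PrimeIdeal.notMem_of_isUnit {A : Type u} [CommMonoid A] (p : PrimeIdeal A) {a : A}
    (h : IsUnit a) : a ∉ p.ideal := by
  intro ha
  obtain ⟨b, hb⟩ := isUnit_iff_exists_inv.1 h
  exact p.one_notMem (hb ▸ p.mul_mem_left b ha)

lemma PrimeIdeal.mul_mem_iff {A : Type u} [CommMonoid A] (p : PrimeIdeal A) {a b : A} :
    a * b ∈ p.ideal ↔ a ∈ p.ideal ∨ b ∈ p.ideal :=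
  ⟨p.mem_or_mem a b, fun h => h.elim (p.mul_mem_left b) (p.mul_mem_right a)⟩

lemma PrimeIdeal.pow_notMem {A : Type u} [CommMonoid A] (p : PrimeIdeal A) {a : A}
    (h : a ∉ p.ideal) (k : ℕ) : a ^ k ∉ p.ideal := pow_mem (S := p.compl) h k

namespace IsLocAway

section

variable {A B : Type u} [CommMonoid A] [CommMonoid B] {ι : A →* B} {f : A}

lemma isUnit_pow (hι : IsLocAway ι f) (k : ℕ) : IsUnit (ι (f ^ k)) := by
  rw [map_pow]
  exact hι.isUnit.pow k

lemma mem_iff (hι : IsLocAway ι f) (q : PrimeIdeal B) {a : A} {b : B} {k : ℕ} (h : b * ι (f ^ k) = ι a) :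
    b ∈ q.ideal ↔ a ∈ (q.comap ι).ideal := by
  rw [PrimeIdeal.mem_comap, ← h, PrimeIdeal.mul_mem_iff]
  exact ⟨Or.inl, fun h => h.resolve_right (q.notMem_of_isUnit (hι.isUnit_pow k))⟩

lemma comap_injective (hι : IsLocAway ι f) : Function.Injective (PrimeIdeal.comap ι) := by
  intro q q' h
  ext b
  obtain ⟨a, k, e⟩ := hι.surj b
  rw [hι.mem_iff q e, hι.mem_iff q' e, h]

lemma exists_comap_eq (hι : IsLocAway ι f) (p : PrimeIdeal A) (hp : f ∉ p.ideal) : ∃ q, PrimeIdeal.comap ι q = p := by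
  have key : ∀ b a k, b * ι (f ^ k) = ι a → ∀ a' k', b * ι (f ^ k') = ι a' →
      a ∈ p.ideal → a' ∈ p.ideal := by
    intro b a k h a' k' h' ha
    have : ι (f ^ k' * a) = ι (f ^ k * a') := by
      rw [map_mul, map_mul, ← h, ← h', mul_left_comm, mul_comm (ι (f ^ k')), mul_left_comm]
    obtain ⟨l, hl⟩ := hι.eq _ _ this
    have h2 : f ^ l * (f ^ k * a') ∈ p.ideal :=
      hl ▸ p.mul_mem_right _ (p.mul_mem_right _ ha)
    rw [p.mul_mem_iff, p.mul_mem_iff] at h2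
    exact (h2.resolve_left (p.pow_notMem hp l)).resolve_left (p.pow_notMem hp k)
  let P : B → Prop := fun b => ∃ a k, b * ι (f ^ k) = ι a ∧ a ∈ p.ideal
  have hP : ∀ b a k, b * ι (f ^ k) = ι a → (P b ↔ a ∈ p.ideal) := fun b a k h =>
    ⟨fun ⟨a', k', h', ha'⟩ => key b a' k' h' a k h ha', fun ha => ⟨a, k, h, ha⟩⟩
  have hP' : ∀ a, P (ι a) ↔ a ∈ p.ideal := fun a => hP (ι a) a 0 (by simp)
  refine ⟨PrimeIdeal.mk' P ?_ ?_, ?_⟩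
  · rw [← map_one ι, hP']
    exact p.one_notMem
  · intro b b'
    obtain ⟨a, k, h⟩ := hι.surj b
    obtain ⟨a', k', h'⟩ := hι.surj b'
    rw [hP b a k h, hP b' a' k' h', ← p.mul_mem_iff]
    refine hP _ _ (k + k') ?_
    rw [pow_add, map_mul, map_mul, ← h, ← h', mul_mul_mul_comm]
  · ext a
    exact hP' a

end

section

variable {A B : CommMonCat.{u}} {ι : A ⟶ B} {f : A}

lemma range_specTopMap (hι : IsLocAway ι.hom f) : Set.range (specTopMap ι) = {p : specTop A | f ∈ specCompl p} := by
  ext p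
  constructor
  · rintro ⟨q, rfl⟩
    exact q.notMem_of_isUnit hι.isUnit
  · exact fun hp => hι.exists_comap_eq p hp

lemma isOpenEmbedding (hι : IsLocAway ι.hom f) : Topology.IsOpenEmbedding (specTopMap ι) := by
  refine .of_continuous_injective_isOpenMap (specTopMap ι).hom.continuous hι.comap_injective ?_
  intro U hU
  rw [isOpen_iff_forall_mem_open]
  rintro _ ⟨q, hq, rfl⟩
  obtain ⟨b, hb, hbU⟩ := PrimeIdeal.exists_basicOpen_le (A := B) (U := ⟨U, hU⟩) hq
  obtain ⟨a, k, h⟩ := hι.surj b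
  refine ⟨((PrimeIdeal.basicOpen (A := A) (a * f) : Opens (PrimeIdeal A)) : Set (PrimeIdeal A)),
    ?_, (PrimeIdeal.basicOpen (A := A) (a * f)).2, ?_⟩
  · intro p hp
    have hp' : ¬ (a ∈ p.ideal ∨ f ∈ p.ideal) := fun h => hp (p.mul_mem_iff.2 h)
    push Not at hp'
    obtain ⟨q', rfl⟩ := hι.exists_comap_eq p hp'.2
    exact ⟨q', hbU (fun hb' => hp'.1 ((hι.mem_iff q' h).1 hb')), rfl⟩
  · intro hmem
    rcases PrimeIdeal.mem_or_mem _ _ _ hmem with h1 | h1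
    · exact hb ((hι.mem_iff q h).2 h1)
    · exact q.notMem_of_isUnit hι.isUnit h1

lemma locMap_bijective (hι : IsLocAway ι.hom f) (p : specTop B) : Function.Bijective (locMap ι p) := by
  constructor
  · intro x y h
    obtain ⟨a, g, hg, rfl⟩ := exists_frac x
    obtain ⟨a', g', hg', rfl⟩ := exists_frac y
    rw [locMap_frac, locMap_frac, frac_eq_iff] at h
    obtain ⟨c, hc, h⟩ := h
    obtain ⟨d, k, hd⟩ := hι.surj c
    have h2 : ι.hom (d * (g' * a)) = ι.hom (d * (g * a')) := by
      have := congr_arg (· * ι.hom (f ^ k)) h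
      simp only [mul_right_comm] at this
      rw [hd] at this
      simpa using this
    obtain ⟨l, hl⟩ := hι.eq _ _ h2
    refine frac_eq_iff.2 ⟨f ^ l * d, ?_, by simpa [mul_assoc] using hl⟩
    refine mul_mem (pow_mem (S := specCompl (specTopMap ι p)) ?_ l) ?_
    · exact p.notMem_of_isUnit hι.isUnit
    · exact fun h => hc ((hι.mem_iff p hd).2 h)
  · intro y
    obtain ⟨b, h, hh, rfl⟩ := exists_frac y
    obtain ⟨a, k, ha⟩ := hι.surj b
    obtain ⟨g, l, hg⟩ := hι.surj h
    have h1 : g * f ^ k ∈ specCompl (specTopMap ι p) := by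
      refine mul_mem (fun h => hh ((hι.mem_iff p hg).2 h))
        (pow_mem (S := specCompl (specTopMap ι p)) ?_ k)
      exact p.notMem_of_isUnit hι.isUnit
    refine ⟨frac _ (a * f ^ l) (g * f ^ k) h1, ?_⟩
    rw [locMap_frac, frac_eq_iff]
    refine ⟨1, one_mem _, ?_⟩
    change 1 * (h * ι.hom (a * f ^ l)) = 1 * (ι.hom (g * f ^ k) * b)
    rw [map_mul, map_mul, ← ha, ← hg]
    simp only [one_mul]
    ac_rfl

lemma isOpenImmersion (hι : IsLocAway ι.hom f) : SheafedSpace.IsOpenImmersion (specSpaceMap ι) := by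
  have (p : specSpace B) : IsIso ((specSpaceMap ι).hom.stalkMap p) := by
    rw [ConcreteCategory.isIso_iff_bijective]
    constructor
    · intro x y h
      obtain ⟨a, g, hg, rfl⟩ := exists_germ_frac (specTopMap ι p) x
      obtain ⟨a', g', hg', rfl⟩ := exists_germ_frac (specTopMap ι p) y
      have h2 : (specPresheaf B).germ _ p hg
            (secMap ι (PrimeIdeal.basicOpen (A := A) g) (secFrac _ a g fun _ h => h)) =
          (specPresheaf B).germ _ p hg'
            (secMap ι (PrimeIdeal.basicOpen (A := A) g') (secFrac _ a' g' fun _ h => h)) :=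
        (PresheafedSpace.stalkMap_germ_apply (specSpaceMap ι).hom
          (PrimeIdeal.basicOpen (A := A) g) p hg _).symm.trans (h.trans
          (PresheafedSpace.stalkMap_germ_apply (specSpaceMap ι).hom
            (PrimeIdeal.basicOpen (A := A) g') p hg' _))
      have h3 := (germ_eq_iff p _ _ (secMap ι _ _) (secMap ι _ _)).1 h2
      exact (germ_eq_iff (specTopMap ι p) _ _ _ _).2 ((hι.locMap_bijective p).1 h3)
    · intro y
      obtain ⟨b, h, hh, rfl⟩ := exists_germ_frac p y
      obtain ⟨x, hx⟩ := (hι.locMap_bijective p).2 (frac p b h hh)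
      obtain ⟨a, g, hg, rfl⟩ := exists_frac x
      refine ⟨(specPresheaf A).germ (PrimeIdeal.basicOpen (A := A) g) (specTopMap ι p) hg
        (secFrac _ a g fun _ h => h), ?_⟩
      refine (PresheafedSpace.stalkMap_germ_apply (specSpaceMap ι).hom
          (PrimeIdeal.basicOpen (A := A) g) p hg _).trans ?_
      exact (germ_eq_iff p _ _ (secMap ι _ _) _).2 hx
  exact SheafedSpace.IsOpenImmersion.of_stalk_iso _ hι.isOpenEmbedding

end

end IsLocAway


/-! ### Affine open subsets -/

variable {X Y : SheafedSpace CommMonCat.{u}}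

lemma isAffineOpen_of_isOpenImmersion {A : CommMonCat.{u}} (j : specSpace A ⟶ X)
    [SheafedSpace.IsOpenImmersion j] (U : Opens X) (h : Set.range j.hom.base = U) :
    IsAffineOpen U := by
  refine ⟨A, ⟨SheafedSpace.isoMk ?_⟩⟩
  have : PresheafedSpace.IsOpenImmersion j.hom := ‹_›
  have h2 : Set.range j.hom.base =
      Set.range (X.toPresheafedSpace.ofRestrict U.isOpenEmbedding).base := by
    rw [h]
    exact Subtype.range_coe.symm
  exact (PresheafedSpace.IsOpenImmersion.isoOfRangeEq j.hom
    (X.toPresheafedSpace.ofRestrict U.isOpenEmbedding) h2).symm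

lemma IsAffineOpen.exists_isOpenImmersion {U : Opens X} (h : IsAffineOpen U) :
    ∃ (A : CommMonCat.{u}) (j : specSpace A ⟶ X), SheafedSpace.IsOpenImmersion j ∧
      Set.range j.hom.base = U := by
  obtain ⟨A, ⟨e⟩⟩ := h
  refine ⟨A, e.inv ≫ X.ofRestrict U.isOpenEmbedding, inferInstance, ?_⟩
  have hc := Set.range_comp (X.ofRestrict U.isOpenEmbedding).hom.base e.inv.hom.base
  refine Eq.trans hc ?_
  have : Function.Surjective e.inv.hom.base := by
    intro x
    refine ⟨e.hom.hom.base x, ?_⟩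
    have := congr_arg (fun f => f.hom.base x) e.hom_inv_id
    exact this
  rw [this.range_eq, Set.image_univ]
  exact Subtype.range_coe

/-- Affine open subsets form a basis. -/
lemma exists_isAffineOpen_le {X : MonoidScheme.{u}} {x : X.toSheafedSpace}
    {W : Opens X.toSheafedSpace} (hx : x ∈ W) :
    ∃ U : Opens X.toSheafedSpace, x ∈ U ∧ U ≤ W ∧ IsAffineOpen U := by
  obtain ⟨V, hxV, hV⟩ := X.local_affine x
  obtain ⟨A, j, hj, hr⟩ := hV.exists_isOpenImmersion
  obtain ⟨p, rfl⟩ : x ∈ Set.range j.hom.base := hr ▸ hxV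
  obtain ⟨f, hf, hfW⟩ := PrimeIdeal.exists_basicOpen_le (A := A) (p := p)
    (U := (Opens.map j.hom.base).obj W) hx
  let ι : A ⟶ CommMonCat.of (Localization (Submonoid.powers f)) :=
    CommMonCat.ofHom (Localization.monoidOf (Submonoid.powers f)).toMonoidHom
  have hι : IsLocAway ι.hom f := isLocAway_localization f
  have := hι.isOpenImmersion
  have hr : Set.range (specSpaceMap ι ≫ j).hom.base =
      j.hom.base '' {p : specTop A | f ∈ specCompl p} := by
    have hc := Set.range_comp j.hom.base (specSpaceMap ι).hom.base
    refine Eq.trans hc (congr_arg _ ?_)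
    exact hι.range_specTopMap
  refine ⟨⟨_, (inferInstance : SheafedSpace.IsOpenImmersion
    (specSpaceMap ι ≫ j)).base_open.isOpen_range⟩, ?_, ?_,
    isAffineOpen_of_isOpenImmersion (specSpaceMap ι ≫ j) _ rfl⟩
  · change _ ∈ Set.range _
    rw [hr]
    exact ⟨p, hf, rfl⟩
  · change Set.range _ ⊆ _
    rw [hr]
    rintro _ ⟨q, hq, rfl⟩
    exact hfW hq

/-- The properties of affine open subsets needed to glue base extensions. -/
structure AffineLike (V : Opens X) : Prop where
  exists_point : ∀ q : PrimeIdeal (X.presheaf.obj (op V)), ∃ (y : X) (hy : y ∈ V),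
    ∀ a, IsUnit (X.presheaf.germ V y hy a) ↔ a ∉ q.ideal
  basis : ∀ (y : X) (hy : y ∈ V) (W : Opens X), y ∈ W → ∃ a, IsUnit (X.presheaf.germ V y hy a) ∧
    ∀ (z : X) (hz : z ∈ V), IsUnit (X.presheaf.germ V z hz a) → z ∈ W
  surj : ∀ (y : X) (hy : y ∈ V) (t : X.presheaf.stalk y), ∃ a s,
    IsUnit (X.presheaf.germ V y hy s) ∧ t * X.presheaf.germ V y hy s = X.presheaf.germ V y hy a
  eq : ∀ (y : X) (hy : y ∈ V) (a b : X.presheaf.obj (op V)),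
    X.presheaf.germ V y hy a = X.presheaf.germ V y hy b →
      ∃ s, IsUnit (X.presheaf.germ V y hy s) ∧ s * a = s * b

/-- The map `A → Γ(Spec A)`. -/
def toGlobal (A : CommMonCat.{u}) : A →* (specPresheaf A).obj (op ⊤) where
  toFun a := secFrac ⊤ a 1 fun _ _ => one_mem _
  map_one' := sec_ext fun _ => frac_one
  map_mul' a b := sec_ext fun p =>
    (frac_eq_iff.2 ⟨1, one_mem _, by simp⟩ : _ = frac p.1 (a * b) (1 * 1) _).trans frac_mul.symm

lemma secVal_toGlobal {A : CommMonCat.{u}} (a : A) (p : (⊤ : Opens (specTop A))) :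
    secVal (toGlobal A a) p = frac p.1 a 1 (one_mem _) := rfl

lemma toGlobal_surjective (A : CommMonCat.{u}) : Function.Surjective (toGlobal A) := by
  intro s
  let c : specTop A := PrimeIdeal.mk' (fun a => ¬ IsUnit a) (by simp)
    (fun a b => by rw [IsUnit.mul_iff]; tauto)
  obtain ⟨V, hV, i, a, f, h⟩ := sec_locally s ⟨c, trivial⟩
  have hVtop : ∀ q, q ∈ V := by
    obtain ⟨g, hg, hgV⟩ := PrimeIdeal.exists_basicOpen_le (A := A) (p := c) (U := V) hV
    have hgu : IsUnit g := not_not.1 hg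
    exact fun q => hgV (PrimeIdeal.notMem_of_isUnit q hgu)
  obtain ⟨hf, -⟩ := h ⟨c, hV⟩
  obtain ⟨f', hf'⟩ := isUnit_iff_exists_inv.1 (not_not.1 hf : IsUnit f)
  refine ⟨a * f', sec_ext fun p => ?_⟩
  obtain ⟨h1, h2⟩ := h ⟨p.1, hVtop p.1⟩
  refine Eq.trans ?_ h2.symm
  rw [secVal_toGlobal]
  refine frac_eq_iff.2 ⟨1, one_mem _, ?_⟩
  rw [mul_left_comm f a f', hf']
  simp

lemma isUnit_germ_toGlobal {A : CommMonCat.{u}} (p : specTop A) (a : A) :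
    IsUnit ((specPresheaf A).germ ⊤ p trivial (toGlobal A a)) ↔ a ∉ PrimeIdeal.ideal (A := A) p := by
  have := isUnit_germ_iff (U := ⊤) p trivial (toGlobal A a)
  rw [secVal_toGlobal, isUnit_frac_iff] at this
  exact this

lemma affineLike_top (A : CommMonCat.{u}) : AffineLike (X := specSpace A) ⊤ where
  exists_point q := by
    refine ⟨PrimeIdeal.comap (toGlobal A) q, trivial, fun s => ?_⟩
    obtain ⟨a, rfl⟩ := toGlobal_surjective A s
    exact isUnit_germ_toGlobal (PrimeIdeal.comap (toGlobal A) q) a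
  basis p _ W hW := by
    obtain ⟨f, hf, hfW⟩ := PrimeIdeal.exists_basicOpen_le (A := A) (p := p) (U := W) hW
    exact ⟨toGlobal A f, (isUnit_germ_toGlobal p f).2 hf,
      fun z _ h => hfW ((isUnit_germ_toGlobal z f).1 h)⟩
  surj p hp t := by
    obtain ⟨a, f, hf, rfl⟩ := exists_germ_frac p t
    refine ⟨toGlobal A a, toGlobal A f, (isUnit_germ_toGlobal p f).2 hf, ?_⟩
    refine (germ_mul_germ_eq_iff (U := PrimeIdeal.basicOpen (A := A) f) (V := ⊤) (W := ⊤) p hf trivial trivial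
      (secFrac _ a f fun _ h => h) (toGlobal A f) (toGlobal A a)).2 ?_
    refine (frac_mul : frac p a f hf * frac p f 1 _ = _).trans (frac_eq_iff.2 ⟨1, one_mem _, ?_⟩)
    simp [mul_comm]
  eq p hp s t h := by
    obtain ⟨a, rfl⟩ := toGlobal_surjective A s
    obtain ⟨b, rfl⟩ := toGlobal_surjective A t
    have h1 := (germ_eq_iff p _ _ (toGlobal A a) (toGlobal A b)).1 h
    obtain ⟨c, hc, e⟩ := frac_eq_iff.1 (h1 : frac p a 1 _ = frac p b 1 _)
    refine ⟨toGlobal A c, (isUnit_germ_toGlobal p c).2 hc, ?_⟩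
    have h2 : toGlobal A (c * a) = toGlobal A (c * b) := by simpa using congr_arg (toGlobal A) e
    rw [map_mul, map_mul] at h2
    exact h2

lemma isUnit_iff_of_isIso {M N : CommMonCat.{u}} (f : M ⟶ N) [IsIso f] (x : M) :
    IsUnit (f x) ↔ IsUnit x := by
  refine ⟨fun h => ?_, fun h => h.map f.hom⟩
  have := h.map (inv f).hom
  rwa [show (inv f).hom (f x) = x from congr_arg (fun g => g.hom x) (IsIso.hom_inv_id f)] at this

lemma AffineLike.of_isOpenImmersion (j : Y ⟶ X) [hj : SheafedSpace.IsOpenImmersion j]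
    (V : Opens X) (hV : (V : Set X) ⊆ Set.range j.hom.base)
    (h : AffineLike ((Opens.map j.hom.base).obj V)) : AffineLike V := by
  let φ : X.presheaf.obj (op V) ⟶ Y.presheaf.obj (op ((Opens.map j.hom.base).obj V)) :=
    j.hom.c.app (op V)
  have hφ : IsIso φ := PresheafedSpace.IsOpenImmersion.c_iso' j.hom ((Opens.map j.hom.base).obj V) (by
    ext x
    constructor
    · intro hx
      obtain ⟨y, rfl⟩ := hV hx
      exact ⟨y, hx, rfl⟩
    · rintro ⟨y, hy, rfl⟩
      exact hy)
  have hφb := (ConcreteCategory.isIso_iff_bijective φ).1 hφ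
  have hst (z : Y) : Function.Bijective (j.hom.stalkMap z) :=
    (ConcreteCategory.isIso_iff_bijective _).1 inferInstance
  have hgerm (z : Y) (hz : j.hom.base z ∈ V) (a) :
      j.hom.stalkMap z (X.presheaf.germ V (j.hom.base z) hz a) =
        Y.presheaf.germ ((Opens.map j.hom.base).obj V) z hz (φ a) :=
    PresheafedSpace.stalkMap_germ_apply j.hom V z hz a
  have hunit (z : Y) (hz : j.hom.base z ∈ V) (a) :
      IsUnit (Y.presheaf.germ ((Opens.map j.hom.base).obj V) z hz (φ a)) ↔
        IsUnit (X.presheaf.germ V (j.hom.base z) hz a) := by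
    rw [← hgerm, isUnit_iff_of_isIso]
  constructor
  · intro q
    obtain ⟨z, hz, hq⟩ := h.exists_point (PrimeIdeal.comap (inv φ).hom q)
    refine ⟨j.hom.base z, hz, fun a => ?_⟩
    refine (hunit z hz a).symm.trans ?_
    rw [hq, PrimeIdeal.mem_comap,
      show (inv φ).hom (φ a) = a from congr_arg (fun g => g.hom a) (IsIso.hom_inv_id φ)]
  · intro y hy W hW
    obtain ⟨z, rfl⟩ := hV hy
    obtain ⟨b, hb, hbW⟩ := h.basis z hy ((Opens.map j.hom.base).obj W) hW
    obtain ⟨a, rfl⟩ := hφb.2 b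
    refine ⟨a, (hunit _ _ _).1 hb, fun x hx hax => ?_⟩
    obtain ⟨z', rfl⟩ := hV hx
    exact hbW z' hx ((hunit _ _ _).2 hax)
  · intro y hy t
    obtain ⟨z, rfl⟩ := hV hy
    obtain ⟨a, s, hs, e⟩ := h.surj z hy (j.hom.stalkMap z t)
    obtain ⟨a, rfl⟩ := hφb.2 a
    obtain ⟨s, rfl⟩ := hφb.2 s
    refine ⟨a, s, (hunit _ _ _).1 hs, (hst z).1 ?_⟩
    rw [map_mul, hgerm, hgerm]
    exact e
  · intro y hy a b hab
    obtain ⟨z, rfl⟩ := hV hy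
    have h1 := congr_arg (j.hom.stalkMap z) hab
    rw [hgerm, hgerm] at h1
    obtain ⟨s, hs, e⟩ := h.eq z hy _ _ h1
    obtain ⟨s, rfl⟩ := hφb.2 s
    refine ⟨s, (hunit _ _ _).1 hs, hφb.1 ?_⟩
    rw [map_mul, map_mul]
    exact e

lemma IsAffineOpen.affineLike {V : Opens X} (hV : IsAffineOpen V) : AffineLike V := by
  obtain ⟨A, j, hj, hr⟩ := hV.exists_isOpenImmersion
  refine .of_isOpenImmersion j V hr.ge ?_
  have : (Opens.map j.hom.base).obj V = ⊤ := by
    ext x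
    simpa using hr.le ⟨x, rfl⟩
  rw [this]
  exact affineLike_top A


/-! ### Base extension of monoids -/

/-- Base extension of monoids to `ℤ`: the functor `A ↦ ℤ[A]`. -/
def zExt : CommMonCat.{u} ⥤ CommRingCat.{u} where
  obj A := CommRingCat.of (MonoidAlgebra ℤ A)
  map φ := CommRingCat.ofHom (MonoidAlgebra.mapDomainRingHom ℤ φ.hom)
  map_id A := by
    ext : 1
    apply MonoidAlgebra.ringHom_ext <;> intro <;> simp
  map_comp φ ψ := by
    ext : 1
    apply MonoidAlgebra.ringHom_ext <;> intro <;> simp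

lemma mapDomainRingHom_of {A B : Type u} [CommMonoid A] [CommMonoid B] (ι : A →* B) (a : A) :
    MonoidAlgebra.mapDomainRingHom ℤ ι (MonoidAlgebra.of ℤ A a) = MonoidAlgebra.of ℤ B (ι a) := by
  simp

/-- `ℤ[A] → ℤ[A_f]` is a localization. -/
lemma IsLocAway.isLocalization {A B : Type u} [CommMonoid A] [CommMonoid B] {ι : A →* B} {f : A}
    (hι : IsLocAway ι f) :
    @IsLocalization.Away (MonoidAlgebra ℤ A) _ (MonoidAlgebra.of ℤ A f) (MonoidAlgebra ℤ B) _
      (MonoidAlgebra.mapDomainRingHom ℤ ι).toAlgebra := by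
  let _ := (MonoidAlgebra.mapDomainRingHom ℤ ι).toAlgebra
  have halg : algebraMap (MonoidAlgebra ℤ A) (MonoidAlgebra ℤ B) =
    MonoidAlgebra.mapDomainRingHom ℤ ι := rfl
  let R := Localization.Away (MonoidAlgebra.of ℤ A f)
  let g : A →* R := (algebraMap (MonoidAlgebra ℤ A) R : _ →* R).comp (MonoidAlgebra.of ℤ A)
  have hgf : IsUnit (g f) := IsLocalization.Away.algebraMap_isUnit (MonoidAlgebra.of ℤ A f)
  -- `ι` as a localization map
  let L : Submonoid.LocalizationMap (Submonoid.powers f) B := ι.toLocalizationMap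
    (by rintro ⟨_, k, rfl⟩; exact hι.isUnit_pow k)
    (fun b => by
      obtain ⟨a, k, h⟩ := hι.surj b
      exact ⟨⟨a, ⟨_, k, rfl⟩⟩, h⟩)
    (fun a a' h => by
      obtain ⟨k, hk⟩ := hι.eq a a' h
      exact ⟨⟨_, k, rfl⟩, hk⟩)
  have hgu : ∀ y : Submonoid.powers f, IsUnit (g y) := by
    rintro ⟨_, k, rfl⟩
    rw [map_pow]
    exact hgf.pow k
  let h : B →* R := L.lift hgu
  have hh : ∀ a, h (ι a) = g a := fun a => L.lift_eq hgu a
  let ψ : MonoidAlgebra ℤ B →+* R := (MonoidAlgebra.lift ℤ R B h).toRingHom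
  have hψ : ψ.comp (MonoidAlgebra.mapDomainRingHom ℤ ι) = algebraMap (MonoidAlgebra ℤ A) R := by
    refine MonoidAlgebra.ringHom_ext (fun n => ?_) (fun a => ?_)
    · have := RingHom.ext_int (ψ.comp ((MonoidAlgebra.mapDomainRingHom ℤ ι).comp
        MonoidAlgebra.singleOneRingHom)) ((algebraMap (MonoidAlgebra ℤ A) R).comp
          MonoidAlgebra.singleOneRingHom)
      exact RingHom.congr_fun this n
    · have h1 : ψ (MonoidAlgebra.of ℤ B (ι a)) = h (ι a) := MonoidAlgebra.lift_of h (ι a)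
      have h2 := mapDomainRingHom_of ι a
      rw [← h2, hh] at h1
      exact h1
  refine ⟨?_, ?_, ?_⟩
  · rintro ⟨_, k, rfl⟩
    rw [halg, map_pow, mapDomainRingHom_of]
    exact (hι.isUnit.map (MonoidAlgebra.of ℤ B)).pow k
  · intro z
    suffices ∃ x k, z * MonoidAlgebra.of ℤ B (ι (f ^ k)) =
        MonoidAlgebra.mapDomainRingHom ℤ ι x by
      obtain ⟨x, k, hx⟩ := this
      refine ⟨⟨x, ⟨_, k, rfl⟩⟩, ?_⟩
      rw [halg, ← hx, ← mapDomainRingHom_of]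
      simp
    induction z using MonoidAlgebra.induction_on with
    | of b =>
      obtain ⟨a, k, h⟩ := hι.surj b
      exact ⟨MonoidAlgebra.of ℤ A a, k, by rw [mapDomainRingHom_of, ← h, map_mul]⟩
    | add z z' hz hz' =>
      obtain ⟨x, k, hx⟩ := hz
      obtain ⟨x', k', hx'⟩ := hz'
      refine ⟨x * MonoidAlgebra.of ℤ A (f ^ k') + x' * MonoidAlgebra.of ℤ A (f ^ k), k + k', ?_⟩
      rw [map_add, map_mul, map_mul, ← hx, ← hx', mapDomainRingHom_of, mapDomainRingHom_of,
        pow_add, map_mul, map_mul]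
      ring
    | smul n z hz =>
      obtain ⟨x, k, hx⟩ := hz
      exact ⟨n • x, k, by rw [smul_mul_assoc, hx, map_zsmul]⟩
  · intro x y hxy
    have := congr_arg ψ hxy
    rw [halg, ← RingHom.comp_apply, ← RingHom.comp_apply, hψ] at this
    exact (IsLocalization.eq_iff_exists (Submonoid.powers (MonoidAlgebra.of ℤ A f)) R).1 this

lemma IsLocAway.isOpenImmersion_zExt {A B : CommMonCat.{u}} {ι : A ⟶ B} {f : A}
    (hι : IsLocAway ι.hom f) : IsOpenImmersion (Spec.map (zExt.map ι)) := by
  let _ := (MonoidAlgebra.mapDomainRingHom ℤ ι.hom).toAlgebra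
  have : IsLocalization.Away (MonoidAlgebra.of ℤ A f) (MonoidAlgebra ℤ B) := hι.isLocalization
  exact IsOpenImmersion.of_isLocalization (S := MonoidAlgebra ℤ B) (MonoidAlgebra.of ℤ A f)

lemma IsLocAway.mem_range_zExt {A B : CommMonCat.{u}} {ι : A ⟶ B} {f : A}
    (hι : IsLocAway ι.hom f) (x : Spec (zExt.obj A)) :
    x ∈ Set.range (Spec.map (zExt.map ι)) ↔
      MonoidAlgebra.of ℤ A f ∉ (PrimeSpectrum.asIdeal (R := MonoidAlgebra ℤ A) x) := by
  let _ := (MonoidAlgebra.mapDomainRingHom ℤ ι.hom).toAlgebra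
  have : IsLocalization.Away (MonoidAlgebra.of ℤ A f) (MonoidAlgebra ℤ B) := hι.isLocalization
  have h := PrimeSpectrum.localization_away_comap_range (MonoidAlgebra ℤ B)
    (MonoidAlgebra.of ℤ A f)
  exact Set.ext_iff.1 h x

/-- The prime ideal of `A` below a prime of `ℤ[A]`. -/
def primeBelow {A : CommMonCat.{u}} (x : Spec (zExt.obj A)) : PrimeIdeal A :=
  PrimeIdeal.mk'
    (fun a => MonoidAlgebra.of ℤ A a ∈ (PrimeSpectrum.asIdeal (R := MonoidAlgebra ℤ A) x))
    (by
      rw [map_one]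
      exact (Ideal.ne_top_iff_one _).1 x.isPrime.ne_top)
    (fun a b => by
      rw [map_mul]
      exact x.isPrime.mul_mem_iff_mem_or_mem)

lemma mem_primeBelow {A : CommMonCat.{u}} {x : Spec (zExt.obj A)} {a : A} :
    a ∈ (primeBelow x).ideal ↔
      MonoidAlgebra.of ℤ A a ∈ (PrimeSpectrum.asIdeal (R := MonoidAlgebra ℤ A) x) := Iff.rfl

/-! ### Restriction between affine open subsets -/

section Restrict

variable {X : SheafedSpace CommMonCat.{u}}

lemma AffineLike.exists_closedPoint {V : Opens X} (hV : AffineLike V) :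
    ∃ (c : X) (hc : c ∈ V), (∀ a, IsUnit (X.presheaf.germ V c hc a) ↔ IsUnit a) ∧
      ∀ W : Opens X, c ∈ W → V ≤ W := by
  obtain ⟨c, hc, h⟩ := hV.exists_point (PrimeIdeal.mk' (fun a => ¬ IsUnit a) (by simp)
    (fun a b => by rw [IsUnit.mul_iff]; tauto))
  have h' : ∀ a, IsUnit (X.presheaf.germ V c hc a) ↔ IsUnit a := fun a => (h a).trans not_not
  refine ⟨c, hc, h', fun W hW z hz => ?_⟩
  obtain ⟨a, ha, haW⟩ := hV.basis c hc W hW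
  exact haW z hz (((h' a).1 ha).map (X.presheaf.germ V z hz).hom)

lemma exists_isLocAway {U V : Opens X} (hU : AffineLike U) (hV : AffineLike V) (i : U ⟶ V) :
    ∃ f : X.presheaf.obj (op V), IsLocAway (X.presheaf.map i.op).hom f ∧
      ∀ (z : X) (hz : z ∈ V), IsUnit (X.presheaf.germ V z hz f) ↔ z ∈ U := by
  obtain ⟨c, hc, hcu, hcW⟩ := hU.exists_closedPoint
  have hcV : c ∈ V := i.le hc
  have hres (z : X) (hz : z ∈ U) (a : X.presheaf.obj (op V)) :
      X.presheaf.germ U z hz (X.presheaf.map i.op a) = X.presheaf.germ V z (i.le hz) a :=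
    TopCat.Presheaf.germ_res_apply _ _ _ _ _
  have hunit (a : X.presheaf.obj (op V)) :
      IsUnit (X.presheaf.germ V c hcV a) ↔ IsUnit (X.presheaf.map i.op a) := by
    rw [← hcu, hres]
  obtain ⟨f, hf, hfU⟩ := hV.basis c hcV U hc
  have hfU' : ∀ (z : X) (hz : z ∈ V), IsUnit (X.presheaf.germ V z hz f) ↔ z ∈ U := by
    refine fun z hz => ⟨hfU z hz, fun hzU => ?_⟩
    rw [← hres z hzU]
    exact ((hunit f).1 hf).map (X.presheaf.germ U z hzU).hom
  have hdvd (s : X.presheaf.obj (op V)) (hs : IsUnit (X.presheaf.map i.op s)) :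
      ∃ k d, s * d = f ^ k := by
    by_contra! hcon
    obtain ⟨y, hy, h⟩ := hV.exists_point (PrimeIdeal.mk' (fun a => ∀ k, ¬ a ∣ f ^ k)
      (fun h => h 0 (one_dvd _)) (fun a b => by
        constructor
        · intro h
          by_contra! h'
          obtain ⟨⟨k, hk⟩, ⟨l, hl⟩⟩ := h'
          exact h (k + l) (pow_add f k l ▸ mul_dvd_mul hk hl)
        · rintro (h | h) k hk
          · exact h k ((dvd_mul_right a b).trans hk)
          · exact h k ((dvd_mul_left b a).trans hk)))
    have hyU : y ∈ U := hfU y hy ((h f).2 fun h => h 1 (by simp))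
    have hsy : IsUnit (X.presheaf.germ V y hy s) := by
      rw [← hres y hyU]
      exact hs.map (X.presheaf.germ U y hyU).hom
    exact (h s).1 hsy fun k ⟨d, hd⟩ => hcon k d hd.symm
  refine ⟨f, ⟨(hunit f).1 hf, ?_, ?_⟩, hfU'⟩
  · intro b
    obtain ⟨a, s, hs, h⟩ := hV.surj c hcV (X.presheaf.germ U c hc b)
    rw [← hres c hc, ← hres c hc, ← map_mul] at h
    obtain ⟨s', hs', h'⟩ := hU.eq c hc _ _ h
    have h2 := ((hcu s').1 hs').mul_left_cancel h'
    obtain ⟨k, d, hd⟩ := hdvd s ((hunit s).1 hs)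
    refine ⟨a * d, k, ?_⟩
    change b * X.presheaf.map i.op (f ^ k) = X.presheaf.map i.op (a * d)
    rw [← hd, map_mul, map_mul, ← mul_assoc, h2]
  · intro a a' h
    have h1 : X.presheaf.germ V c hcV a = X.presheaf.germ V c hcV a' := by
      rw [← hres c hc, ← hres c hc]
      exact congr_arg _ h
    obtain ⟨s, hs, e⟩ := hV.eq c hcV _ _ h1
    obtain ⟨k, d, hd⟩ := hdvd s ((hunit s).1 hs)
    refine ⟨k, ?_⟩
    rw [← hd, mul_comm s d, mul_assoc, mul_assoc, e]

end Restrict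


/-! ### The push-out of monoids -/

section Tensor

variable {L A B : CommMonCat.{u}} (φ : L ⟶ A) (ψ : L ⟶ B)

/-- The relation `(φ(l) m, n) ∼ (m, ψ(l) n)` on `A × B`. -/
inductive TensorRel : A × B → A × B → Prop
  | of (l : L) (m : A) (n : B) : TensorRel (φ l * m, n) (m, ψ l * n)

/-- The equivalence relation on `A × B` generated by `(φ(l) m, n) ∼ (m, ψ(l) n)`; it is a
congruence. -/
def tensorCon : Con (A × B) where
  r := Relation.EqvGen (TensorRel φ ψ)
  iseqv := Relation.EqvGen.is_equivalence _
  mul' := by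
    have key (c : A × B) {a b : A × B} (h : Relation.EqvGen (TensorRel φ ψ) a b) :
        Relation.EqvGen (TensorRel φ ψ) (a * c) (b * c) := by
      induction h with
      | rel a b h =>
        obtain ⟨l, m, n⟩ := h
        have := TensorRel.of (φ := φ) (ψ := ψ) l (m * c.1) (n * c.2)
        rw [← mul_assoc, ← mul_assoc] at this
        exact .rel _ _ this
      | refl a => exact .refl _
      | symm a b _ h => exact .symm _ _ h
      | trans a b d _ _ h h' => exact .trans _ _ _ h h'
    intro a b c d hab hcd
    refine .trans _ _ _ (key c hab) ?_
    rw [mul_comm b c, mul_comm b d]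
    exact key b hcd

/-- The monoid `A ⊗_L B = (A × B) / ∼`. -/
def tensor : CommMonCat.{u} := CommMonCat.of (tensorCon φ ψ).Quotient

/-- The map `A → A ⊗_L B`, `a ↦ [a, 1]`. -/
def tensorInl : A ⟶ tensor φ ψ :=
  CommMonCat.ofHom ((tensorCon φ ψ).mk'.comp (MonoidHom.inl A B))

/-- The map `B → A ⊗_L B`, `b ↦ [1, b]`. -/
def tensorInr : B ⟶ tensor φ ψ :=
  CommMonCat.ofHom ((tensorCon φ ψ).mk'.comp (MonoidHom.inr A B))

end Tensor

end

end FOne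

namespace MonoidScheme

open FOne

noncomputable section

/-! ### Base extension of schemes -/

/-- The ordered set of affine open subsets of a scheme over `𝔽₁`. -/
abbrev AffOpens (X : MonoidScheme.{u}) : Type u :=
  {U : Opens X.toSheafedSpace // IsAffineOpen U}

/-- The diagram of schemes `U ↦ Spec ℤ[𝒪_X(U)]` indexed by the affine open subsets of `X`. -/
def zDiagram (X : MonoidScheme.{u}) : X.AffOpens ⥤ Scheme.{u} where
  obj U := AlgebraicGeometry.Spec (zExt.obj (X.presheaf.obj (op U.1)))
  map i := AlgebraicGeometry.Spec.map (zExt.map (X.presheaf.map (homOfLE i.le).op))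
  map_id U := by
    rw [show (homOfLE (𝟙 U : U ⟶ U).le).op = 𝟙 (op U.1) from rfl, CategoryTheory.Functor.map_id,
      CategoryTheory.Functor.map_id, AlgebraicGeometry.Spec.map_id]
  map_comp i j := by
    rw [← AlgebraicGeometry.Spec.map_comp, ← Functor.map_comp, ← Functor.map_comp]
    rfl

lemma zDiagram_isLocAway {X : MonoidScheme.{u}} {U V : X.AffOpens} (i : U ⟶ V) :
    ∃ f : X.presheaf.obj (op V.1), IsLocAway (X.presheaf.map (homOfLE i.le : U.1 ⟶ V.1).op).hom f ∧
      ∀ (z : X.toSheafedSpace) (hz : z ∈ V.1), IsUnit (X.presheaf.germ V.1 z hz f) ↔ z ∈ U.1 :=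
  FOne.exists_isLocAway U.2.affineLike V.2.affineLike (homOfLE i.le)

instance (X : MonoidScheme.{u}) {U V : X.AffOpens} (i : U ⟶ V) :
    IsOpenImmersion (X.zDiagram.map i) := by
  obtain ⟨f, hf, -⟩ := zDiagram_isLocAway i
  exact hf.isOpenImmersion_zExt

instance (X : MonoidScheme.{u}) : (X.zDiagram ⋙ Scheme.forget).IsLocallyDirected := by
  constructor
  intro U V W i j x y hxy
  let P := X.zDiagram.map i x
  have hx : X.zDiagram.map i x = P := rfl
  have hy : X.zDiagram.map j y = P := hxy.symm
  obtain ⟨f, hf, hfU⟩ := zDiagram_isLocAway i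
  obtain ⟨g, hg, hgV⟩ := zDiagram_isLocAway j
  have hfP := (hf.mem_range_zExt P).1 ⟨x, hx⟩
  have hgP := (hg.mem_range_zExt P).1 ⟨y, hy⟩
  obtain ⟨z, hz, hzP⟩ := W.2.affineLike.exists_point (primeBelow P)
  have hzU : z ∈ U.1 := (hfU z hz).1 ((hzP f).2 hfP)
  have hzV : z ∈ V.1 := (hgV z hz).1 ((hzP g).2 hgP)
  have hzUV : z ∈ U.1 ⊓ V.1 := ⟨hzU, hzV⟩
  obtain ⟨T, hzT, hT, hTa⟩ := exists_isAffineOpen_le hzUV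
  let T' : X.AffOpens := ⟨T, hTa⟩
  let k : T' ⟶ U := homOfLE (hT.trans inf_le_left)
  let l : T' ⟶ V := homOfLE (hT.trans inf_le_right)
  obtain ⟨h, hh, hhT⟩ := zDiagram_isLocAway (k ≫ i)
  have hhP : MonoidAlgebra.of ℤ _ h ∉ (PrimeSpectrum.asIdeal (R := MonoidAlgebra ℤ _) P) :=
    (hzP h).1 ((hhT z hz).2 hzT)
  obtain ⟨t, ht⟩ := (hh.mem_range_zExt P).2 hhP
  have hcomp (S : X.AffOpens) (a : T' ⟶ S) (b : S ⟶ W) (t : X.zDiagram.obj T') :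
      X.zDiagram.map b (X.zDiagram.map a t) = X.zDiagram.map (a ≫ b) t := by
    rw [Functor.map_comp, Scheme.Hom.comp_apply]
  have ht1 := (hcomp _ k i t).trans ht
  have ht2 := (hcomp _ l j t).trans ht
  refine ⟨T', k, l, t, ?_, ?_⟩
  · exact (X.zDiagram.map i).isOpenEmbedding.injective (ht1.trans hx.symm)
  · exact (X.zDiagram.map j).isOpenEmbedding.injective (ht2.trans hy.symm)

/-- The base extension `X ⊗ ℤ`: the scheme obtained by gluing the affine schemes
`Spec ℤ[𝒪_X(U)]`, `U ⊆ X` affine open, along the maps induced by the inclusions. -/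
def zObj (X : MonoidScheme.{u}) : Scheme.{u} := colimit X.zDiagram

/-- The canonical chart `Spec ℤ[𝒪_X(U)] ⟶ X ⊗ ℤ`. -/
def zChart (X : MonoidScheme.{u}) (U : X.AffOpens) :
    AlgebraicGeometry.Spec (zExt.obj (X.presheaf.obj (op U.1))) ⟶ X.zObj :=
  colimit.ι X.zDiagram U

lemma zDiagram_map_zChart (X : MonoidScheme.{u}) {U V : X.AffOpens} (h : U.1 ≤ V.1) :
    AlgebraicGeometry.Spec.map (zExt.map (X.presheaf.map (homOfLE h).op)) ≫ X.zChart V =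
      X.zChart U :=
  colimit.w X.zDiagram (homOfLE h : U ⟶ V)

lemma zObj_hom_ext {X : MonoidScheme.{u}} {T : Scheme.{u}} {f g : X.zObj ⟶ T}
    (h : ∀ U, X.zChart U ≫ f = X.zChart U ≫ g) : f = g :=
  colimit.hom_ext h

variable {X Y Z : MonoidScheme.{u}}

/-- Every affine open subset is mapped into an affine open subset. -/
lemma exists_affOpens_le (f : X ⟶ Y) (U : X.AffOpens) :
    ∃ V : Y.AffOpens, U.1 ≤ (Opens.map f.mor.hom.base).obj V.1 := by
  obtain ⟨c, hc, -, h⟩ := U.2.affineLike.exists_closedPoint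
  obtain ⟨V, hV, -, hVa⟩ := exists_isAffineOpen_le (X := Y) (x := f.mor.hom.base c) (W := ⊤) trivial
  exact ⟨⟨V, hVa⟩, h _ hV⟩

/-- The map `𝒪_Y(V) → 𝒪_X(U)` for `f(U) ⊆ V`. -/
def appLE (f : X ⟶ Y) (U : X.AffOpens) (V : Y.AffOpens)
    (h : U.1 ≤ (Opens.map f.mor.hom.base).obj V.1) :
    Y.presheaf.obj (op V.1) ⟶ X.presheaf.obj (op U.1) :=
  f.mor.hom.c.app (op V.1) ≫ X.presheaf.map (homOfLE h).op

/-- The map `Spec ℤ[𝒪_X(U)] ⟶ Spec ℤ[𝒪_Y(V)] ⟶ Y ⊗ ℤ` for `f(U) ⊆ V`. -/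
def zLocal (f : X ⟶ Y) (U : X.AffOpens) (V : Y.AffOpens)
    (h : U.1 ≤ (Opens.map f.mor.hom.base).obj V.1) :
    AlgebraicGeometry.Spec (zExt.obj (X.presheaf.obj (op U.1))) ⟶ Y.zObj :=
  AlgebraicGeometry.Spec.map (zExt.map (appLE f U V h)) ≫ Y.zChart V

lemma map_zLocal (f : X ⟶ Y) {U U' : X.AffOpens} (i : U.1 ≤ U'.1) (V : Y.AffOpens)
    (h : U'.1 ≤ (Opens.map f.mor.hom.base).obj V.1) :
    AlgebraicGeometry.Spec.map (zExt.map (X.presheaf.map (homOfLE i).op)) ≫ zLocal f U' V h =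
      zLocal f U V (i.trans h) := by
  rw [zLocal, zLocal, ← AlgebraicGeometry.Spec.map_comp_assoc, ← Functor.map_comp, appLE, appLE,
    Category.assoc, ← Functor.map_comp]
  rfl

lemma zLocal_of_le (f : X ⟶ Y) (U : X.AffOpens) {V V' : Y.AffOpens} (i : V.1 ≤ V'.1)
    (h : U.1 ≤ (Opens.map f.mor.hom.base).obj V.1)
    (h' : U.1 ≤ (Opens.map f.mor.hom.base).obj V'.1) :
    zLocal f U V h = zLocal f U V' h' := by
  have e : appLE f U V' h' = Y.presheaf.map (homOfLE i).op ≫ appLE f U V h := by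
    rw [appLE, appLE, NatTrans.naturality_assoc]
    congr 1
    exact X.presheaf.map_comp ((Opens.map f.mor.hom.base).map (homOfLE i)).op (homOfLE h).op
  rw [zLocal, zLocal, e, Functor.map_comp, AlgebraicGeometry.Spec.map_comp, Category.assoc,
    zDiagram_map_zChart]

lemma zLocal_eq (f : X ⟶ Y) (U : X.AffOpens) (V V' : Y.AffOpens)
    (h : U.1 ≤ (Opens.map f.mor.hom.base).obj V.1)
    (h' : U.1 ≤ (Opens.map f.mor.hom.base).obj V'.1) :
    zLocal f U V h = zLocal f U V' h' := by
  obtain ⟨c, hc, -, hW⟩ := U.2.affineLike.exists_closedPoint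
  have hcV : f.mor.hom.base c ∈ V.1 ⊓ V'.1 := ⟨h hc, h' hc⟩
  obtain ⟨T, hcT, hT, hTa⟩ := exists_isAffineOpen_le (X := Y) hcV
  have hUT : U.1 ≤ (Opens.map f.mor.hom.base).obj T := hW _ hcT
  rw [← zLocal_of_le f U (V := ⟨T, hTa⟩) (hT.trans inf_le_left) hUT h,
    zLocal_of_le f U (V := ⟨T, hTa⟩) (hT.trans inf_le_right) hUT h']

/-- The base extension of a morphism `f : X ⟶ Y`, glued from the maps
`Spec ℤ[𝒪_X(U)] ⟶ Spec ℤ[𝒪_Y(V)]` for affine open subsets with `f(U) ⊆ V`. -/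
def zMap (f : X ⟶ Y) : X.zObj ⟶ Y.zObj :=
  colimit.desc X.zDiagram
    { pt := Y.zObj
      ι :=
        { app := fun U => zLocal f U _ (exists_affOpens_le f U).choose_spec
          naturality := fun U U' i => by
            refine (map_zLocal f i.le _ _).trans ?_
            refine (zLocal_eq f U _ _ _ _).trans (Category.comp_id _).symm } }

lemma zChart_zMap (f : X ⟶ Y) (U : X.AffOpens) (V : Y.AffOpens)
    (h : U.1 ≤ (Opens.map f.mor.hom.base).obj V.1) :
    X.zChart U ≫ zMap f = AlgebraicGeometry.Spec.map (zExt.map (appLE f U V h)) ≫ Y.zChart V :=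
  (colimit.ι_desc _ _).trans (zLocal_eq f U _ V _ h)

/-- Base extension as a functor from schemes over `𝔽₁` to schemes over `ℤ`. -/
def baseExtension : MonoidScheme.{u} ⥤ Scheme.{u} where
  obj X := X.zObj
  map f := zMap f
  map_id X := by
    refine zObj_hom_ext fun U => ?_
    rw [zChart_zMap (𝟙 X) U U le_rfl, Category.comp_id]
    have : appLE (𝟙 X) U U le_rfl = 𝟙 _ := by
      refine (Category.id_comp _).trans ?_
      exact X.presheaf.map_id _
    rw [this, CategoryTheory.Functor.map_id, AlgebraicGeometry.Spec.map_id, Category.id_comp]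
  map_comp {X Y Z} f g := by
    refine zObj_hom_ext fun U => ?_
    obtain ⟨V, hV⟩ := exists_affOpens_le f U
    obtain ⟨W, hW⟩ := exists_affOpens_le g V
    have hUW : U.1 ≤ (Opens.map (f ≫ g).mor.hom.base).obj W.1 := fun x hx => hW (hV hx)
    rw [zChart_zMap (f ≫ g) U W hUW, ← Category.assoc, zChart_zMap f U V hV, Category.assoc,
      zChart_zMap g V W hW, ← Category.assoc, ← AlgebraicGeometry.Spec.map_comp,
      ← Functor.map_comp]
    congr 3
    rw [appLE, appLE, appLE, Category.assoc, NatTrans.naturality_assoc]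
    refine (Category.assoc _ _ _).trans ?_
    congr 2
    exact X.presheaf.map_comp ((Opens.map f.mor.hom.base).map (homOfLE hW)).op (homOfLE hV).op

end

end MonoidScheme

namespace FOne

noncomputable section

/-! ### Sections and morphisms of monoidal spaces via germs -/

section Germs

variable {X Y Z : SheafedSpace CommMonCat.{u}}

/-! The decisive difference from rings is that every monoid is local: its non-units form the largest
prime ideal. A prime ideal of `A` amounts to a homomorphism from `A` to the multiplicative monoid
`{0, 1}`, so a prime of `A ⊗_L B` is a pair of primes of `A` and `B` with the same restriction to
`L`. Hence the fibre product has no points beyond those of the topological fibre product, and it can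
be written down without gluing: its points are the pairs `(x, y)` with equal image in `S`, and its
sections are the families of elements of the push-outs of stalks at `(x, y)` that are locally of the
form `[a_x, b_y]` (`fibSpace`). The projections are local because `[a, b]` is invertible in a
push-out along local homomorphisms only if `a` and `b` are (`isUnit_of_isUnit_tensorMk`). The
universal property then holds for local morphisms from any monoidal space (`fibLift`,
`fib_mor_ext`).

In the affine case, local morphisms from any monoidal space `Z` to `Spec A` are homomorphisms `A →
Γ(Z)` (`mor_spec_ext`, `toSpec`), and `Γ(Spec A)` is `A` (`globalEquiv`) since the ideal of
non-units has no neighbourhood but the whole space. So `Spec` is fully faithful and turns push-outs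
into fibre products. Comparing universal properties shows that `Spec (A ⊗_L B)` is the open part of
`fibSpace` over compatible affine charts (`exists_fib_chart`), so `fibSpace` is an `𝔽₁`-scheme.

For base extension, `ℤ[A ⊗_L B]` is the push-out of `ℤ[A]` and `ℤ[B]` over `ℤ[L]`
(`isPushout_zExt_tensor`), which settles the affine case. In general a prime of `ℤ[A]` meets `A` in
a prime, so a point of `X ⊗ ℤ` lies over a point of `X`, well defined up to topological
indistinguishability (`Over`). A point lies in the base extension of a chart exactly when the point
below lies in the chart (`Over.mem_range_zMap_iff`). This shows that the affine charts cover the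
fibre product of schemes and that their inverse images under the canonical morphism are the
corresponding charts of the source. Thus the morphism is an isomorphism locally on its target. -/

lemma section_ext_germ {U : Opens X} {s t : X.presheaf.obj (op U)}
    (h : ∀ (x : X) (hx : x ∈ U), X.presheaf.germ U x hx s = X.presheaf.germ U x hx t) : s = t :=
  TopCat.Presheaf.section_ext X.sheaf U s t h

/-- Both germs live in the stalk at the same `x`, so no transport along the equality of the base
maps is needed. -/
lemma mor_ext_germ {f g : X ⟶ Y} (h : ∀ x, f.hom.base x = g.hom.base x)
    (h' : ∀ (U : Opens Y) (s : Y.presheaf.obj (op U)) (x : X) (hx : f.hom.base x ∈ U)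
      (hx' : g.hom.base x ∈ U),
      X.presheaf.germ ((Opens.map f.hom.base).obj U) x hx (f.hom.c.app (op U) s) =
        X.presheaf.germ ((Opens.map g.hom.base).obj U) x hx' (g.hom.c.app (op U) s)) : f = g := by
  obtain ⟨⟨f, fc⟩⟩ := f
  obtain ⟨⟨g, gc⟩⟩ := g
  obtain rfl : f = g := ConcreteCategory.hom_ext _ _ h
  congr 2
  ext U s
  exact section_ext_germ fun x hx => h' U s x hx hx

/-- A family of germs which is locally given by sections comes from a section. -/
lemma exists_section_of_germs {U : Opens X} (t : ∀ x ∈ U, X.presheaf.stalk x)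
    (h : ∀ x ∈ U, ∃ (V : Opens X) (_ : x ∈ V) (s : X.presheaf.obj (op V)),
      ∀ (z : X) (hz : z ∈ V) (hzU : z ∈ U), X.presheaf.germ V z hz s = t z hzU) :
    ∃ s : X.presheaf.obj (op U), ∀ (z : X) (hz : z ∈ U), X.presheaf.germ U z hz s = t z hz := by
  choose V hV s hs using h
  -- The given neighbourhoods need not lie in `U`, so the cover of `U` consists of their
  -- intersections with it.
  let W : U → Opens X := fun x => V x.1 x.2 ⊓ U
  let r : ∀ x : U, X.presheaf.obj (op (W x)) := fun x =>
    X.presheaf.map (Opens.infLELeft (V x.1 x.2) U).op (s x.1 x.2)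
  have hr (x : U) (z : X) (hz : z ∈ W x) : X.presheaf.germ (W x) z hz (r x) = t z hz.2 :=
    (TopCat.Presheaf.germ_res_apply _ _ _ _ _).trans (hs x.1 x.2 z hz.1 hz.2)
  obtain ⟨a, ha, -⟩ := X.sheaf.existsUnique_gluing' W U (fun x => Opens.infLERight _ _)
    (fun x hx => Opens.mem_iSup.2 ⟨⟨x, hx⟩, hV x hx, hx⟩) r (by
      intro x y
      refine section_ext_germ fun z hz => ?_
      refine (TopCat.Presheaf.germ_res_apply _ _ _ _ _).trans (Eq.trans ?_
        (TopCat.Presheaf.germ_res_apply _ _ _ _ _).symm)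
      rw [hr, hr])
  refine ⟨a, fun z hz => ?_⟩
  rw [← hr ⟨z, hz⟩ z ⟨hV z hz, hz⟩]
  refine Eq.trans ?_ (congr_arg _ (ha ⟨z, hz⟩))
  exact (TopCat.Presheaf.germ_res_apply _ _ _ _ _).symm

lemma germ_mul_germ {U V : Opens X} {x : X} (hU : x ∈ U) (hV : x ∈ V) (hUV : x ∈ U ⊓ V)
    (s : X.presheaf.obj (op U)) (t : X.presheaf.obj (op V)) :
    X.presheaf.germ U x hU s * X.presheaf.germ V x hV t =
      X.presheaf.germ (U ⊓ V) x hUV (X.presheaf.map (Opens.infLELeft U V).op s *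
        X.presheaf.map (Opens.infLERight U V).op t) := by
  rw [map_mul, TopCat.Presheaf.germ_res_apply, TopCat.Presheaf.germ_res_apply]

/-- A unit germ has an inverse on a neighbourhood. -/
lemma exists_inverse_of_isUnit_germ {U : Opens X} {x : X} {hx : x ∈ U} {s : X.presheaf.obj (op U)}
    (h : IsUnit (X.presheaf.germ U x hx s)) :
    ∃ (V : Opens X) (_ : x ∈ V) (t : X.presheaf.obj (op V)),
      ∀ (z : X) (hz : z ∈ V), ∃ hzU : z ∈ U,
        X.presheaf.germ U z hzU s * X.presheaf.germ V z hz t = 1 := by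
  obtain ⟨y, hy⟩ := isUnit_iff_exists_inv.1 h
  obtain ⟨V, hV, t, rfl⟩ := X.presheaf.exists_germ_eq y
  have hUV : x ∈ U ⊓ V := ⟨hx, hV⟩
  rw [germ_mul_germ hx hV hUV, ← map_one (X.presheaf.germ (U ⊓ V) x hUV).hom] at hy
  -- The product of the two germs equals the germ of `1`, so the two sections already agree on a
  -- neighbourhood.
  obtain ⟨W, hW, i, j, e'⟩ := X.presheaf.germ_eq x hUV hUV _ _ hy
  refine ⟨W, hW, X.presheaf.map (i ≫ Opens.infLERight U V).op t, fun z hz => ⟨(i.le hz).1, ?_⟩⟩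
  rw [TopCat.Presheaf.germ_res_apply, germ_mul_germ (i.le hz).1 (i.le hz).2 (i.le hz)]
  refine (TopCat.Presheaf.germ_res_apply _ i z hz _).symm.trans ?_
  refine (congr_arg _ e').trans ?_
  rw [map_one, map_one]

/-- The locus where a germ is invertible is open. -/
lemma isOpen_isUnit_germ (U : Opens X) (s : X.presheaf.obj (op U)) :
    IsOpen {x : X | ∃ hx : x ∈ U, IsUnit (X.presheaf.germ U x hx s)} := by
  rw [isOpen_iff_forall_mem_open]
  rintro x ⟨hx, h⟩
  obtain ⟨V, hV, t, ht⟩ := exists_inverse_of_isUnit_germ h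
  refine ⟨V, fun z hz => ?_, V.2, hV⟩
  obtain ⟨hzU, e⟩ := ht z hz
  exact ⟨hzU, isUnit_iff_exists_inv.2 ⟨_, e⟩⟩

/-! ### Morphisms given by their effect on points and germs. -/

section HomOfGerms

variable (b : Z.carrier ⟶ Y.carrier)
  (θ : ∀ (U : Opens Y) (z : Z), b z ∈ U → (Y.presheaf.obj (op U) →* Z.presheaf.stalk z))
  (hθ : ∀ (U V : Opens Y) (i : V ⟶ U) (z : Z) (hz : b z ∈ V) (s : Y.presheaf.obj (op U)),
    θ V z hz (Y.presheaf.map i.op s) = θ U z (i.le hz) s)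
  (hloc : ∀ (U : Opens Y) (s : Y.presheaf.obj (op U)) (z : Z) (_ : b z ∈ U),
    ∃ (V : Opens Z) (_ : z ∈ V) (t : Z.presheaf.obj (op V)), ∀ (w : Z) (hw : w ∈ V) (hwU : b w ∈ U),
      Z.presheaf.germ V w hw t = θ U w hwU s)

/-- The map on sections determined by its effect on germs. -/
def secOfGerms (U : Opens Y) :
    Y.presheaf.obj (op U) ⟶ Z.presheaf.obj (op ((Opens.map b).obj U)) :=
  have h (s) := exists_section_of_germs (U := (Opens.map b).obj U) (fun z hz => θ U z hz s)
    (fun z hz => hloc U s z hz)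
  CommMonCat.ofHom
    { toFun := fun s => (h s).choose
      map_one' := section_ext_germ fun z hz =>
        ((h 1).choose_spec z hz).trans ((map_one (θ U z hz)).trans (map_one
          (Z.presheaf.germ ((Opens.map b).obj U) z hz).hom).symm)
      map_mul' := fun s t => section_ext_germ fun z hz => by
        refine ((h (s * t)).choose_spec z hz).trans ((map_mul (θ U z hz) s t).trans ?_)
        rw [map_mul]
        exact congr_arg₂ (· * ·) ((h s).choose_spec z hz).symm ((h t).choose_spec z hz).symm }

lemma germ_secOfGerms (U : Opens Y) (s : Y.presheaf.obj (op U)) (z : Z)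
    (hz : z ∈ (Opens.map b).obj U) :
    Z.presheaf.germ _ z hz (secOfGerms b θ hloc U s) = θ U z hz s :=
  (exists_section_of_germs (U := (Opens.map b).obj U) (fun z hz => θ U z hz s)
    (fun z hz => hloc U s z hz)).choose_spec z hz

/-- The morphism of monoidal spaces determined by its effect on points and germs. -/
def homOfGerms : Z ⟶ Y :=
  InducedCategory.homMk
    { base := b
      c :=
        { app := fun U => secOfGerms b θ hloc U.unop
          naturality := fun U V i => by
            ext s
            refine section_ext_germ fun z hz => ?_
            refine (germ_secOfGerms b θ hloc V.unop _ z hz).trans ?_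
            refine (hθ U.unop V.unop i.unop z hz s).trans ?_
            refine (germ_secOfGerms b θ hloc U.unop s z (i.unop.le hz)).symm.trans ?_
            exact (TopCat.Presheaf.germ_res_apply Z.presheaf
              ((Opens.map b).map i.unop) z hz _).symm } }

lemma germ_homOfGerms (U : Opens Y) (s : Y.presheaf.obj (op U)) (z : Z) (hz : b z ∈ U) :
    Z.presheaf.germ ((Opens.map b).obj U) z hz ((homOfGerms b θ hθ hloc).hom.c.app (op U) s) =
      θ U z hz s :=
  germ_secOfGerms b θ hloc U s z hz

end HomOfGerms

/-! ### Local morphisms and open immersions. -/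

lemma isLocalMor_of_isOpenImmersion (j : X ⟶ Y) [SheafedSpace.IsOpenImmersion j] :
    IsLocalMor j := fun x => ⟨fun _ h => (isUnit_iff_of_isIso (j.hom.stalkMap x) _).1 h⟩

/-- A germ with invertible image under `f` lifts along `g`. Locality of the composite makes the lift
a unit, and units map to units. -/
lemma IsLocalMor.of_comp {f : X ⟶ Y} {g : Y ⟶ Z} (h : IsLocalMor (f ≫ g))
    (hg' : ∀ y : Y, Function.Surjective (g.hom.stalkMap y)) : IsLocalMor f := by
  intro x
  refine ⟨fun t ht => ?_⟩
  obtain ⟨s, rfl⟩ := hg' _ t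
  refine IsUnit.map (g.hom.stalkMap _).hom ((h x).1 s ?_)
  rw [show (f ≫ g).hom.stalkMap x = _ from PresheafedSpace.stalkMap.comp f.hom g.hom x]
  exact ht

/-- Lift of a local morphism along an open immersion. -/
lemma exists_lift_of_isOpenImmersion (j : Y ⟶ Z) [SheafedSpace.IsOpenImmersion j] (f : X ⟶ Z)
    (hf : IsLocalMor f) (h : Set.range f.hom.base ⊆ Set.range j.hom.base) :
    ∃ l : X ⟶ Y, IsLocalMor l ∧ l ≫ j = f := by
  have : PresheafedSpace.IsOpenImmersion j.hom := ‹_›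
  let l : X ⟶ Y := InducedCategory.homMk (PresheafedSpace.IsOpenImmersion.lift j.hom f.hom h)
  have hl : l ≫ j = f :=
    InducedCategory.hom_ext (PresheafedSpace.IsOpenImmersion.lift_fac j.hom f.hom h)
  refine ⟨l, ?_, hl⟩
  refine IsLocalMor.of_comp (g := j) (hl ▸ hf) fun y => ?_
  exact ((ConcreteCategory.isIso_iff_bijective _).1 inferInstance).2

end Germs

end

end FOne

namespace FOne

noncomputable section

/-! ### The universal property of the spectrum -/

section SpecUniversal

variable {A B : CommMonCat.{u}} {Z Z' : SheafedSpace CommMonCat.{u}}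

/-- The homomorphism `A → Γ(Z)` induced by a morphism `Z ⟶ Spec A`. -/
def globalHom (f : Z ⟶ specSpace A) : A →* Z.presheaf.obj (op ⊤) :=
  (f.hom.c.app (op ⊤)).hom.comp (toGlobal A)

/-- In the stalk of `Spec A` one has `(a / g) · (g / 1) = a / 1`. Applying the stalk map gives the
effect of `f` on fractions in terms of global sections alone, with denominators cleared. -/
lemma germ_app_secFrac_mul {U : Opens (specTop A)} (f : Z ⟶ specSpace A) {a g : A} {hg}
    (z : Z) (hz : f.hom.base z ∈ U) :
    Z.presheaf.germ ((Opens.map f.hom.base).obj U) z hz (f.hom.c.app (op U) (secFrac U a g hg)) *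
      Z.presheaf.germ ⊤ z trivial (globalHom f g) = Z.presheaf.germ ⊤ z trivial (globalHom f a) := by
  have e (V : Opens (specTop A)) (hV : f.hom.base z ∈ V) (s : (specPresheaf A).obj (op V)) :
      f.hom.stalkMap z ((specPresheaf A).germ V _ hV s) =
        Z.presheaf.germ ((Opens.map f.hom.base).obj V) z hV (f.hom.c.app (op V) s) :=
    PresheafedSpace.stalkMap_germ_apply f.hom V z hV s
  have e1 := e U hz (secFrac U a g hg)
  have e2 := e ⊤ trivial (toGlobal A g)
  have e3 := e ⊤ trivial (toGlobal A a)
  refine (congr_arg₂ (· * ·) e1.symm e2.symm).trans (Eq.trans ?_ e3)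
  refine (map_mul (f.hom.stalkMap z).hom _ _).symm.trans (congr_arg _ ?_)
  refine (germ_mul_germ_eq_iff _ _ _ _ _ _ _).2 ?_
  refine (frac_mul (hf := hg _ hz) (hg := one_mem _)).trans (frac_eq_iff.2 ⟨1, one_mem _, ?_⟩)
  simp [mul_comm]

/-- Locality lets the map `A → Γ(Z)` recover the point `f(z)`: its prime ideal consists of the
elements whose germ at `z` is not invertible. -/
lemma isUnit_germ_globalHom_iff {f : Z ⟶ specSpace A} (hf : IsLocalMor f) (z : Z) (a : A) :
    IsUnit (Z.presheaf.germ ⊤ z trivial (globalHom f a)) ↔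
      a ∉ PrimeIdeal.ideal (A := A) (f.hom.base z) := by
  refine Iff.trans ?_ (isUnit_germ_toGlobal (A := A) _ a)
  constructor
  · exact fun h => (isLocalMor_iff f).1 hf z ⊤ trivial (toGlobal A a) h
  · intro h
    have := h.map (f.hom.stalkMap z).hom
    exact (PresheafedSpace.stalkMap_germ_apply f.hom ⊤ z trivial (toGlobal A a)) ▸ this

/-- The points are recovered by `isUnit_germ_globalHom_iff`. Sections are locally fractions `a / d`
whose denominator becomes a unit germ at `z`, so it may be cancelled after applying
`germ_app_secFrac_mul`. -/
lemma mor_spec_ext {f g : Z ⟶ specSpace A} (hf : IsLocalMor f) (hg : IsLocalMor g)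
    (h : globalHom f = globalHom g) : f = g := by
  refine mor_ext_germ (fun z => PrimeIdeal.ext' (A := A) fun a => ?_) fun U s z hz hz' => ?_
  · rw [← not_iff_not]
    refine (isUnit_germ_globalHom_iff hf z a).symm.trans ?_
    rw [h]
    exact isUnit_germ_globalHom_iff hg z a
  · obtain ⟨V, hV, i, a, d, e⟩ := sec_locally s ⟨_, hz⟩
    have hgz : g.hom.base z = f.hom.base z := PrimeIdeal.ext' (A := A) fun a => by
      rw [← not_iff_not]
      refine (isUnit_germ_globalHom_iff hg z a).symm.trans ?_
      rw [← h]
      exact isUnit_germ_globalHom_iff hf z a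
    have hgV : g.hom.base z ∈ V := hgz ▸ hV
    have hs : (specPresheaf A).map i.op s = secFrac V a d (fun p hp => (e ⟨p, hp⟩).1) :=
      sec_ext fun p => (e p).2
    have hres (k : Z ⟶ specSpace A) (hk : k.hom.base z ∈ V) :
        Z.presheaf.germ ((Opens.map k.hom.base).obj U) z (i.le hk) (k.hom.c.app (op U) s) =
          Z.presheaf.germ ((Opens.map k.hom.base).obj V) z hk
            (k.hom.c.app (op V) ((specPresheaf A).map i.op s)) := by
      rw [show k.hom.c.app (op V) ((specPresheaf A).map i.op s) = _ from
        ConcreteCategory.congr_hom (k.hom.c.naturality i.op) s]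
      exact (TopCat.Presheaf.germ_res_apply Z.presheaf
        ((Opens.map k.hom.base).map i) z hk _).symm
    rw [hres f hV, hres g hgV, hs]
    have hd : IsUnit (Z.presheaf.germ ⊤ z trivial (globalHom f d)) :=
      (isUnit_germ_globalHom_iff hf z d).2 (e ⟨_, hV⟩).1
    refine hd.mul_right_cancel ?_
    rw [germ_app_secFrac_mul f z hV]
    rw [h, germ_app_secFrac_mul g z hgV]

/-! ### The morphism to `Spec A` induced by a homomorphism to the global sections. -/

section ToSpec

variable (θ : A →* Z.presheaf.obj (op ⊤))

/-- The map on points of the morphism `Z ⟶ Spec A` induced by `A → Γ(Z)`. -/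
def toSpecBase : Z.carrier ⟶ specTop A :=
  TopCat.ofHom
    { toFun := fun z => PrimeIdeal.mk' (A := A)
        (fun a => ¬ IsUnit (Z.presheaf.germ ⊤ z trivial (θ a))) (by simp)
        (fun a b => by rw [map_mul, map_mul, IsUnit.mul_iff]; tauto)
      continuous_toFun := by
        rw [continuous_def]
        intro U hU
        rw [isOpen_iff_forall_mem_open]
        intro z hz
        obtain ⟨f, hf, hfU⟩ := PrimeIdeal.exists_basicOpen_le (U := ⟨U, hU⟩) hz
        refine ⟨_, fun w hw => hfU ?_, isOpen_isUnit_germ ⊤ (θ f), ⟨trivial, not_not.1 hf⟩⟩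
        exact not_not.2 hw.2 }

lemma mem_specCompl_toSpecBase {z : Z} {a : A} :
    a ∈ specCompl (toSpecBase θ z) ↔ IsUnit (Z.presheaf.germ ⊤ z trivial (θ a)) := not_not

/-- The map on stalks of the morphism `Z ⟶ Spec A` induced by `A → Γ(Z)`. -/
def toSpecLoc (z : Z) : LocAt (toSpecBase θ z) →* Z.presheaf.stalk z :=
  let g : A →* Z.presheaf.stalk z := (Z.presheaf.germ ⊤ z trivial).hom.comp θ
  have hg : ∀ y : specCompl (toSpecBase θ z), IsUnit (g y) := fun y =>
    (mem_specCompl_toSpecBase θ).1 y.2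
  (Localization.monoidOf (specCompl (toSpecBase θ z))).lift hg

lemma toSpecLoc_frac (z : Z) (a f : A) (h) :
    toSpecLoc θ z (frac _ a f h) * Z.presheaf.germ ⊤ z trivial (θ f) =
      Z.presheaf.germ ⊤ z trivial (θ a) := by
  unfold frac
  rw [Localization.mk_eq_monoidOf_mk'_apply, mul_comm]
  let g : A →* Z.presheaf.stalk z := (Z.presheaf.germ ⊤ z trivial).hom.comp θ
  have hg : ∀ y : specCompl (toSpecBase θ z), IsUnit (g y) := fun y =>
    (mem_specCompl_toSpecBase θ).1 y.2
  exact ((Localization.monoidOf (specCompl (toSpecBase θ z))).lift_mk'_spec hg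
    a _ ⟨f, h⟩).1 rfl |>.symm

/-- The action of the morphism `Z ⟶ Spec A` induced by `A → Γ(Z)` on germs. -/
def toSpecGerm (U : Opens (specTop A)) (z : Z) (h : toSpecBase θ z ∈ U) :
    (specPresheaf A).obj (op U) →* Z.presheaf.stalk z where
  toFun s := toSpecLoc θ z (secVal s ⟨_, h⟩)
  map_one' := map_one (toSpecLoc θ z)
  map_mul' _ _ := map_mul (toSpecLoc θ z) _ _

/-- Near `z` the section is a fraction `a / f`, and `θ f` has an inverse `t` on a neighbourhood
because its germ is a unit; the product of `θ a` and `t` has the required germs. -/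
lemma toSpecGerm_locally (U : Opens (specTop A)) (s : (specPresheaf A).obj (op U)) (z : Z)
    (hz : toSpecBase θ z ∈ U) :
    ∃ (V : Opens Z) (_ : z ∈ V) (t : Z.presheaf.obj (op V)),
      ∀ (w : Z) (hw : w ∈ V) (hwU : toSpecBase θ w ∈ U),
        Z.presheaf.germ V w hw t = toSpecGerm θ U w hwU s := by
  obtain ⟨V, hV, i, a, f, h⟩ := sec_locally s ⟨_, hz⟩
  obtain ⟨hf, -⟩ := h ⟨_, hV⟩
  obtain ⟨W, hW, t, ht⟩ := exists_inverse_of_isUnit_germ ((mem_specCompl_toSpecBase θ).1 hf)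
  refine ⟨W ⊓ (Opens.map (toSpecBase θ)).obj V, ⟨hW, hV⟩,
    Z.presheaf.map (homOfLE le_top).op (θ a) * Z.presheaf.map (Opens.infLELeft _ _).op t,
    fun w hw hwU => ?_⟩
  obtain ⟨hf', e⟩ := h ⟨_, hw.2⟩
  obtain ⟨_, e2⟩ := ht w hw.1
  rw [map_mul, TopCat.Presheaf.germ_res_apply, TopCat.Presheaf.germ_res_apply]
  refine Eq.trans ?_ (congr_arg (toSpecLoc θ w) e).symm
  rw [← toSpecLoc_frac θ w a f hf', mul_assoc, e2, mul_one]

/-- The morphism `Z ⟶ Spec A` induced by `A → Γ(Z)`. -/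
def toSpec : Z ⟶ specSpace A :=
  homOfGerms (Y := specSpace A) (toSpecBase θ) (toSpecGerm θ) (fun _ _ _ _ _ _ => rfl)
    (toSpecGerm_locally θ)

lemma germ_toSpec (U : Opens (specTop A)) (s : (specPresheaf A).obj (op U)) (z : Z)
    (hz : toSpecBase θ z ∈ U) :
    Z.presheaf.germ ((Opens.map (toSpecBase θ)).obj U) z hz ((toSpec θ).hom.c.app (op U) s) =
      toSpecLoc θ z (secVal s ⟨_, hz⟩) :=
  germ_homOfGerms (Y := specSpace A) (toSpecBase θ) (toSpecGerm θ) (fun _ _ _ _ _ _ => rfl)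
    (toSpecGerm_locally θ) U s z hz

/-- The points were chosen for this: if `a / f` maps to a unit, then so does `a`, its image being
that of `a / f` times a unit. Hence `a` lies outside the prime and `a / f` is invertible. -/
lemma isLocalMor_toSpec : IsLocalMor (toSpec θ) := by
  rw [isLocalMor_iff]
  intro z U hz s hs
  refine (isUnit_germ_iff (toSpecBase θ z) hz s).2 ?_
  obtain ⟨a, f, hf, e⟩ := exists_frac (secVal s ⟨toSpecBase θ z, hz⟩)
  have h1 := (germ_toSpec θ U s z hz).trans (congr_arg _ e)
  have h2 : IsUnit (toSpecLoc θ z (frac _ a f hf)) := h1 ▸ hs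
  rw [e, isUnit_frac_iff, mem_specCompl_toSpecBase, ← toSpecLoc_frac θ z a f hf]
  exact h2.mul ((mem_specCompl_toSpecBase θ).1 hf)

lemma globalHom_toSpec : globalHom (toSpec θ) = θ := by
  ext a
  refine section_ext_germ fun z hz => ?_
  refine (germ_toSpec θ ⊤ (toGlobal A a) z trivial).trans ?_
  have := toSpecLoc_frac θ z a 1 (one_mem _)
  rw [map_one, map_one, mul_one] at this
  exact this

end ToSpec

lemma globalHom_comp_specSpaceMap (φ : A ⟶ B) (f : Z ⟶ specSpace B) :
    globalHom (f ≫ specSpaceMap φ) = (globalHom f).comp φ.hom := by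
  ext a
  refine congr_arg (f.hom.c.app (op ⊤)) (sec_ext fun p => ?_ :
    secMap φ ⊤ (toGlobal A a) = toGlobal B (φ.hom a))
  refine (locMap_frac φ p.1 a 1 (one_mem _)).trans (frac_eq_iff.2 ⟨1, one_mem _, ?_⟩)
  simp

/-! ### Global sections of `Spec A`, and morphisms between spectra. -/

lemma toGlobal_injective (A : CommMonCat.{u}) : Function.Injective (toGlobal A) := by
  intro a b h
  -- At the prime of non-units all denominators are already units of `A`, so localizing there
  -- identifies nothing.
  let c : specTop A := PrimeIdeal.mk' (fun a => ¬ IsUnit a) (by simp)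
    (fun a b => by rw [IsUnit.mul_iff]; tauto)
  have h1 : frac c a 1 (one_mem _) = frac c b 1 (one_mem _) :=
    congr_arg (fun s => secVal s (⟨c, trivial⟩ : (⊤ : Opens (specTop A)))) h
  obtain ⟨d, hd, e⟩ := frac_eq_iff.1 h1
  have hu : IsUnit d := not_not.1 hd
  simpa using hu.mul_left_cancel e

/-- The isomorphism `A ≃ Γ(Spec A)`. -/
def globalEquiv (A : CommMonCat.{u}) : A ≃* (specPresheaf A).obj (op ⊤) :=
  MulEquiv.ofBijective (toGlobal A) ⟨toGlobal_injective A, toGlobal_surjective A⟩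

lemma globalHom_specSpaceMap (φ : A ⟶ B) :
    globalHom (specSpaceMap φ) = (toGlobal B).comp φ.hom := by
  rw [← Category.id_comp (specSpaceMap φ), globalHom_comp_specSpaceMap]
  rfl

/-- Local morphisms are determined by their homomorphism `A → Γ(Spec B)`, and `globalEquiv`
identifies the target with `B`. -/
lemma existsUnique_specSpaceMap {f : specSpace B ⟶ specSpace A} (hf : IsLocalMor f) :
    ∃! φ : A ⟶ B, specSpaceMap φ = f := by
  refine ⟨CommMonCat.ofHom ((globalEquiv B).symm.toMonoidHom.comp (globalHom f)), ?_, ?_⟩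
  · refine mor_spec_ext (specSpaceMap_isLocal _) hf ?_
    rw [globalHom_specSpaceMap]
    ext a
    exact (globalEquiv B).apply_symm_apply (globalHom f a)
  · rintro φ rfl
    ext a
    refine ((globalEquiv B).symm_apply_apply (φ.hom a)).symm.trans (congr_arg _ ?_)
    exact (DFunLike.congr_fun (globalHom_specSpaceMap φ) a).symm

end SpecUniversal

/-! ### The push-out of monoids -/

section Tensor

variable {L A B : CommMonCat.{u}} {φ : L ⟶ A} {ψ : L ⟶ B}

/-- The element `[a, b]` of `A ⊗_L B`. -/
def tensorMk (φ : L ⟶ A) (ψ : L ⟶ B) (a : A) (b : B) : tensor φ ψ :=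
  (tensorCon φ ψ).mk' (a, b)

lemma tensorMk_mul (a a' : A) (b b' : B) :
    tensorMk φ ψ a b * tensorMk φ ψ a' b' = tensorMk φ ψ (a * a') (b * b') := rfl

lemma tensorInl_apply (a : A) : tensorInl φ ψ a = tensorMk φ ψ a 1 := rfl

lemma tensorInr_apply (b : B) : tensorInr φ ψ b = tensorMk φ ψ 1 b := rfl

lemma exists_tensorMk (t : tensor φ ψ) : ∃ a b, t = tensorMk φ ψ a b := by
  induction t using Con.induction_on with
  | H x => exact ⟨x.1, x.2, rfl⟩

lemma tensorMk_eq (a : A) (b : B) :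
    tensorMk φ ψ a b = tensorInl φ ψ a * tensorInr φ ψ b := by
  rw [tensorInl_apply, tensorInr_apply, tensorMk_mul, mul_one, one_mul]

lemma tensorMk_map (l : L) : tensorMk φ ψ (φ l) 1 = tensorMk φ ψ 1 (ψ l) := by
  have := TensorRel.of (φ := φ) (ψ := ψ) l 1 1
  rw [mul_one, mul_one] at this
  exact (Con.eq _).2 (Relation.EqvGen.rel _ _ this)

/-- The homomorphism out of `A ⊗_L B` induced by compatible homomorphisms. -/
def tensorDesc {M : Type u} [CommMonoid M] (α : A →* M) (β : B →* M)
    (h : ∀ l : L, α (φ l) = β (ψ l)) : tensor φ ψ →* M :=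
  (tensorCon φ ψ).lift (α.coprod β) (by
    intro x y hxy
    change α.coprod β x = α.coprod β y
    induction (hxy : Relation.EqvGen (TensorRel φ ψ) x y) with
    | rel a b hab =>
      obtain ⟨l, m, n⟩ := hab
      simp only [MonoidHom.coprod_apply, map_mul, h]
      ac_rfl
    | refl a => rfl
    | symm a b _ ih => exact ih.symm
    | trans a b c _ _ ih ih' => exact ih.trans ih')

lemma tensorDesc_mk {M : Type u} [CommMonoid M] {α : A →* M} {β : B →* M} {h} (a : A) (b : B) :
    tensorDesc (φ := φ) (ψ := ψ) α β h (tensorMk φ ψ a b) = α a * β b := rfl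

lemma tensorDesc_inl {M : Type u} [CommMonoid M] (α : A →* M) (β : B →* M)
    (h : ∀ l : L, α (φ l) = β (ψ l)) (a : A) :
    tensorDesc α β h (tensorInl φ ψ a) = α a := by
  rw [tensorInl_apply, tensorDesc_mk, map_one, mul_one]

lemma tensorDesc_inr {M : Type u} [CommMonoid M] (α : A →* M) (β : B →* M)
    (h : ∀ l : L, α (φ l) = β (ψ l)) (b : B) :
    tensorDesc α β h (tensorInr φ ψ b) = β b := by
  rw [tensorInr_apply, tensorDesc_mk, map_one, one_mul]

lemma tensor_hom_ext {M : Type u} [CommMonoid M] {f g : tensor φ ψ →* M}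
    (h1 : ∀ a, f (tensorInl φ ψ a) = g (tensorInl φ ψ a))
    (h2 : ∀ b, f (tensorInr φ ψ b) = g (tensorInr φ ψ b)) : f = g := by
  ext t
  obtain ⟨a, b, rfl⟩ := exists_tensorMk t
  rw [tensorMk_eq, map_mul, map_mul, h1, h2]

lemma tensor_condition (φ : L ⟶ A) (ψ : L ⟶ B) :
    φ ≫ tensorInl φ ψ = ψ ≫ tensorInr φ ψ := by
  ext l
  exact tensorMk_map l

lemma isPushout_tensor (φ : L ⟶ A) (ψ : L ⟶ B) :
    IsPushout φ ψ (tensorInl φ ψ) (tensorInr φ ψ) where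
  w := tensor_condition φ ψ
  isColimit' := ⟨PushoutCocone.IsColimit.mk _
    (fun s => CommMonCat.ofHom (tensorDesc s.inl.hom s.inr.hom
      (fun l => ConcreteCategory.congr_hom s.condition l)))
    (fun s => by
      ext a
      exact tensorDesc_inl s.inl.hom s.inr.hom (fun l => ConcreteCategory.congr_hom s.condition l) a)
    (fun s => by
      ext b
      exact tensorDesc_inr s.inl.hom s.inr.hom (fun l => ConcreteCategory.congr_hom s.condition l) b)
    (fun s m h1 h2 => by
      ext1
      refine tensor_hom_ext (fun a => ?_) (fun b => ?_)
      · refine (ConcreteCategory.congr_hom h1 a).trans ?_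
        exact (tensorDesc_inl s.inl.hom s.inr.hom
          (fun l => ConcreteCategory.congr_hom s.condition l) a).symm
      · refine (ConcreteCategory.congr_hom h2 b).trans ?_
        exact (tensorDesc_inr s.inl.hom s.inr.hom
          (fun l => ConcreteCategory.congr_hom s.condition l) b).symm)⟩

/-- If `φ` and `ψ` are local, then `[a, b]` is invertible only if `a` and `b` are. -/
lemma isUnit_of_isUnit_tensorMk [IsLocalHom φ.hom] [IsLocalHom ψ.hom] {a : A} {b : B}
    (h : IsUnit (tensorMk φ ψ a b)) : IsUnit a ∧ IsUnit b := by
  -- Being a pair of units is invariant under the generating relation: by locality, `φ l` and `ψ l`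
  -- are each invertible exactly when `l` is.
  have key (x y : A × B) (hxy : Relation.EqvGen (TensorRel φ ψ) x y) :
      (IsUnit x.1 ∧ IsUnit x.2) ↔ (IsUnit y.1 ∧ IsUnit y.2) := by
    induction hxy with
    | rel a b hab =>
      obtain ⟨l, m, n⟩ := hab
      have h1 : IsUnit (φ l) ↔ IsUnit l := isUnit_map_iff φ.hom l
      have h2 : IsUnit (ψ l) ↔ IsUnit l := isUnit_map_iff ψ.hom l
      simp only [IsUnit.mul_iff, h1, h2]
      tauto
    | refl a => rfl
    | symm a b _ ih => exact ih.symm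
    | trans a b c _ _ ih ih' => exact ih.trans ih'
  obtain ⟨t, ht⟩ := isUnit_iff_exists_inv.1 h
  obtain ⟨a', b', rfl⟩ := exists_tensorMk t
  -- The product of a representative with one of the inverse is equivalent to `(1, 1)`, hence is a
  -- pair of units.
  have h2 := (key _ _ ((Con.eq _).1 ht)).2 ⟨isUnit_one, isUnit_one⟩
  exact ⟨isUnit_of_mul_isUnit_left h2.1, isUnit_of_mul_isUnit_left h2.2⟩

end Tensor

/-! ### Spectra of push-outs. -/

/-- Universal property of `Spec (A ⊗_L B)` among all monoidal spaces. -/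
lemma exists_lift_spec_tensor {L A B : CommMonCat.{u}} (φ : L ⟶ A) (ψ : L ⟶ B)
    {Z : SheafedSpace CommMonCat.{u}} {f : Z ⟶ specSpace A} {g : Z ⟶ specSpace B}
    (hf : IsLocalMor f) (hg : IsLocalMor g) (h : f ≫ specSpaceMap φ = g ≫ specSpaceMap ψ) :
    ∃ k : Z ⟶ specSpace (tensor φ ψ), IsLocalMor k ∧
      k ≫ specSpaceMap (tensorInl φ ψ) = f ∧ k ≫ specSpaceMap (tensorInr φ ψ) = g := by
  have h' := congr_arg globalHom h
  rw [globalHom_comp_specSpaceMap, globalHom_comp_specSpaceMap] at h'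
  let θ : tensor φ ψ →* Z.presheaf.obj (op ⊤) :=
    tensorDesc (globalHom f) (globalHom g) (fun l => DFunLike.congr_fun h' l)
  have hθ := isLocalMor_toSpec θ
  refine ⟨toSpec θ, hθ, ?_, ?_⟩
  · refine mor_spec_ext (hθ.comp (specSpaceMap_isLocal _)) hf ?_
    rw [globalHom_comp_specSpaceMap, globalHom_toSpec]
    ext a
    exact tensorDesc_inl _ _ (fun l => DFunLike.congr_fun h' l) a
  · refine mor_spec_ext (hθ.comp (specSpaceMap_isLocal _)) hg ?_
    rw [globalHom_comp_specSpaceMap, globalHom_toSpec]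
    ext b
    exact tensorDesc_inr _ _ (fun l => DFunLike.congr_fun h' l) b

lemma mor_spec_tensor_ext {L A B : CommMonCat.{u}} {φ : L ⟶ A} {ψ : L ⟶ B}
    {Z : SheafedSpace CommMonCat.{u}} {f g : Z ⟶ specSpace (tensor φ ψ)}
    (hf : IsLocalMor f) (hg : IsLocalMor g)
    (h1 : f ≫ specSpaceMap (tensorInl φ ψ) = g ≫ specSpaceMap (tensorInl φ ψ))
    (h2 : f ≫ specSpaceMap (tensorInr φ ψ) = g ≫ specSpaceMap (tensorInr φ ψ)) : f = g := by
  refine mor_spec_ext hf hg ?_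
  have h1' := congr_arg globalHom h1
  have h2' := congr_arg globalHom h2
  rw [globalHom_comp_specSpaceMap, globalHom_comp_specSpaceMap] at h1' h2'
  exact tensor_hom_ext (DFunLike.congr_fun h1') (DFunLike.congr_fun h2')

end

end FOne

namespace MonoidScheme

open FOne

lemma existsUnique_spec_map {L A : CommMonCat.{u}}
    (f : Spec.{u}.obj (op A) ⟶ Spec.{u}.obj (op L)) :
    ∃! φ : L ⟶ A, Spec.{u}.map φ.op = f := by
  obtain ⟨φ, hφ, hu⟩ := existsUnique_specSpaceMap f.isLocal
  exact ⟨φ, hom_ext hφ, fun φ' h => hu φ' (congr_arg Hom.mor h)⟩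

lemma isPullback_spec_tensor {L A B : CommMonCat.{u}} (φ : L ⟶ A) (ψ : L ⟶ B) :
    IsPullback (Spec.{u}.map (tensorInl φ ψ).op) (Spec.{u}.map (tensorInr φ ψ).op)
      (Spec.{u}.map φ.op) (Spec.{u}.map ψ.op) where
  w := by
    rw [← Functor.map_comp, ← Functor.map_comp, ← op_comp, ← op_comp, tensor_condition]
  isLimit' := ⟨by
    have h (s : PullbackCone (Spec.{u}.map φ.op) (Spec.{u}.map ψ.op)) :=
      exists_lift_spec_tensor φ ψ s.fst.isLocal s.snd.isLocal (congr_arg Hom.mor s.condition)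
    exact PullbackCone.IsLimit.mk _ (fun s => ⟨(h s).choose, (h s).choose_spec.1⟩)
      (fun s => hom_ext (h s).choose_spec.2.1) (fun s => hom_ext (h s).choose_spec.2.2)
      (fun s m h1 h2 => hom_ext (mor_spec_tensor_ext m.isLocal (h s).choose_spec.1
        ((congr_arg Hom.mor h1).trans (h s).choose_spec.2.1.symm)
        ((congr_arg Hom.mor h2).trans (h s).choose_spec.2.2.symm)))⟩

end MonoidScheme

namespace FOne

noncomputable section

/-! ### Fibre products of monoidal spaces -/

section Fibre

variable {X Y S : SheafedSpace CommMonCat.{u}} (f : X ⟶ S) (g : Y ⟶ S)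

/-- The fibre product of the underlying topological spaces. -/
def fibTop : TopCat.{u} := TopCat.of {w : X × Y // f.hom.base w.1 = g.hom.base w.2}

variable {f g} in
/-- The first coordinate. -/
def fibX (w : fibTop f g) : X := w.1.1

variable {f g} in
/-- The second coordinate. -/
def fibY (w : fibTop f g) : Y := w.1.2

variable {f g} in
lemma fib_condition (w : fibTop f g) : f.hom.base (fibX w) = g.hom.base (fibY w) := w.2

lemma continuous_fibX : Continuous (fibX : fibTop f g → X) :=
  continuous_fst.comp continuous_subtype_val

lemma continuous_fibY : Continuous (fibY : fibTop f g → Y) :=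
  continuous_snd.comp continuous_subtype_val

variable {f g} in
/-- The map on stalks from the base to the first factor. -/
def fibPhi (w : fibTop f g) :
    S.presheaf.stalk (f.hom.base (fibX w)) ⟶ X.presheaf.stalk (fibX w) :=
  f.hom.stalkMap (fibX w)

variable {f g} in
/-- The map on stalks from the base to the second factor. -/
def fibPsi (w : fibTop f g) :
    S.presheaf.stalk (f.hom.base (fibX w)) ⟶ Y.presheaf.stalk (fibY w) :=
  -- The two images in `S` are equal only by the defining condition of the point, so the stalks have
  -- to be identified along that equality.
  S.presheaf.stalkSpecializes (specializes_of_eq (fib_condition w).symm) ≫ g.hom.stalkMap (fibY w)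

variable {f g} in
/-- The tensor product of the stalks at a point of the fibre product. -/
abbrev fibStalk (w : fibTop f g) : CommMonCat.{u} := tensor (fibPhi w) (fibPsi w)

variable {f g} in
/-- The element `[a_x, b_y]` of the tensor product of the stalks. -/
def fibGerm (w : fibTop f g) {U : Opens X} {V : Opens Y} (hU : fibX w ∈ U) (hV : fibY w ∈ V)
    (a : X.presheaf.obj (op U)) (b : Y.presheaf.obj (op V)) : fibStalk w :=
  tensorMk (fibPhi w) (fibPsi w) (X.presheaf.germ U (fibX w) hU a)
    (Y.presheaf.germ V (fibY w) hV b)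

variable {f g} in
lemma fibGerm_one_right (w : fibTop f g) {U : Opens X} {V : Opens Y} (hU : fibX w ∈ U)
    (hV : fibY w ∈ V) (a : X.presheaf.obj (op U)) :
    fibGerm w hU hV a 1 = tensorInl _ _ (X.presheaf.germ U (fibX w) hU a) :=
  congr_arg (tensorMk _ _ _) (map_one _)

variable {f g} in
lemma fibGerm_one_left (w : fibTop f g) {U : Opens X} {V : Opens Y} (hU : fibX w ∈ U)
    (hV : fibY w ∈ V) (b : Y.presheaf.obj (op V)) :
    fibGerm w hU hV 1 b = tensorInr _ _ (Y.presheaf.germ V (fibY w) hV b) :=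
  congr_arg (fun t => tensorMk _ _ t _) (map_one _)

variable {f g} in
lemma fibGerm_eq (w : fibTop f g) {U : Opens X} {V : Opens Y} (hU : fibX w ∈ U)
    (hV : fibY w ∈ V) (a : X.presheaf.obj (op U)) (b : Y.presheaf.obj (op V)) :
    fibGerm w hU hV a b = tensorInl _ _ (X.presheaf.germ U (fibX w) hU a) *
      tensorInr _ _ (Y.presheaf.germ V (fibY w) hV b) :=
  tensorMk_eq _ _

variable {f g} in
lemma fibPhi_germ (w : fibTop f g) (U : Opens S) (hU : f.hom.base (fibX w) ∈ U)
    (s : S.presheaf.obj (op U)) :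
    fibPhi w (S.presheaf.germ U _ hU s) =
      X.presheaf.germ ((Opens.map f.hom.base).obj U) (fibX w) hU (f.hom.c.app (op U) s) :=
  PresheafedSpace.stalkMap_germ_apply f.hom U (fibX w) hU s

variable {f g} in
lemma fibPsi_germ (w : fibTop f g) (U : Opens S) (hU : f.hom.base (fibX w) ∈ U)
    (hU' : g.hom.base (fibY w) ∈ U) (s : S.presheaf.obj (op U)) :
    fibPsi w (S.presheaf.germ U _ hU s) =
      Y.presheaf.germ ((Opens.map g.hom.base).obj U) (fibY w) hU' (g.hom.c.app (op U) s) := by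
  refine Eq.trans ?_ (PresheafedSpace.stalkMap_germ_apply g.hom U (fibY w) hU' s)
  have e := ConcreteCategory.congr_hom (S.presheaf.germ_stalkSpecializes hU
    (specializes_of_eq (fib_condition w).symm)) s
  exact congr_arg (g.hom.stalkMap (fibY w)) e

lemma isUnit_germ_congr {x y : X} (h : x = y) {U : Opens X} (hx : x ∈ U) (hy : y ∈ U)
    {s : X.presheaf.obj (op U)} (hs : IsUnit (X.presheaf.germ U x hx s)) :
    IsUnit (X.presheaf.germ U y hy s) := by
  subst h
  exact hs

variable {f g} in
lemma isLocalHom_fibPsi (hg : IsLocalMor g) (w : fibTop f g) : IsLocalHom (fibPsi w).hom := by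
  refine ⟨fun t ht => ?_⟩
  obtain ⟨U, hU, s, rfl⟩ := S.presheaf.exists_germ_eq t
  have hU' : g.hom.base (fibY w) ∈ U := fib_condition w ▸ hU
  have e := fibPsi_germ w U hU hU' s
  refine isUnit_germ_congr (fib_condition w).symm hU' hU ?_
  exact (isLocalMor_iff g).1 hg (fibY w) U hU' s (e ▸ ht)

/-- The families of the form `w ↦ [a_x, b_y]`. -/
def fibPrelocal : TopCat.PrelocalPredicate (fun w : fibTop f g => (fibStalk w : Type u)) where
  pred {W} s := ∃ (U : Opens X) (V : Opens Y) (a : X.presheaf.obj (op U))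
    (b : Y.presheaf.obj (op V)), ∀ w : W, ∃ (hU : fibX w.1 ∈ U) (hV : fibY w.1 ∈ V),
      s w = fibGerm w.1 hU hV a b
  res := by
    rintro U V i s ⟨U', V', a, b, h⟩
    exact ⟨U', V', a, b, fun w => h (i w)⟩

/-- The sections of the structure sheaf of the fibre product. -/
def fibSections (W : Opens (fibTop f g)) : Submonoid (∀ w : W, fibStalk w.1) where
  carrier := {s | (fibPrelocal f g).sheafify.pred s}
  one_mem' w := by
    refine ⟨W, w.2, 𝟙 _, ⊤, ⊤, 1, 1, fun w => ⟨trivial, trivial, ?_⟩⟩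
    exact ((fibGerm_one_right w.1 _ _ 1).trans
      ((congr_arg (tensorInl _ _) (map_one _)).trans (map_one _))).symm
  mul_mem' {s t} hs ht w := by
    obtain ⟨W₁, hW₁, i, U₁, V₁, a₁, b₁, h₁⟩ := hs w
    obtain ⟨W₂, hW₂, j, U₂, V₂, a₂, b₂, h₂⟩ := ht w
    refine ⟨W₁ ⊓ W₂, ⟨hW₁, hW₂⟩, Opens.infLELeft _ _ ≫ i, U₁ ⊓ U₂, V₁ ⊓ V₂,
      X.presheaf.map (Opens.infLELeft _ _).op a₁ * X.presheaf.map (Opens.infLERight _ _).op a₂,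
      Y.presheaf.map (Opens.infLELeft _ _).op b₁ * Y.presheaf.map (Opens.infLERight _ _).op b₂,
      fun v => ?_⟩
    obtain ⟨hU₁, hV₁, e₁⟩ := h₁ ⟨v.1, v.2.1⟩
    obtain ⟨hU₂, hV₂, e₂⟩ := h₂ ⟨v.1, v.2.2⟩
    refine ⟨⟨hU₁, hU₂⟩, ⟨hV₁, hV₂⟩, (congr_arg₂ (· * ·) e₁ e₂).trans ?_⟩
    refine (tensorMk_mul _ _ _ _).trans (congr_arg₂ (tensorMk _ _) ?_ ?_)
    · exact germ_mul_germ hU₁ hU₂ _ a₁ a₂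
    · exact germ_mul_germ hV₁ hV₂ _ b₁ b₂

/-- The structure presheaf of the fibre product. -/
def fibPresheaf : TopCat.Presheaf CommMonCat.{u} (fibTop f g) where
  obj W := CommMonCat.of (fibSections f g W.unop)
  map {_ _} i := CommMonCat.ofHom
    { toFun := fun s => ⟨fun w => s.1 (i.unop w),
        (fibPrelocal f g).sheafify.res i.unop s.1 s.2⟩
      map_one' := rfl
      map_mul' := fun _ _ => rfl }

lemma fibPresheaf_isSheaf : (fibPresheaf f g).IsSheaf :=
  (TopCat.Presheaf.isSheaf_iff_isSheaf_comp (CategoryTheory.forget CommMonCat) _).2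
    (TopCat.Presheaf.isSheaf_of_iso
      (F := (TopCat.subsheafToTypes (fibPrelocal f g).sheafify).1)
      (NatIso.ofComponents (fun _ => Iso.refl _)) (TopCat.subsheafToTypes _).2)

/-- The fibre product of monoidal spaces. -/
def fibSpace : SheafedSpace CommMonCat.{u} where
  carrier := fibTop f g
  presheaf := fibPresheaf f g
  IsSheaf := fibPresheaf_isSheaf f g

variable {f g}

/-- The value of a section at a point. -/
def fibEval {W : Opens (fibTop f g)} (s : (fibPresheaf f g).obj (op W)) (w : W) : fibStalk w.1 :=
  s.1 w

lemma fib_sec_ext {W : Opens (fibTop f g)} {s t : (fibPresheaf f g).obj (op W)}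
    (h : ∀ w : W, fibEval s w = fibEval t w) : s = t :=
  Subtype.ext (funext h)

/-- Evaluation depends only on the germ, so the stalk maps to the push-out of the stalks; this is
what detects non-units. -/
lemma fibEval_eq_of_germ_eq {W W' : Opens (fibTop f g)} {w : fibTop f g} {h : w ∈ W} {h' : w ∈ W'}
    {s : (fibPresheaf f g).obj (op W)} {t : (fibPresheaf f g).obj (op W')}
    (e : (fibPresheaf f g).germ W w h s = (fibPresheaf f g).germ W' w h' t) :
    fibEval s ⟨w, h⟩ = fibEval t ⟨w, h'⟩ := by
  obtain ⟨V, hV, i, j, e⟩ := (fibPresheaf f g).germ_eq w h h' s t e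
  exact congr_arg (fun s => fibEval s ⟨w, hV⟩) e

lemma fib_germ_ext {W W' : Opens (fibTop f g)} {w : fibTop f g} {h : w ∈ W} {h' : w ∈ W'}
    {s : (fibPresheaf f g).obj (op W)} {t : (fibPresheaf f g).obj (op W')}
    (e : ∀ (v : fibTop f g) (hv : v ∈ W) (hv' : v ∈ W'), fibEval s ⟨v, hv⟩ = fibEval t ⟨v, hv'⟩) :
    (fibPresheaf f g).germ W w h s = (fibPresheaf f g).germ W' w h' t :=
  (fibPresheaf f g).germ_ext (W ⊓ W') ⟨h, h'⟩ (Opens.infLELeft _ _) (Opens.infLERight _ _)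
    (fib_sec_ext fun v => e v.1 v.2.1 v.2.2)

lemma isUnit_fibEval {W : Opens (fibTop f g)} {w : fibTop f g} {h : w ∈ W}
    {s : (fibPresheaf f g).obj (op W)} (hs : IsUnit ((fibPresheaf f g).germ W w h s)) :
    IsUnit (fibEval s ⟨w, h⟩) := by
  obtain ⟨y, hy⟩ := isUnit_iff_exists_inv.1 hs
  obtain ⟨V, hV, t, rfl⟩ := (fibPresheaf f g).exists_germ_eq y
  have hWV : w ∈ W ⊓ V := ⟨h, hV⟩
  have e : (fibPresheaf f g).germ (W ⊓ V) w hWV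
      ((fibPresheaf f g).map (Opens.infLELeft W V).op s *
        (fibPresheaf f g).map (Opens.infLERight W V).op t) =
      (fibPresheaf f g).germ (W ⊓ V) w hWV 1 := by
    rw [map_mul, TopCat.Presheaf.germ_res_apply, TopCat.Presheaf.germ_res_apply, hy, map_one]
  exact isUnit_iff_exists_inv.2 ⟨fibEval t ⟨w, hV⟩, fibEval_eq_of_germ_eq e⟩

/-! ### The projections of the fibre product. -/

variable (f g)

/-- The first projection. -/
def fibFst : fibSpace f g ⟶ X :=
  InducedCategory.homMk
    { base := TopCat.ofHom ⟨fibX, continuous_fibX f g⟩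
      c :=
        { app := fun U => CommMonCat.ofHom
            { toFun := fun a => ⟨fun w => tensorInl _ _ (X.presheaf.germ U.unop (fibX w.1) w.2 a),
                fun w => ⟨_, w.2, 𝟙 _, U.unop, ⊤, a, 1, fun v =>
                  ⟨v.2, trivial, (fibGerm_one_right v.1 _ _ a).symm⟩⟩⟩
              map_one' := fib_sec_ext fun w => by
                refine (congr_arg (tensorInl _ _) (map_one _)).trans (map_one _)
              map_mul' := fun a b => fib_sec_ext fun w => by
                refine (congr_arg (tensorInl _ _) (map_mul _ a b)).trans (map_mul _ _ _) }
          naturality := fun U V i => by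
            ext a
            refine fib_sec_ext fun w => congr_arg (tensorInl _ _) ?_
            exact TopCat.Presheaf.germ_res_apply X.presheaf i.unop (fibX w.1) w.2 a } }

/-- The second projection. -/
def fibSnd : fibSpace f g ⟶ Y :=
  InducedCategory.homMk
    { base := TopCat.ofHom ⟨fibY, continuous_fibY f g⟩
      c :=
        { app := fun U => CommMonCat.ofHom
            { toFun := fun a => ⟨fun w => tensorInr _ _ (Y.presheaf.germ U.unop (fibY w.1) w.2 a),
                fun w => ⟨_, w.2, 𝟙 _, ⊤, U.unop, 1, a, fun v =>
                  ⟨trivial, v.2, (fibGerm_one_left v.1 _ _ a).symm⟩⟩⟩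
              map_one' := fib_sec_ext fun w => by
                refine (congr_arg (tensorInr _ _) (map_one _)).trans (map_one _)
              map_mul' := fun a b => fib_sec_ext fun w => by
                refine (congr_arg (tensorInr _ _) (map_mul _ a b)).trans (map_mul _ _ _) }
          naturality := fun U V i => by
            ext a
            refine fib_sec_ext fun w => congr_arg (tensorInr _ _) ?_
            exact TopCat.Presheaf.germ_res_apply Y.presheaf i.unop (fibY w.1) w.2 a } }

variable {f g}

lemma fib_locally {W : Opens (fibTop f g)} (s : (fibPresheaf f g).obj (op W)) (w : W) :
    ∃ (W' : Opens (fibTop f g)) (_ : w.1 ∈ W') (i : W' ⟶ W) (U : Opens X) (V : Opens Y)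
      (a : X.presheaf.obj (op U)) (b : Y.presheaf.obj (op V)),
      ∀ v : W', ∃ (hU : fibX v.1 ∈ U) (hV : fibY v.1 ∈ V), fibEval s (i v) = fibGerm v.1 hU hV a b :=
  s.2 w

/-- Near `w` the section is `[a, b] = [a, 1] · [1, b]`, a product of pullbacks along the two
projections. So the stalk of the fibre product is generated by the images of the two stalk maps,
which gives both uniqueness and locality of induced morphisms. -/
lemma fib_germ_eq {W : Opens (fibTop f g)} (s : (fibPresheaf f g).obj (op W)) (w : fibTop f g)
    (hw : w ∈ W) :
    ∃ (U : Opens X) (V : Opens Y) (a : X.presheaf.obj (op U)) (b : Y.presheaf.obj (op V))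
      (hU : fibX w ∈ U) (hV : fibY w ∈ V), fibEval s ⟨w, hw⟩ = fibGerm w hU hV a b ∧
      (fibPresheaf f g).germ W w hw s =
        (fibFst f g).hom.stalkMap w (X.presheaf.germ U (fibX w) hU a) *
        (fibSnd f g).hom.stalkMap w (Y.presheaf.germ V (fibY w) hV b) := by
  obtain ⟨W', hW', i, U, V, a, b, h⟩ := fib_locally s ⟨w, hw⟩
  obtain ⟨hU, hV, e⟩ := h ⟨w, hW'⟩
  refine ⟨U, V, a, b, hU, hV, e, ?_⟩
  have e1 : (fibFst f g).hom.stalkMap w (X.presheaf.germ U (fibX w) hU a) =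
      (fibPresheaf f g).germ ((Opens.map (fibFst f g).hom.base).obj U) w hU
        ((fibFst f g).hom.c.app (op U) a) :=
    PresheafedSpace.stalkMap_germ_apply (fibFst f g).hom U w hU a
  have e2 : (fibSnd f g).hom.stalkMap w (Y.presheaf.germ V (fibY w) hV b) =
      (fibPresheaf f g).germ ((Opens.map (fibSnd f g).hom.base).obj V) w hV
        ((fibSnd f g).hom.c.app (op V) b) :=
    PresheafedSpace.stalkMap_germ_apply (fibSnd f g).hom V w hV b
  rw [e1, e2]
  have i1 : W' ≤ (Opens.map (fibFst f g).hom.base).obj U := fun v hv => (h ⟨v, hv⟩).choose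
  have i2 : W' ≤ (Opens.map (fibSnd f g).hom.base).obj V := fun v hv =>
    (h ⟨v, hv⟩).choose_spec.choose
  have r1 := TopCat.Presheaf.germ_res_apply (fibPresheaf f g) i w hW' s
  have r2 := TopCat.Presheaf.germ_res_apply (fibPresheaf f g) (homOfLE i1) w hW'
    ((fibFst f g).hom.c.app (op U) a)
  have r3 := TopCat.Presheaf.germ_res_apply (fibPresheaf f g) (homOfLE i2) w hW'
    ((fibSnd f g).hom.c.app (op V) b)
  refine r1.symm.trans (Eq.trans ?_ (congr_arg₂ (· * ·) r2 r3))
  refine Eq.trans (congr_arg _ (fib_sec_ext fun v => ?_)) (map_mul _ _ _)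
  obtain ⟨_, _, e'⟩ := h v
  exact e'.trans (fibGerm_eq _ _ _ _ _)

/-- On points this is the definition of the topological fibre product; on germs it is the relation
`[φ l, 1] = [1, ψ l]`. -/
lemma fib_mor_condition : fibFst f g ≫ f = fibSnd f g ≫ g := by
  refine mor_ext_germ (fun w => fib_condition w) fun U s w hw hw' => ?_
  refine fib_germ_ext (W := (Opens.map (fibFst f g ≫ f).hom.base).obj U)
    (W' := (Opens.map (fibSnd f g ≫ g).hom.base).obj U) fun v hv hv' => ?_
  refine (congr_arg (tensorInl _ _) (fibPhi_germ v U hv s)).symm.trans (Eq.trans ?_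
    (congr_arg (tensorInr _ _) (fibPsi_germ v U hv hv' s)))
  exact tensorMk_map _

variable {Z : SheafedSpace CommMonCat.{u}}

lemma germ_app_congr {k k' : Z ⟶ S} (h : k = k') (U : Opens S) (s : S.presheaf.obj (op U)) (z : Z)
    (hz : k.hom.base z ∈ U) (hz' : k'.hom.base z ∈ U) :
    Z.presheaf.germ ((Opens.map k.hom.base).obj U) z hz (k.hom.c.app (op U) s) =
      Z.presheaf.germ ((Opens.map k'.hom.base).obj U) z hz' (k'.hom.c.app (op U) s) := by
  subst h
  rfl

/-- The map on points is given by its coordinates, and by `fib_germ_eq` every germ is a product of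
germs pulled back from the factors. -/
lemma fib_mor_ext {m m' : Z ⟶ fibSpace f g} (h1 : m ≫ fibFst f g = m' ≫ fibFst f g)
    (h2 : m ≫ fibSnd f g = m' ≫ fibSnd f g) : m = m' := by
  obtain ⟨⟨b, c⟩⟩ := m
  obtain ⟨⟨b', c'⟩⟩ := m'
  obtain rfl : b = b' := ConcreteCategory.hom_ext _ _ fun z => Subtype.ext (Prod.ext
    (congr_arg (fun k => k.hom.base z) h1) (congr_arg (fun k => k.hom.base z) h2))
  refine mor_ext_germ (fun z => rfl) fun W s z hz _ => ?_
  obtain ⟨U, V, x, y, hU, hV, -, e⟩ := fib_germ_eq s (b z) hz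
  -- Stated for an arbitrary sheaf component `c` over the common base map `b`, so that it applies to
  -- both morphisms.
  have key (c) :
      Z.presheaf.germ ((Opens.map b).obj W) z hz
          ((⟨⟨b, c⟩⟩ : Z ⟶ fibSpace f g).hom.c.app (op W) s) =
        Z.presheaf.germ _ z hU (((⟨⟨b, c⟩⟩ : Z ⟶ fibSpace f g) ≫ fibFst f g).hom.c.app (op U) x) *
        Z.presheaf.germ _ z hV
          (((⟨⟨b, c⟩⟩ : Z ⟶ fibSpace f g) ≫ fibSnd f g).hom.c.app (op V) y) := by
    let m : Z ⟶ fibSpace f g := ⟨⟨b, c⟩⟩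
    refine (PresheafedSpace.stalkMap_germ_apply m.hom W z hz s).symm.trans ?_
    refine (congr_arg (m.hom.stalkMap z) e).trans ?_
    refine (map_mul (m.hom.stalkMap z).hom _ _).trans (congr_arg₂ (· * ·) ?_ ?_)
    · refine (congr_arg (m.hom.stalkMap z) (PresheafedSpace.stalkMap_germ_apply
        (fibFst f g).hom U (b z) hU x)).trans ?_
      exact PresheafedSpace.stalkMap_germ_apply m.hom _ z hU _
    · refine (congr_arg (m.hom.stalkMap z) (PresheafedSpace.stalkMap_germ_apply
        (fibSnd f g).hom V (b z) hV y)).trans ?_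
      exact PresheafedSpace.stalkMap_germ_apply m.hom _ z hV _
  refine (key c).trans (Eq.trans (congr_arg₂ (· * ·) ?_ ?_) (key c').symm)
  · exact germ_app_congr h1 U x z _ _
  · exact germ_app_congr h2 V y z _ _

/-- An invertible germ evaluates to an invertible `[a, 1]`; since both maps out of the stalk of `S`
are local, `isUnit_of_isUnit_tensorMk` makes `a` invertible. -/
lemma isLocalMor_fibFst (hf : IsLocalMor f) (hg : IsLocalMor g) : IsLocalMor (fibFst f g) := by
  rw [isLocalMor_iff]
  intro w U hU a ha
  have : IsLocalHom (fibPhi w).hom := hf (fibX w)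
  have : IsLocalHom (fibPsi w).hom := isLocalHom_fibPsi hg w
  exact (isUnit_of_isUnit_tensorMk (isUnit_fibEval ha)).1

lemma isLocalMor_fibSnd (hf : IsLocalMor f) (hg : IsLocalMor g) : IsLocalMor (fibSnd f g) := by
  rw [isLocalMor_iff]
  intro w U hU a ha
  have : IsLocalHom (fibPhi w).hom := hf (fibX w)
  have : IsLocalHom (fibPsi w).hom := isLocalHom_fibPsi hg w
  exact (isUnit_of_isUnit_tensorMk (isUnit_fibEval ha)).2

/-! ### The morphism to the fibre product induced by compatible morphisms. -/

section Lift

variable {a : Z ⟶ X} {b : Z ⟶ Y}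

lemma fibLift_base_condition (h : a ≫ f = b ≫ g) (z : Z) :
    f.hom.base (a.hom.base z) = g.hom.base (b.hom.base z) :=
  congr_arg (fun k : Z ⟶ S => k.hom.base z) h

variable (h : a ≫ f = b ≫ g)

lemma continuous_fibLift : Continuous fun z : Z =>
    (⟨(a.hom.base z, b.hom.base z), fibLift_base_condition h z⟩ : fibTop f g) :=
  Continuous.subtype_mk (a.hom.base.hom.continuous.prodMk b.hom.base.hom.continuous) _

/-- The map on points induced by compatible morphisms. -/
def fibLiftBase : Z.carrier ⟶ fibTop f g :=
  TopCat.ofHom ⟨_, continuous_fibLift h⟩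

lemma fibLiftStalk_condition (z : Z) (l : S.presheaf.stalk (f.hom.base (fibX (fibLiftBase h z)))) :
    a.hom.stalkMap z (fibPhi (fibLiftBase h z) l) =
      b.hom.stalkMap z (fibPsi (fibLiftBase h z) l) := by
  obtain ⟨U, hU, s, rfl⟩ := S.presheaf.exists_germ_eq l
  have hU' : g.hom.base (b.hom.base z) ∈ U := fib_condition (fibLiftBase h z) ▸ hU
  refine ((congr_arg (a.hom.stalkMap z) (fibPhi_germ (fibLiftBase h z) U hU s)).trans
    (PresheafedSpace.stalkMap_germ_apply a.hom _ z hU _)).trans (Eq.trans ?_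
    ((congr_arg (b.hom.stalkMap z) (fibPsi_germ (fibLiftBase h z) U hU hU' s)).trans
    (PresheafedSpace.stalkMap_germ_apply b.hom _ z hU' _)).symm)
  exact germ_app_congr h U s z hU hU'

/-- The map on stalks induced by compatible morphisms. -/
def fibLiftStalk (z : Z) : fibStalk (fibLiftBase h z) →* Z.presheaf.stalk z :=
  tensorDesc (a.hom.stalkMap z).hom (b.hom.stalkMap z).hom (fibLiftStalk_condition h z)

lemma fibLiftStalk_fibGerm (z : Z) {U : Opens X} {V : Opens Y} (hU hV)
    (x : X.presheaf.obj (op U)) (y : Y.presheaf.obj (op V)) :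
    fibLiftStalk h z (fibGerm _ hU hV x y) =
      Z.presheaf.germ ((Opens.map a.hom.base).obj U) z hU (a.hom.c.app (op U) x) *
      Z.presheaf.germ ((Opens.map b.hom.base).obj V) z hV (b.hom.c.app (op V) y) :=
  congr_arg₂ (· * ·) (PresheafedSpace.stalkMap_germ_apply a.hom U z hU x)
    (PresheafedSpace.stalkMap_germ_apply b.hom V z hV y)

/-- The action on germs of the morphism induced by compatible morphisms. -/
def fibLiftGerm (W : Opens (fibTop f g)) (z : Z) (hz : fibLiftBase h z ∈ W) :
    (fibPresheaf f g).obj (op W) →* Z.presheaf.stalk z where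
  toFun s := fibLiftStalk h z (fibEval s ⟨_, hz⟩)
  map_one' := map_one (fibLiftStalk h z)
  map_mul' _ _ := map_mul (fibLiftStalk h z) _ _

/-- Where `s` has the form `[x, y]`, the product of the pullbacks of `x` along `a` and of `y` along
`b` is the section required. -/
lemma fibLiftGerm_locally (W : Opens (fibTop f g)) (s : (fibPresheaf f g).obj (op W)) (z : Z)
    (hz : fibLiftBase h z ∈ W) :
    ∃ (V : Opens Z) (_ : z ∈ V) (t : Z.presheaf.obj (op V)),
      ∀ (w : Z) (hw : w ∈ V) (hwW : fibLiftBase h w ∈ W),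
        Z.presheaf.germ V w hw t = fibLiftGerm h W w hwW s := by
  obtain ⟨W', hW', i, U, V, x, y, e⟩ := fib_locally s ⟨_, hz⟩
  have i1 : (Opens.map (fibLiftBase h)).obj W' ≤ (Opens.map a.hom.base).obj U := fun v hv =>
    (e ⟨_, hv⟩).choose
  have i2 : (Opens.map (fibLiftBase h)).obj W' ≤ (Opens.map b.hom.base).obj V := fun v hv =>
    (e ⟨_, hv⟩).choose_spec.choose
  refine ⟨(Opens.map (fibLiftBase h)).obj W', hW',
    Z.presheaf.map (homOfLE i1).op (a.hom.c.app (op U) x) *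
      Z.presheaf.map (homOfLE i2).op (b.hom.c.app (op V) y), fun w hw hwW => ?_⟩
  obtain ⟨hU, hV, e'⟩ := e ⟨_, hw⟩
  refine Eq.trans ?_ (congr_arg (fibLiftStalk h w) e').symm
  rw [map_mul]
  refine Eq.trans ?_ (fibLiftStalk_fibGerm h w hU hV x y).symm
  exact congr_arg₂ (· * ·) (TopCat.Presheaf.germ_res_apply _ _ _ _ _)
    (TopCat.Presheaf.germ_res_apply _ _ _ _ _)

/-- The morphism to the fibre product induced by compatible morphisms. -/
def fibLift : Z ⟶ fibSpace f g :=
  homOfGerms (Y := fibSpace f g) (fibLiftBase h) (fibLiftGerm h) (fun _ _ _ _ _ _ => rfl)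
    (fibLiftGerm_locally h)

lemma germ_fibLift (W : Opens (fibTop f g)) (s : (fibPresheaf f g).obj (op W)) (z : Z)
    (hz : fibLiftBase h z ∈ W) :
    Z.presheaf.germ ((Opens.map (fibLiftBase h)).obj W) z hz
        ((fibLift h).hom.c.app (op W) s) =
      fibLiftStalk h z (fibEval s ⟨_, hz⟩) :=
  germ_homOfGerms (Y := fibSpace f g) (fibLiftBase h) (fibLiftGerm h) (fun _ _ _ _ _ _ => rfl)
    (fibLiftGerm_locally h) W s z hz

lemma fibLift_fst : fibLift h ≫ fibFst f g = a := by
  refine mor_ext_germ (fun z => rfl) fun U s z hz _ => ?_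
  refine (germ_fibLift h _ ((fibFst f g).hom.c.app (op U) s) z hz).trans ?_
  refine (tensorDesc_inl _ _ _ _).trans ?_
  exact PresheafedSpace.stalkMap_germ_apply a.hom U z hz s

lemma fibLift_snd : fibLift h ≫ fibSnd f g = b := by
  refine mor_ext_germ (fun z => rfl) fun U s z hz _ => ?_
  refine (germ_fibLift h _ ((fibSnd f g).hom.c.app (op U) s) z hz).trans ?_
  refine (tensorDesc_inr _ _ _ _).trans ?_
  exact PresheafedSpace.stalkMap_germ_apply b.hom U z hz s

/-- By `fib_germ_eq` the germ is a product of pullbacks of germs `x` and `y`, and its image is the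
product of their pullbacks to `Z`. A product in a commutative monoid is a unit only if both factors
are, so locality of `a` and `b` applies to each factor. -/
lemma isLocalMor_fibLift (ha : IsLocalMor a) (hb : IsLocalMor b) : IsLocalMor (fibLift h) := by
  rw [isLocalMor_iff]
  intro z W hz s hs
  obtain ⟨U, V, x, y, hU, hV, e, e'⟩ := fib_germ_eq s (fibLiftBase h z) hz
  refine (congr_arg IsUnit e').mpr ?_
  have h1 := (germ_fibLift h W s z hz).trans
    ((congr_arg (fibLiftStalk h z) e).trans (fibLiftStalk_fibGerm h z hU hV x y))
  have h2 := IsUnit.mul_iff.1 ((congr_arg IsUnit h1).mp hs)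
  refine IsUnit.mul ?_ ?_
  · exact ((isLocalMor_iff a).1 ha z U hU x h2.1).map ((fibFst f g).hom.stalkMap _).hom
  · exact ((isLocalMor_iff b).1 hb z V hV y h2.2).map ((fibSnd f g).hom.stalkMap _).hom

end Lift

end Fibre

end

end FOne

namespace FOne

/-! ### Affine charts of fibre products -/

section Charts

variable {X Y S : SheafedSpace CommMonCat.{u}}

lemma range_base_comp_subset (f : X ⟶ Y) (g : Y ⟶ S) :
    Set.range (f ≫ g).hom.base ⊆ Set.range g.hom.base := by
  rintro _ ⟨x, rfl⟩
  exact ⟨f.hom.base x, rfl⟩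

/-- Affine charts of the fibre product. -/
lemma exists_fib_chart {f : X ⟶ S} {g : Y ⟶ S} (hf : IsLocalMor f) (hg : IsLocalMor g)
    {L A B : CommMonCat.{u}} {φ : L ⟶ A} {ψ : L ⟶ B}
    (i : specSpace A ⟶ X) (j : specSpace B ⟶ Y) (l : specSpace L ⟶ S)
    (oi : SheafedSpace.IsOpenImmersion i) (oj : SheafedSpace.IsOpenImmersion j)
    (ol : SheafedSpace.IsOpenImmersion l)
    (hi : specSpaceMap φ ≫ l = i ≫ f) (hj : specSpaceMap ψ ≫ l = j ≫ g) :
    ∃ k : specSpace (tensor φ ψ) ⟶ fibSpace f g, SheafedSpace.IsOpenImmersion k ∧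
      k ≫ fibFst f g = specSpaceMap (tensorInl φ ψ) ≫ i ∧
      k ≫ fibSnd f g = specSpaceMap (tensorInr φ ψ) ≫ j ∧
      Set.range k.hom.base =
        {w : fibTop f g | fibX w ∈ Set.range i.hom.base ∧ fibY w ∈ Set.range j.hom.base} := by
  have li := isLocalMor_of_isOpenImmersion i
  have lj := isLocalMor_of_isOpenImmersion j
  have lp := isLocalMor_fibFst hf hg
  have lq := isLocalMor_fibSnd hf hg
  have hk : (specSpaceMap (tensorInl φ ψ) ≫ i) ≫ f = (specSpaceMap (tensorInr φ ψ) ≫ j) ≫ g := by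
    rw [Category.assoc, Category.assoc, ← hi, ← hj, ← Category.assoc, ← Category.assoc,
      ← specSpaceMap_comp, ← specSpaceMap_comp, tensor_condition]
  let k := fibLift hk
  have lk : IsLocalMor k := isLocalMor_fibLift hk ((specSpaceMap_isLocal _).comp li)
    ((specSpaceMap_isLocal _).comp lj)
  have k1 : k ≫ fibFst f g = specSpaceMap (tensorInl φ ψ) ≫ i := fibLift_fst hk
  have k2 : k ≫ fibSnd f g = specSpaceMap (tensorInr φ ψ) ≫ j := fibLift_snd hk
  -- The expected image, regarded as an open subspace. It maps to both charts, and the universal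
  -- property of `Spec (A ⊗_L B)` will give the inverse `m` of the corestriction `k'` of `k`.
  let N : Opens (fibSpace f g) :=
    ⟨{w : fibTop f g | fibX w ∈ Set.range i.hom.base ∧ fibY w ∈ Set.range j.hom.base},
      ((oi.base_open.isOpen_range.preimage
        (continuous_fibX f g)).inter
      (oj.base_open.isOpen_range.preimage (continuous_fibY f g)) :)⟩
  let n : (fibSpace f g).restrict N.isOpenEmbedding ⟶ fibSpace f g :=
    (fibSpace f g).ofRestrict N.isOpenEmbedding
  have ln := isLocalMor_of_isOpenImmersion n
  have hn : Set.range n.hom.base = N := Subtype.range_coe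
  have n1 : Set.range (n ≫ fibFst f g).hom.base ⊆ Set.range i.hom.base := by
    rintro _ ⟨w, rfl⟩
    exact w.2.1
  have n2 : Set.range (n ≫ fibSnd f g).hom.base ⊆ Set.range j.hom.base := by
    rintro _ ⟨w, rfl⟩
    exact w.2.2
  have hkN : Set.range k.hom.base ⊆ N := by
    rintro _ ⟨t, rfl⟩
    have e1 := congr_arg (fun m : specSpace (tensor φ ψ) ⟶ X => m.hom.base t) k1.symm
    have e2 := congr_arg (fun m : specSpace (tensor φ ψ) ⟶ Y => m.hom.base t) k2.symm
    exact ⟨⟨_, e1⟩, ⟨_, e2⟩⟩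
  obtain ⟨a, la, ha⟩ := exists_lift_of_isOpenImmersion i _ (ln.comp lp) n1
  obtain ⟨b, lb, hb⟩ := exists_lift_of_isOpenImmersion j _ (ln.comp lq) n2
  obtain ⟨k', lk', hk'⟩ := exists_lift_of_isOpenImmersion n k lk (hkN.trans hn.ge)
  -- Compatibility over `Spec L` may be checked in `S`, because the open immersion `l` is a
  -- monomorphism.
  have hab : a ≫ specSpaceMap φ = b ≫ specSpaceMap ψ := by
    rw [← cancel_mono l, Category.assoc, Category.assoc, hi, hj, ← Category.assoc,
      ← Category.assoc, ha, hb, Category.assoc, Category.assoc, fib_mor_condition]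
  obtain ⟨m, lm, m1, m2⟩ := exists_lift_spec_tensor φ ψ la lb hab
  have hmk : m ≫ k = n := by
    refine fib_mor_ext ?_ ?_
    · rw [Category.assoc, k1, ← Category.assoc, m1, ha]
    · rw [Category.assoc, k2, ← Category.assoc, m2, hb]
  have hmk' : m ≫ k' = 𝟙 _ := by
    rw [← cancel_mono n, Category.assoc, hk', hmk, Category.id_comp]
  have hkm : k' ≫ m = 𝟙 _ := by
    have e : (k' ≫ m) ≫ k = k := by rw [Category.assoc, hmk, hk']
    refine mor_spec_tensor_ext (lk'.comp lm) (IsLocalMor.id _) ?_ ?_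
    · rw [← cancel_mono i, Category.assoc _ _ i, ← k1, ← Category.assoc, e, k1, Category.id_comp]
    · rw [← cancel_mono j, Category.assoc _ _ j, ← k2, ← Category.assoc, e, k2, Category.id_comp]
  have : IsIso k' := ⟨m, hkm, hmk'⟩
  refine ⟨k, ?_, k1, k2, Set.Subset.antisymm hkN ?_⟩
  · rw [← hk']
    infer_instance
  · have := range_base_comp_subset m k
    rw [hmk, hn] at this
    exact this

end Charts

end FOne

namespace MonoidScheme

open FOne

/-! ### Compatible affine charts of `𝔽₁`-schemes. -/

variable {X Y S : MonoidScheme.{u}}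

lemma exists_chart (x : X.toSheafedSpace) (W : Opens X.toSheafedSpace) (hx : x ∈ W) :
    ∃ (A : CommMonCat.{u}) (i : specObj A ⟶ X), SheafedSpace.IsOpenImmersion i.mor ∧
      x ∈ Set.range i.mor.hom.base ∧ Set.range i.mor.hom.base ⊆ W := by
  obtain ⟨U, hxU, hUW, hU⟩ := exists_isAffineOpen_le hx
  obtain ⟨A, i, hi, hr⟩ := hU.exists_isOpenImmersion
  exact ⟨A, ⟨i, isLocalMor_of_isOpenImmersion i⟩, hi, hr ▸ hxU, hr.le.trans hUW⟩

/-- A morphism can locally be described by homomorphisms of monoids. -/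
lemma exists_spec_lift {L A : CommMonCat.{u}} (f : X ⟶ S) (i : specObj A ⟶ X) (l : specObj L ⟶ S)
    [SheafedSpace.IsOpenImmersion l.mor]
    (h : Set.range (i ≫ f).mor.hom.base ⊆ Set.range l.mor.hom.base) :
    ∃ φ : L ⟶ A, Spec.{u}.map φ.op ≫ l = i ≫ f := by
  obtain ⟨m, lm, hm⟩ := exists_lift_of_isOpenImmersion l.mor _ (i ≫ f).isLocal h
  obtain ⟨φ, hφ, -⟩ := existsUnique_specSpaceMap lm
  exact ⟨φ, hom_ext (by rw [← hm, ← hφ]; rfl)⟩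

/-- Every pair of points with topologically indistinguishable images in the base lies in a pair of compatible charts. -/
lemma exists_charts (f : X ⟶ S) (g : Y ⟶ S) (x : X.toSheafedSpace) (y : Y.toSheafedSpace)
    (h : ∀ W : Opens S.toSheafedSpace, f.mor.hom.base x ∈ W → g.mor.hom.base y ∈ W) :
    ∃ (L A B : CommMonCat.{u}) (φ : L ⟶ A) (ψ : L ⟶ B)
      (i : specObj A ⟶ X) (j : specObj B ⟶ Y) (l : specObj L ⟶ S),
      SheafedSpace.IsOpenImmersion i.mor ∧ SheafedSpace.IsOpenImmersion j.mor ∧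
      SheafedSpace.IsOpenImmersion l.mor ∧
      Spec.{u}.map φ.op ≫ l = i ≫ f ∧ Spec.{u}.map ψ.op ≫ l = j ≫ g ∧
      x ∈ Set.range i.mor.hom.base ∧ y ∈ Set.range j.mor.hom.base := by
  -- A chart around the image of `x` also contains the image of `y` by hypothesis; the charts at `x`
  -- and `y` are then chosen inside the preimages of its range.
  obtain ⟨L, l, hl, hs, -⟩ := exists_chart (X := S) (f.mor.hom.base x) ⊤ trivial
  let W : Opens S.toSheafedSpace := ⟨Set.range l.mor.hom.base, hl.base_open.isOpen_range⟩
  have key {X : MonoidScheme.{u}} (f : X ⟶ S) (x : X.toSheafedSpace)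
      (hx : f.mor.hom.base x ∈ W) : ∃ (A : CommMonCat.{u}) (φ : L ⟶ A) (i : specObj A ⟶ X),
        SheafedSpace.IsOpenImmersion i.mor ∧ Spec.{u}.map φ.op ≫ l = i ≫ f ∧
        x ∈ Set.range i.mor.hom.base := by
    obtain ⟨A, i, hi, hxi, hiW⟩ := exists_chart (X := X) x ((Opens.map f.mor.hom.base).obj W) hx
    obtain ⟨φ, hφ⟩ := exists_spec_lift f i l (by
      rintro _ ⟨t, rfl⟩
      exact hiW ⟨t, rfl⟩)
    exact ⟨A, φ, i, hi, hφ, hxi⟩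
  obtain ⟨A, φ, i, hi, hφ, hxi⟩ := key f x hs
  obtain ⟨B, ψ, j, hj, hψ, hyj⟩ := key g y (h W hs)
  exact ⟨L, A, B, φ, ψ, i, j, l, hi, hj, hl, hφ, hψ, hxi, hyj⟩

/-! ### The fibre product of `𝔽₁`-schemes. -/

section FibreProduct

variable (f : X ⟶ S) (g : Y ⟶ S)

/-- The fibre product of schemes over `𝔽₁`. -/
noncomputable def fibreProduct : MonoidScheme.{u} where
  toSheafedSpace := fibSpace f.mor g.mor
  local_affine w := by
    obtain ⟨L, A, B, φ, ψ, i, j, l, hi, hj, hl, hφ, hψ, hx, hy⟩ :=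
      exists_charts f g (fibX w) (fibY w) (fun _ h => fib_condition w ▸ h)
    obtain ⟨k, hk, -, -, hr⟩ := exists_fib_chart f.isLocal g.isLocal i.mor j.mor l.mor hi hj hl
      (congr_arg Hom.mor hφ) (congr_arg Hom.mor hψ)
    refine ⟨⟨_, hk.base_open.isOpen_range⟩, ?_, isAffineOpen_of_isOpenImmersion k _ rfl⟩
    exact hr.ge ⟨hx, hy⟩

/-- The first projection of the fibre product. -/
noncomputable def fibreFst : fibreProduct f g ⟶ X :=
  ⟨fibFst f.mor g.mor, isLocalMor_fibFst f.isLocal g.isLocal⟩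

/-- The second projection of the fibre product. -/
noncomputable def fibreSnd : fibreProduct f g ⟶ Y :=
  ⟨fibSnd f.mor g.mor, isLocalMor_fibSnd f.isLocal g.isLocal⟩

/-- The universal property is already known for monoidal spaces; for schemes it remains only that
the induced morphism is local. -/
lemma isPullback_fibreProduct : IsPullback (fibreFst f g) (fibreSnd f g) f g where
  w := hom_ext fib_mor_condition
  isLimit' := ⟨PullbackCone.IsLimit.mk _
    (fun s => ⟨fibLift (congr_arg Hom.mor s.condition),
      isLocalMor_fibLift _ s.fst.isLocal s.snd.isLocal⟩)
    (fun s => hom_ext (fibLift_fst (congr_arg Hom.mor s.condition)))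
    (fun s => hom_ext (fibLift_snd (congr_arg Hom.mor s.condition)))
    (fun s _ h1 h2 => hom_ext (fib_mor_ext
      ((congr_arg Hom.mor h1).trans (fibLift_fst (congr_arg Hom.mor s.condition)).symm)
      ((congr_arg Hom.mor h2).trans (fibLift_snd (congr_arg Hom.mor s.condition)).symm)))⟩

lemma existsUnique_iso_of_isPullback {f : X ⟶ S} {g : Y ⟶ S} {P P' : MonoidScheme.{u}}
    {p : P ⟶ X} {q : P ⟶ Y} {p' : P' ⟶ X} {q' : P' ⟶ Y} (h : IsPullback p q f g)
    (h' : IsPullback p' q' f g) : ∃! e : P' ≅ P, e.hom ≫ p = p' ∧ e.hom ≫ q = q' :=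
  ⟨h'.isoIsPullback _ _ h, ⟨h'.isoIsPullback_hom_fst _ _ h, h'.isoIsPullback_hom_snd _ _ h⟩,
    fun _ he => Iso.ext (h.hom_ext (he.1.trans (h'.isoIsPullback_hom_fst _ _ h).symm)
      (he.2.trans (h'.isoIsPullback_hom_snd _ _ h).symm))⟩

/-- Affine charts of the fibre product. -/
lemma exists_fibreProduct_chart {L A B : CommMonCat.{u}} {φ : L ⟶ A} {ψ : L ⟶ B}
    {f : X ⟶ S} {g : Y ⟶ S} {i : specObj A ⟶ X} {j : specObj B ⟶ Y} {l : specObj L ⟶ S}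
    (hi : SheafedSpace.IsOpenImmersion i.mor) (hj : SheafedSpace.IsOpenImmersion j.mor)
    (hl : SheafedSpace.IsOpenImmersion l.mor)
    (hφ : Spec.{u}.map φ.op ≫ l = i ≫ f) (hψ : Spec.{u}.map ψ.op ≫ l = j ≫ g) :
    ∃ k : specObj (tensor φ ψ) ⟶ fibreProduct f g, SheafedSpace.IsOpenImmersion k.mor ∧
      k ≫ fibreFst f g = Spec.{u}.map (tensorInl φ ψ).op ≫ i ∧
      k ≫ fibreSnd f g = Spec.{u}.map (tensorInr φ ψ).op ≫ j ∧
      Set.range k.mor.hom.base = {w | (fibreFst f g).mor.hom.base w ∈ Set.range i.mor.hom.base ∧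
        (fibreSnd f g).mor.hom.base w ∈ Set.range j.mor.hom.base} := by
  obtain ⟨k, hk, k1, k2, hr⟩ := exists_fib_chart f.isLocal g.isLocal i.mor j.mor l.mor hi hj hl
    (congr_arg Hom.mor hφ) (congr_arg Hom.mor hψ)
  exact ⟨⟨k, isLocalMor_of_isOpenImmersion k⟩, hk, hom_ext k1, hom_ext k2, hr⟩

end FibreProduct

end MonoidScheme

namespace FOne

/-! ### Base extension of push-outs of monoids -/

section ZTensor

variable {L A B : CommMonCat.{u}}

/-- The ring homomorphism `ℤ[A] → R` induced by a homomorphism of monoids `A → R`. -/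
noncomputable def zLift {R : CommRingCat.{u}} (α : A →* R) : zExt.obj A ⟶ R :=
  CommRingCat.ofHom (MonoidAlgebra.lift ℤ R A α).toRingHom

/-- The inclusion `A → ℤ[A]`. -/
noncomputable def zOf (A : CommMonCat.{u}) : A →* (zExt.obj A : Type u) := MonoidAlgebra.of ℤ A

lemma zLift_zOf {R : CommRingCat.{u}} (α : A →* R) (a : A) : zLift α (zOf A a) = α a :=
  MonoidAlgebra.lift_of α a

lemma zExt_map_zOf (φ : L ⟶ A) (l : L) : zExt.map φ (zOf L l) = zOf A (φ l) :=
  mapDomainRingHom_of φ.hom l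

lemma zExt_hom_ext {R : CommRingCat.{u}} {f g : zExt.obj A ⟶ R}
    (h : ∀ a, f (zOf A a) = g (zOf A a)) : f = g := by
  ext1
  refine MonoidAlgebra.ringHom_ext (fun n => ?_) h
  exact RingHom.congr_fun (RingHom.ext_int (f.hom.comp MonoidAlgebra.singleOneRingHom)
    (g.hom.comp MonoidAlgebra.singleOneRingHom)) n

/-- `A ↦ ℤ[A]` is left adjoint to taking the multiplicative monoid of a ring, hence preserves
push-outs. The argument is this adjunction spelled out: ring maps out of `ℤ[A ⊗_L B]` are monoid
maps out of `A ⊗_L B`. -/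
lemma isPushout_zExt_tensor (φ : L ⟶ A) (ψ : L ⟶ B) :
    IsPushout (zExt.map φ) (zExt.map ψ) (zExt.map (tensorInl φ ψ)) (zExt.map (tensorInr φ ψ)) where
  w := by rw [← Functor.map_comp, ← Functor.map_comp, tensor_condition]
  isColimit' := by
    have h (s : PushoutCocone (zExt.map φ) (zExt.map ψ)) (l : L) :
        s.inl (zOf A (φ l)) = s.inr (zOf B (ψ l)) := by
      rw [← zExt_map_zOf, ← zExt_map_zOf]
      exact ConcreteCategory.congr_hom s.condition (zOf L l)
    let α (s : PushoutCocone (zExt.map φ) (zExt.map ψ)) : A →* s.pt :=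
      (s.inl.hom : _ →* s.pt).comp (zOf A)
    let β (s : PushoutCocone (zExt.map φ) (zExt.map ψ)) : B →* s.pt :=
      (s.inr.hom : _ →* s.pt).comp (zOf B)
    have h1 (s) (a : A) : tensorDesc (α s) (β s) (h s) (tensorInl φ ψ a) = s.inl (zOf A a) :=
      tensorDesc_inl (α s) (β s) (h s) a
    have h2 (s) (b : B) : tensorDesc (α s) (β s) (h s) (tensorInr φ ψ b) = s.inr (zOf B b) :=
      tensorDesc_inr (α s) (β s) (h s) b
    refine ⟨PushoutCocone.IsColimit.mk _ (fun s => zLift (tensorDesc (α s) (β s) (h s)))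
      (fun s => zExt_hom_ext fun a => ?_) (fun s => zExt_hom_ext fun b => ?_)
      (fun s m e1 e2 => zExt_hom_ext fun t => ?_)⟩
    · refine (congr_arg (zLift _) (zExt_map_zOf (tensorInl φ ψ) a)).trans ?_
      exact (zLift_zOf _ _).trans (h1 s a)
    · refine (congr_arg (zLift _) (zExt_map_zOf (tensorInr φ ψ) b)).trans ?_
      exact (zLift_zOf _ _).trans (h2 s b)
    · refine Eq.trans ?_ (zLift_zOf _ _).symm
      refine DFunLike.congr_fun (tensor_hom_ext
        (f := (m.hom : _ →* s.pt).comp (zOf (tensor φ ψ))) (fun a => ?_) (fun b => ?_)) t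
      · refine Eq.trans ?_ (h1 s a).symm
        refine Eq.trans ?_ (ConcreteCategory.congr_hom e1 (zOf A a))
        exact congr_arg m (zExt_map_zOf (tensorInl φ ψ) a).symm
      · refine Eq.trans ?_ (h2 s b).symm
        refine Eq.trans ?_ (ConcreteCategory.congr_hom e2 (zOf B b))
        exact congr_arg m (zExt_map_zOf (tensorInr φ ψ) b).symm

lemma mem_primeBelow_map {φ : A ⟶ B} {y : AlgebraicGeometry.Spec (zExt.obj B)} {a : A} :
    a ∈ (primeBelow (AlgebraicGeometry.Spec.map (zExt.map φ) y)).ideal ↔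
      φ a ∈ (primeBelow y).ideal := by
  rw [mem_primeBelow, mem_primeBelow, ← mapDomainRingHom_of φ.hom a]
  rfl

end ZTensor

end FOne

namespace MonoidScheme

open FOne

noncomputable section

/-! ### The points of the base extension -/

section Points

variable {X Y : MonoidScheme.{u}}

/-- The point `y` of `Spec ℤ[𝒪_X(U)]` lies over the point `x` of `U`. -/
def LiesOver (U : X.AffOpens)
    (y : AlgebraicGeometry.Spec (zExt.obj (X.presheaf.obj (op U.1)))) (x : X.toSheafedSpace) :
    Prop :=
  ∃ hx : x ∈ U.1, ∀ a, IsUnit (X.presheaf.germ U.1 x hx a) ↔ a ∉ (primeBelow y).ideal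

lemma exists_liesOver (U : X.AffOpens)
    (y : AlgebraicGeometry.Spec (zExt.obj (X.presheaf.obj (op U.1)))) :
    ∃ x, LiesOver U y x :=
  U.2.affineLike.exists_point (primeBelow y)

/-- Points below the same `y` have the same invertible sections of `U`, and the invertibility loci
of sections form a basis of `U`. Such points are therefore topologically indistinguishable, which is
all the uniqueness that is needed. -/
lemma LiesOver.mem_of_mem {U : X.AffOpens}
    {y : AlgebraicGeometry.Spec (zExt.obj (X.presheaf.obj (op U.1)))} {x x' : X.toSheafedSpace}
    (h : LiesOver U y x) (h' : LiesOver U y x') (W : Opens X.toSheafedSpace) (hW : x ∈ W) :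
    x' ∈ W := by
  obtain ⟨hx, e⟩ := h
  obtain ⟨hx', e'⟩ := h'
  obtain ⟨a, ha, haW⟩ := U.2.affineLike.basis x hx W hW
  exact haW x' hx' ((e' a).2 ((e a).1 ha))

lemma LiesOver.map {U V : X.AffOpens} (i : U ⟶ V)
    {y : AlgebraicGeometry.Spec (zExt.obj (X.presheaf.obj (op U.1)))} {x : X.toSheafedSpace}
    (h : LiesOver U y x) : LiesOver V (X.zDiagram.map i y) x := by
  obtain ⟨hx, e⟩ := h
  refine ⟨i.le hx, fun a => ?_⟩
  refine Iff.trans ?_ (not_congr (mem_primeBelow_map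
    (φ := X.presheaf.map (homOfLE i.le : U.1 ⟶ V.1).op))).symm
  rw [← e]
  have := TopCat.Presheaf.germ_res_apply X.presheaf (homOfLE i.le : U.1 ⟶ V.1) x hx a
  rw [this]

/-- The point `t` of `X ⊗ ℤ` lies over the point `x` of `X`. -/
def Over (t : X.zObj) (x : X.toSheafedSpace) : Prop :=
  ∃ U y, X.zChart U y = t ∧ LiesOver U y x

lemma exists_over (t : X.zObj) : ∃ x, Over t x := by
  obtain ⟨U, y, e⟩ := Scheme.IsLocallyDirected.ι_jointly_surjective X.zDiagram t
  obtain ⟨x, hx⟩ := exists_liesOver U y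
  exact ⟨x, U, y, e, hx⟩

/-- Two representatives of `t` in different charts come from a common point over a smaller affine
open set. A point below that one is indistinguishable from both `x` and `x'`. -/
lemma Over.mem_of_mem {t : X.zObj} {x x' : X.toSheafedSpace} (h : Over t x) (h' : Over t x')
    (W : Opens X.toSheafedSpace) (hW : x ∈ W) : x' ∈ W := by
  obtain ⟨U, y, e, hx⟩ := h
  obtain ⟨U', y', e', hx'⟩ := h'
  obtain ⟨T, i, j, z, hz, hz'⟩ := (Scheme.IsLocallyDirected.ι_eq_ι_iff X.zDiagram).1
    (e.trans e'.symm)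
  obtain ⟨x'', hx''⟩ := exists_liesOver T z
  exact (hz' ▸ hx''.map j).mem_of_mem hx' W (hx.mem_of_mem (hz ▸ hx''.map i) W hW)

instance (U : X.AffOpens) : IsOpenImmersion (X.zChart U) :=
  inferInstanceAs (IsOpenImmersion (colimit.ι X.zDiagram U))

lemma zChart_map_apply {U V : X.AffOpens} (h : U.1 ≤ V.1)
    (y : AlgebraicGeometry.Spec (zExt.obj (X.presheaf.obj (op U.1)))) :
    X.zChart V (AlgebraicGeometry.Spec.map (zExt.map (X.presheaf.map (homOfLE h).op)) y) =
      X.zChart U y := by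
  rw [← Scheme.Hom.comp_apply, zDiagram_map_zChart]

/-- The chart of `U` is the full inverse image of `U` in `X ⊗ ℤ`. One direction is the
indistinguishability of the points below `t`; for the other, `t` is moved from its chart `V` to an
affine neighbourhood of `x` in `U ⊓ V`. -/
lemma Over.mem_range_zChart_iff {t : X.zObj} {x : X.toSheafedSpace} (h : Over t x)
    (U : X.AffOpens) : t ∈ Set.range (X.zChart U) ↔ x ∈ U.1 := by
  constructor
  · rintro ⟨y, hy⟩
    obtain ⟨x', hx'⟩ := exists_liesOver U y
    exact Over.mem_of_mem ⟨U, y, hy, hx'⟩ h U.1 hx'.choose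
  · intro hxU
    obtain ⟨V, y, rfl, hx, e⟩ := h
    obtain ⟨T, hxT, hT, hTa⟩ := exists_isAffineOpen_le (X := X) (W := U.1 ⊓ V.1) ⟨hxU, hx⟩
    let T' : X.AffOpens := ⟨T, hTa⟩
    let i : T' ⟶ V := homOfLE (hT.trans inf_le_right)
    obtain ⟨f, hf, hfT⟩ := zDiagram_isLocAway i
    -- The sections of `T` are those of `V` localized at `f`, and `f` is invertible at `x`. Hence
    -- `f` lies outside the prime below `y`, so `y` comes from the chart of `T`.
    obtain ⟨z, hz⟩ := (hf.mem_range_zExt y).2 ((e f).1 ((hfT x hx).2 hxT))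
    refine ⟨_, (zChart_map_apply (U := T') (V := U) (hT.trans inf_le_left) z).trans ?_⟩
    refine (zChart_map_apply (U := T') (V := V) (hT.trans inf_le_right) z).symm.trans ?_
    exact congr_arg _ hz

/-- Locality of `f` is what makes this work: a section is invertible at `f(x)` exactly when its
pullback is invertible at `x`, that is, when the pullback lies outside the prime below the
representative of `t`. -/
lemma over_zMap {t : X.zObj} {x : X.toSheafedSpace} (h : Over t x) (f : X ⟶ Y) :
    Over (zMap f t) (f.mor.hom.base x) := by
  obtain ⟨U, y, rfl, hx, e⟩ := h
  obtain ⟨V, hV⟩ := exists_affOpens_le f U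
  refine ⟨V, AlgebraicGeometry.Spec.map (zExt.map (appLE f U V hV)) y, ?_, hV hx, fun a => ?_⟩
  · rw [← Scheme.Hom.comp_apply, ← Scheme.Hom.comp_apply, zChart_zMap f U V hV]
  · rw [mem_primeBelow_map, ← e]
    have h1 : X.presheaf.germ U.1 x hx (appLE f U V hV a) =
        X.presheaf.germ ((Opens.map f.mor.hom.base).obj V.1) x (hV hx)
          (f.mor.hom.c.app (op V.1) a) :=
      TopCat.Presheaf.germ_res_apply X.presheaf (homOfLE hV) x hx _
    rw [h1]
    constructor
    · intro h2
      have := h2.map (f.mor.hom.stalkMap x).hom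
      exact (PresheafedSpace.stalkMap_germ_apply f.mor.hom V.1 x (hV hx) a) ▸ this
    · exact (isLocalMor_iff f.mor).1 f.isLocal x V.1 (hV hx) a

end Points

/-! ### Base extension of affine schemes and of open immersions -/

section Affine

lemma range_isIso_comp {T T' T'' : Scheme.{u}} (e : T ⟶ T') [IsIso e] (h : T' ⟶ T'') :
    Set.range (e ≫ h) = Set.range h := by
  ext z
  constructor
  · rintro ⟨y, rfl⟩
    exact ⟨e y, by rw [← Scheme.Hom.comp_apply]⟩
  · rintro ⟨y, rfl⟩
    exact ⟨inv e y, by rw [← Scheme.Hom.comp_apply, IsIso.inv_hom_id_assoc]⟩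

variable {X : MonoidScheme.{u}} {A B L : CommMonCat.{u}}

/-- The morphism `Spec B ⟶ Spec A` induced by `A ⟶ B`. -/
def specMap (φ : A ⟶ B) : specObj B ⟶ specObj A := Spec.{u}.map φ.op

/-- The affine open subset `Spec A` of `Spec A`. -/
def topAff (A : CommMonCat.{u}) : (specObj A).AffOpens :=
  ⟨⊤, A, ⟨(specSpace A).restrictTopIso⟩⟩

/-- The whole space is the greatest affine open subset of `Spec A`, so the colimit is the value of
the diagram there. -/
instance isIso_zChart_topAff (A : CommMonCat.{u}) : IsIso ((specObj A).zChart (topAff A)) :=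
  isIso_ι_of_isTerminal (j := topAff A) (IsTerminal.ofUniqueHom
    (fun U => homOfLE (show U ≤ topAff A from fun _ _ => trivial)) (fun _ _ => rfl)) (specObj A).zDiagram

/-- The isomorphism `Γ(Spec A) ≅ A`. -/
def globalIso (A : CommMonCat.{u}) : (specObj A).presheaf.obj (op (topAff A).1) ≅ A :=
  (globalEquiv A).symm.toCommMonCatIso

/-- The isomorphism `Spec ℤ[A] ⟶ (Spec A) ⊗ ℤ`. -/
def zSpec (A : CommMonCat.{u}) : AlgebraicGeometry.Spec (zExt.obj A) ⟶ (specObj A).zObj :=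
  AlgebraicGeometry.Spec.map (zExt.map (globalIso A).hom) ≫ (specObj A).zChart (topAff A)

instance (A : CommMonCat.{u}) : IsIso (zSpec A) := by
  unfold zSpec
  infer_instance

lemma appLE_spec_map (φ : A ⟶ B) :
    appLE (specMap φ) (topAff B) (topAff A) le_top ≫
      (globalIso B).hom = (globalIso A).hom ≫ φ := by
  rw [← Iso.inv_comp_eq]
  ext a
  refine (congr_arg (globalEquiv B).symm ?_).trans ((globalEquiv B).symm_apply_apply (φ.hom a))
  exact DFunLike.congr_fun (globalHom_specSpaceMap φ) a

lemma zSpec_zMap (φ : A ⟶ B) :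
    zSpec B ≫ zMap (specMap φ) =
      AlgebraicGeometry.Spec.map (zExt.map φ) ≫ zSpec A := by
  rw [zSpec, zSpec, Category.assoc]
  refine (congr_arg _ (zChart_zMap (specMap φ) (topAff B) (topAff A) le_top)).trans ?_
  rw [← AlgebraicGeometry.Spec.map_comp_assoc, ← AlgebraicGeometry.Spec.map_comp_assoc,
    ← Functor.map_comp, ← Functor.map_comp, appLE_spec_map]

/-- `Spec` of rings turns the push-out `isPushout_zExt_tensor` into a pullback, which is carried
over by the natural isomorphisms `zSpec`. -/
lemma isPullback_zMap_spec_tensor (φ : L ⟶ A) (ψ : L ⟶ B) :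
    IsPullback (zMap (specMap (tensorInl φ ψ))) (zMap (specMap (tensorInr φ ψ)))
      (zMap (specMap φ)) (zMap (specMap ψ)) :=
  IsPullback.of_iso (isPullback_SpecMap_of_isPushout _ _ _ _ (isPushout_zExt_tensor φ ψ))
    (asIso (zSpec _)) (asIso (zSpec A)) (asIso (zSpec B)) (asIso (zSpec L))
    (zSpec_zMap _).symm (zSpec_zMap _).symm (zSpec_zMap _).symm (zSpec_zMap _).symm

variable {i : specObj A ⟶ X} (hi : SheafedSpace.IsOpenImmersion i.mor)

/-- The image of an affine chart. -/
def chartAff : X.AffOpens :=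
  ⟨⟨Set.range i.mor.hom.base, hi.base_open.isOpen_range⟩,
    @isAffineOpen_of_isOpenImmersion _ A i.mor hi _ rfl⟩

lemma top_le_chartAff : (topAff A).1 ≤ (Opens.map i.mor.hom.base).obj (chartAff hi).1 :=
  fun x _ => ⟨x, rfl⟩

lemma isIso_appLE_chartAff : IsIso (appLE i (topAff A) (chartAff hi) (top_le_chartAff hi)) := by
  have h1 : IsIso (i.mor.hom.c.app (op (chartAff hi).1)) :=
    PresheafedSpace.IsOpenImmersion.c_iso' i.mor.hom ⊤ (Opens.ext Set.image_univ.symm)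
  have h2 : IsIso ((specObj A).presheaf.map (homOfLE (top_le_chartAff hi)).op) := by
    have : IsIso (homOfLE (top_le_chartAff hi)) :=
      ⟨homOfLE le_top, Subsingleton.elim _ _, Subsingleton.elim _ _⟩
    infer_instance
  exact IsIso.comp_isIso

lemma zMap_chart_eq :
    (specObj A).zChart (topAff A) ≫ zMap i =
      AlgebraicGeometry.Spec.map (zExt.map (appLE i (topAff A) (chartAff hi) (top_le_chartAff hi))) ≫
        X.zChart (chartAff hi) :=
  zChart_zMap i (topAff A) (chartAff hi) (top_le_chartAff hi)

include hi

/-- A chart is an isomorphism onto its image, so its base extension is, up to an isomorphism of the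
source, the chart of `X ⊗ ℤ` belonging to that image. Openness and the description of the range
follow from those of `zChart`. -/
lemma exists_isIso_zMap_chart :
    ∃ e : (specObj A).zObj ⟶ _, IsIso e ∧ zMap i = e ≫ X.zChart (chartAff hi) := by
  have := isIso_appLE_chartAff hi
  refine ⟨inv ((specObj A).zChart (topAff A)) ≫ AlgebraicGeometry.Spec.map (zExt.map
    (appLE i (topAff A) (chartAff hi) (top_le_chartAff hi))), inferInstance, ?_⟩
  rw [Category.assoc, ← zMap_chart_eq, IsIso.inv_hom_id_assoc]

lemma isOpenImmersion_zMap : IsOpenImmersion (zMap i) := by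
  obtain ⟨e, he, h⟩ := exists_isIso_zMap_chart hi
  rw [h]
  infer_instance

lemma Over.mem_range_zMap_iff {t : X.zObj} {x : X.toSheafedSpace} (h : Over t x) :
    t ∈ Set.range (zMap i) ↔ x ∈ Set.range i.mor.hom.base := by
  obtain ⟨e, he, h'⟩ := exists_isIso_zMap_chart hi
  refine Iff.trans ?_ (h.mem_range_zChart_iff (chartAff hi))
  rw [h', range_isIso_comp]

end Affine

end

end MonoidScheme

namespace MonoidScheme

open FOne

/-! ### Base extension of fibre products -/

section BaseExtension

/-- A morphism of schemes is an isomorphism if it is so locally on the target. -/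
lemma isIso_of_forall_exists_isPullback {P Q : Scheme.{u}} (h : P ⟶ Q)
    (H : ∀ z : Q, ∃ (T : Scheme.{u}) (k : T ⟶ P) (c : T ⟶ Q), IsOpenImmersion c ∧
      z ∈ Set.range c ∧ IsPullback (𝟙 T) k c h) : IsIso h := by
  choose T k c hc hz hp using H
  let 𝒰 : Q.OpenCover :=
    { I₀ := Q
      X := T
      f := c
      mem₀ := by
        rw [Scheme.presieve₀_mem_precoverage_iff]
        exact ⟨fun z => ⟨z, hz z⟩, hc⟩ }
  refine (IsZariskiLocalAtTarget.iff_of_openCover (P := MorphismProperty.isomorphisms Scheme.{u})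
    𝒰).2 fun z => ?_
  change IsIso (pullback.snd h (c z))
  -- By the given square, the base change of `h` along `c z` is isomorphic to an identity.
  rw [← (hp z).flip.isoPullback_inv_snd]
  infer_instance

variable {X Y S : MonoidScheme.{u}} (f : X ⟶ S) (g : Y ⟶ S)

lemma zMap_comp {X Y Z : MonoidScheme.{u}} (f : X ⟶ Y) (g : Y ⟶ Z) :
    zMap (f ≫ g) = zMap f ≫ zMap g :=
  baseExtension.{u}.map_comp f g

/-- Around each point of the fibre product of schemes there are compatible affine charts. Over them
both sides are `Spec` of the same push-out of rings, and the chart of the source is the whole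
inverse image of the chart of the target. -/
lemma isPullback_zMap_fibreProduct :
    IsPullback (zMap (fibreFst f g)) (zMap (fibreSnd f g)) (zMap f) (zMap g) := by
  have w : zMap (fibreFst f g) ≫ zMap f = zMap (fibreSnd f g) ≫ zMap g := by
    rw [← zMap_comp, ← zMap_comp, (isPullback_fibreProduct f g).w]
  let h := pullback.lift _ _ w
  have h1 : h ≫ pullback.fst _ _ = zMap (fibreFst f g) := pullback.lift_fst _ _ _
  have h2 : h ≫ pullback.snd _ _ = zMap (fibreSnd f g) := pullback.lift_snd _ _ _
  suffices IsIso h from .of_iso_pullback ⟨w⟩ (asIso h) h1 h2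
  refine isIso_of_forall_exists_isPullback h fun z => ?_
  obtain ⟨x, hx⟩ := exists_over (pullback.fst (zMap f) (zMap g) z)
  obtain ⟨y, hy⟩ := exists_over (pullback.snd (zMap f) (zMap g) z)
  -- The images of `x` and `y` both lie below the common image of `z` in `S ⊗ ℤ`, so they have the
  -- same neighbourhoods; their equality is not needed to find charts.
  have hxy (W : Opens S.toSheafedSpace) (hW : f.mor.hom.base x ∈ W) : g.mor.hom.base y ∈ W := by
    refine Over.mem_of_mem (over_zMap hx f) ?_ W hW
    have := over_zMap hy g
    rwa [← Scheme.Hom.comp_apply, ← pullback.condition, Scheme.Hom.comp_apply] at this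
  obtain ⟨L, A, B, φ, ψ, i, j, l, hi, hj, hl, hφ, hψ, hxi, hyj⟩ := exists_charts f g x y hxy
  obtain ⟨k, hk, k1, k2, hr⟩ := exists_fibreProduct_chart hi hj hl hφ hψ
  have := isOpenImmersion_zMap hi
  have := isOpenImmersion_zMap hj
  have := isOpenImmersion_zMap hl
  have := isOpenImmersion_zMap hk
  have e1 : zMap (specMap φ) ≫ zMap l = zMap i ≫ zMap f := by
    rw [← zMap_comp, ← zMap_comp]
    exact congr_arg zMap hφ
  have e2 : zMap (specMap ψ) ≫ zMap l = zMap j ≫ zMap g := by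
    rw [← zMap_comp, ← zMap_comp]
    exact congr_arg zMap hψ
  have e3 : zMap k ≫ zMap (fibreFst f g) = zMap (specMap (tensorInl φ ψ)) ≫ zMap i := by
    rw [← zMap_comp, ← zMap_comp]
    exact congr_arg zMap k1
  have e4 : zMap k ≫ zMap (fibreSnd f g) = zMap (specMap (tensorInr φ ψ)) ≫ zMap j := by
    rw [← zMap_comp, ← zMap_comp]
    exact congr_arg zMap k2
  -- `c` maps the fibre product of the extended charts to that of the whole schemes; `e` identifies
  -- its source with the base extension of `Spec (A ⊗_L B)`.
  let c := pullback.map _ _ _ _ (zMap i) (zMap j) (zMap l) e1 e2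
  let e := (isPullback_zMap_spec_tensor φ ψ).isoPullback
  have he1 : e.hom ≫ pullback.fst _ _ = _ := IsPullback.isoPullback_hom_fst _
  have he2 : e.hom ≫ pullback.snd _ _ = _ := IsPullback.isoPullback_hom_snd _
  have hc : zMap k ≫ h = e.hom ≫ c := by
    refine pullback.hom_ext ?_ ?_
    · rw [Category.assoc, h1, e3, Category.assoc, pullback.lift_fst, ← Category.assoc, he1]
    · rw [Category.assoc, h2, e4, Category.assoc, pullback.lift_snd, ← Category.assoc, he2]
  have hcr (z) : z ∈ Set.range (e.hom ≫ c) ↔ pullback.fst (zMap f) (zMap g) z ∈ Set.range (zMap i) ∧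
      pullback.snd (zMap f) (zMap g) z ∈ Set.range (zMap j) := by
    rw [range_isIso_comp]
    exact Set.ext_iff.1 (Scheme.Pullback.range_map _ _ _ _ _ _ _ e1 e2) z
  -- For open immersions the square is a pullback once the inverse image under `h` of the range of
  -- `e.hom ≫ c` is the range of `zMap k`; this is verified on the points below.
  refine ⟨_, zMap k, e.hom ≫ c, inferInstance, (hcr z).2 ⟨?_, ?_⟩,
    IsOpenImmersion.isPullback _ _ _ _ (hc.trans (Category.id_comp _).symm) ?_⟩
  · exact (Over.mem_range_zMap_iff hi hx).2 hxi
  · exact (Over.mem_range_zMap_iff hj hy).2 hyj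
  · ext t
    obtain ⟨w, hw⟩ := exists_over t
    have t1 := Over.mem_range_zMap_iff hi (over_zMap hw (fibreFst f g))
    have t2 := Over.mem_range_zMap_iff hj (over_zMap hw (fibreSnd f g))
    have t3 := Over.mem_range_zMap_iff hk hw
    rw [← h1, Scheme.Hom.comp_apply] at t1
    rw [← h2, Scheme.Hom.comp_apply] at t2
    refine (hcr (h t)).trans (Iff.trans ?_ t3.symm)
    rw [t1, t2, hr]
    rfl

end BaseExtension

end MonoidScheme

theorem mainTheorem5 :
    -- existence, universal property and uniqueness of the fibre product
    (∀ (X Y S : MonoidScheme.{u}) (f : X ⟶ S) (g : Y ⟶ S),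
      ∃ (P : MonoidScheme.{u}) (p : P ⟶ X) (q : P ⟶ Y),
        IsPullback p q f g ∧
        ∀ (P' : MonoidScheme.{u}) (p' : P' ⟶ X) (q' : P' ⟶ Y), IsPullback p' q' f g →
          ∃! e : P' ≅ P, e.hom ≫ p = p' ∧ e.hom ≫ q = q') ∧
    -- the affine case
    (∀ (L A : CommMonCat.{u})
      (f : MonoidScheme.Spec.{u}.obj (op A) ⟶ MonoidScheme.Spec.{u}.obj (op L)),
      ∃! φ : L ⟶ A, MonoidScheme.Spec.{u}.map φ.op = f) ∧
    (∀ (L A B : CommMonCat.{u}) (φ : L ⟶ A) (ψ : L ⟶ B),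
      IsPushout φ ψ (FOne.tensorInl φ ψ) (FOne.tensorInr φ ψ) ∧
      IsPullback
        (MonoidScheme.Spec.{u}.map (FOne.tensorInl φ ψ).op)
        (MonoidScheme.Spec.{u}.map (FOne.tensorInr φ ψ).op)
        (MonoidScheme.Spec.{u}.map φ.op)
        (MonoidScheme.Spec.{u}.map ψ.op)) ∧
    -- compatibility with base extension to `ℤ`
    (∀ (P X Y S : MonoidScheme.{u}) (p : P ⟶ X) (q : P ⟶ Y) (f : X ⟶ S) (g : Y ⟶ S),
      IsPullback p q f g →
      IsPullback
        (MonoidScheme.baseExtension.{u}.map p)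
        (MonoidScheme.baseExtension.{u}.map q)
        (MonoidScheme.baseExtension.{u}.map f)
        (MonoidScheme.baseExtension.{u}.map g)) := by
  refine ⟨fun X Y S f g => ?_, fun L A f => MonoidScheme.existsUnique_spec_map f,
    fun L A B φ ψ => ⟨FOne.isPushout_tensor φ ψ, MonoidScheme.isPullback_spec_tensor φ ψ⟩,
    fun P X Y S p q f g h => ?_⟩
  · have h := MonoidScheme.isPullback_fibreProduct f g
    exact ⟨_, _, _, h, fun P' p' q' h' => MonoidScheme.existsUnique_iso_of_isPullback h h'⟩
  · have h' := MonoidScheme.isPullback_fibreProduct f g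
    -- An arbitrary fibre product is isomorphic to the constructed one compatibly with the
    -- projections, and the functor carries this isomorphism to the base extensions.
    refine IsPullback.of_iso (MonoidScheme.isPullback_zMap_fibreProduct f g)
      (MonoidScheme.baseExtension.{u}.mapIso (h'.isoIsPullback _ _ h)) (Iso.refl _) (Iso.refl _)
      (Iso.refl _) ?_ ?_ ?_ ?_
    · refine (Category.comp_id _).trans ?_
      refine Eq.trans ?_ (MonoidScheme.baseExtension.{u}.map_comp _ _)
      rw [h'.isoIsPullback_hom_fst]
      rfl
    · refine (Category.comp_id _).trans ?_
      refine Eq.trans ?_ (MonoidScheme.baseExtension.{u}.map_comp _ _)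
      rw [h'.isoIsPullback_hom_snd]
      rfl
    · exact (Category.comp_id _).trans (Category.id_comp _).symm
    · exact (Category.comp_id _).trans (Category.id_comp _).symm
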